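/- Let $K$ be an algebraically closed field of characteristic $0$ and let $\mathfrak g=\mathfrak g_0\oplus\mathfrak g_1$ be a finite dimensional Lie superalgebra over $K$. All representations are $\mathbb Z/2$-graded, of arbitrary dimension, and a representation is called simple if it is nonzero and has no graded subrepresentations other than $0$ and itself; $\mathcal U(\cdot)$ denotes the universal enveloping superalgebra. Let $\mathfrak k$ be a (graded) ideal of $\mathfrak g$ and let $\sigma:\mathfrak k\to\mathcal End(U)$ be a simple representation of $\mathfrak k$. Let $\mathfrak h=\mathfrak{st}(\sigma,\mathfrak g)$ be the stabilizer of $\sigma$, that is, the span of all homogeneous $y\in\mathfrak g$ for which there is a homogeneous $s\in\mathcal End(U)$ of the same degree as $y$ with $\sigma([y,x])=[s,\sigma(x)]$ (supercommutator) for all homogeneous $x\in\mathfrak k$; it is a subalgebra of $\mathfrak g$ containing $\mathfrak k$. Let $W$ be a simple representation of $\mathfrak h$ whose restriction to $\mathfrak k$ is a direct sum of copies of $U$, where each copy is taken up to parity (each summand is isomorphic to $U$ or to the parity changed representation $\Pi U$). Then the induced representation $\mathrm{ind}(W,\mathfrak g)=\mathcal U(\mathfrak g)\otimes_{\mathcal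 U(\mathfrak h)}W$ of $\mathfrak g$ is simple. -/

import Mathlib

open scoped TensorProduct

noncomputable section

universe w

/-! # Super vector spaces -/

/-- The Koszul sign `(-1)^{ij}` attached to two parities. -/
def koszulSign (K : Type*) [Field K] (i j : ZMod 2) : K := (-1) ^ (i.val * j.val)

theorem zmodTwo_cases (i : ZMod 2) : i = 0 ∨ i = 1 := by
  revert i; decide

section sign

variable (K : Type*) [Field K]

@[simp] theorem koszulSign_zero_left (j : ZMod 2) : koszulSign K 0 j = 1 := by
  simp [koszulSign]

@[simp] theorem koszulSign_zero_right (j : ZMod 2) : koszulSign K j 0 = 1 := by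
  simp [koszulSign]

@[simp] theorem koszulSign_one_one : koszulSign K 1 1 = -1 := by
  simp [koszulSign, ZMod.val_one]

end sign

theorem zmodTwo_one_add_one : (1 : ZMod 2) + 1 = 0 := by decide

/-- A super vector space: a vector space `V` with a `ℤ/2`-grading `V = V₀ ⊕ V₁`. -/
class SuperSpace (K : Type*) (V : Type*) [Field K] [AddCommGroup V] [Module K V] where
  /-- the homogeneous components -/
  deg : ZMod 2 → Submodule K V
  isCompl : IsCompl (deg 0) (deg 1)

open SuperSpace (deg)

section superSpace

variable {K : Type*} {V : Type*} [Field K] [AddCommGroup V] [Module K V] [SuperSpace K V]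

/-- Every vector is the sum of an even and of an odd vector. -/
theorem SuperSpace.exists_add (K : Type*) {V : Type*} [Field K] [AddCommGroup V] [Module K V]
    [SuperSpace K V] (v : V) :
    ∃ v₀ ∈ deg (K := K) (V := V) 0, ∃ v₁ ∈ deg (K := K) (V := V) 1, v₀ + v₁ = v := by
  have h : v ∈ deg (K := K) (V := V) 0 ⊔ deg (K := K) (V := V) 1 := by
    rw [SuperSpace.isCompl.sup_eq_top]; trivial
  exact Submodule.mem_sup.mp h

/-- A linear subspace `N` is a sub super vector space if it is the sum of its even and odd
parts. -/
def IsHomogeneousSub (N : Submodule K V) : Prop :=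
  N ≤ (N ⊓ deg 0) ⊔ (N ⊓ deg 1)

/-- A linear map is homogeneous of degree `i`. -/
def IsHomogeneousMap {V' : Type*} [AddCommGroup V'] [Module K V'] [SuperSpace K V']
    (i : ZMod 2) (f : V →ₗ[K] V') : Prop :=
  ∀ j : ZMod 2, ∀ v ∈ deg (K := K) (V := V) j, f v ∈ deg (K := K) (V := V') (i + j)

/-- The grading on a sub super vector space. -/
@[reducible] def IsHomogeneousSub.superSpace {N : Submodule K V} (hN : IsHomogeneousSub N) :
    SuperSpace K N where
  deg i := (deg i).comap N.subtype
  isCompl := by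
    constructor
    · rw [Submodule.disjoint_def]
      intro x h0 h1
      have := Submodule.disjoint_def.mp (SuperSpace.isCompl (K := K) (V := V)).disjoint x h0 h1
      exact Subtype.ext this
    · rw [codisjoint_iff, eq_top_iff]
      rintro ⟨x, hx⟩ -
      obtain ⟨a, ha, b, hb, hab⟩ := Submodule.mem_sup.mp (hN hx)
      exact Submodule.mem_sup.mpr ⟨⟨a, ha.1⟩, ha.2, ⟨b, hb.1⟩, hb.2, Subtype.ext hab⟩

/-- The parity map `v₀ + v₁ ↦ v₀ - v₁`. -/
def parityMap (K : Type*) (V : Type*) [Field K] [AddCommGroup V] [Module K V] [SuperSpace K V] :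
    V →ₗ[K] V :=
  (deg 0).projection (deg 1) SuperSpace.isCompl -
    (deg 1).projection (deg 0) SuperSpace.isCompl.symm

theorem parityMap_apply {i : ZMod 2} {v : V} (hv : v ∈ deg (K := K) i) :
    parityMap K V v = koszulSign K i 1 • v := by
  rcases zmodTwo_cases i with rfl | rfl
  · have h1 := Submodule.projection_apply_left
      (SuperSpace.isCompl (K := K) (V := V)) ⟨v, hv⟩
    have h2 := Submodule.projection_apply_right
      (SuperSpace.isCompl (K := K) (V := V)).symm ⟨v, hv⟩
    simp only at h1 h2
    simp [parityMap, h1, h2]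
  · have h1 := Submodule.projection_apply_left
      (SuperSpace.isCompl (K := K) (V := V)).symm ⟨v, hv⟩
    have h2 := Submodule.projection_apply_right
      (SuperSpace.isCompl (K := K) (V := V)) ⟨v, hv⟩
    simp only at h1 h2
    simp [parityMap, h1, h2]

/-- Two subspaces on which some linear map acts by `1`, respectively `-1`, are disjoint. -/
theorem disjoint_of_sign [CharZero K] {V : Type*} [AddCommGroup V] [Module K V]
    {D : ZMod 2 → Submodule K V} (f : V →ₗ[K] V)
    (hf : ∀ i, ∀ v ∈ D i, f v = koszulSign K i 1 • v) : Disjoint (D 0) (D 1) := by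
  rw [Submodule.disjoint_def]
  intro x h0 h1
  have e0 := hf 0 x h0
  have e1 := hf 1 x h1
  rw [koszulSign_zero_left, one_smul] at e0
  rw [koszulSign_one_one, neg_one_smul, e0] at e1
  have h2 : (2 : K) • x = 0 := by rw [two_smul]; nth_rewrite 1 [e1]; simp
  exact (smul_eq_zero.mp h2).resolve_left two_ne_zero

end superSpace

/-! # Lie superalgebras -/

/-- A Lie superalgebra structure on the super vector space `g` (over a field of characteristic
zero). -/
class LieSuperalgebra (K : Type*) (g : Type*) [Field K] [AddCommGroup g] [Module K g]
    [SuperSpace K g] where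
  /-- the bracket -/
  bracket : g →ₗ[K] g →ₗ[K] g
  br_mem : ∀ {i j : ZMod 2} {x y : g}, x ∈ deg (K := K) i → y ∈ deg (K := K) j →
    bracket x y ∈ deg (K := K) (i + j)
  skew : ∀ {i j : ZMod 2} {x y : g}, x ∈ deg (K := K) i → y ∈ deg (K := K) j →
    bracket x y = -(koszulSign K i j • bracket y x)
  jacobi : ∀ {i j l : ZMod 2} {x y z : g}, x ∈ deg (K := K) i → y ∈ deg (K := K) j →
    z ∈ deg (K := K) l →
    bracket x (bracket y z) = bracket (bracket x y) z + koszulSign K i j • bracket y (bracket x z)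

/-- The bracket of a Lie superalgebra, with the base field explicit. -/
abbrev LieSuperalgebra.br (K : Type*) {g : Type*} [Field K] [AddCommGroup g] [Module K g]
    [SuperSpace K g] [LieSuperalgebra K g] : g →ₗ[K] g →ₗ[K] g :=
  LieSuperalgebra.bracket

open LieSuperalgebra (br)

/-- A (graded) Lie subalgebra of a Lie superalgebra. -/
structure LieSubsuperalgebra (K : Type*) (g : Type*) [Field K] [AddCommGroup g] [Module K g]
    [SuperSpace K g] [LieSuperalgebra K g] extends Submodule K g where
  homogeneous : IsHomogeneousSub toSubmodule
  br_mem' : ∀ {x y : g}, x ∈ toSubmodule → y ∈ toSubmodule → br K x y ∈ toSubmodule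

section subalgebra

variable {K : Type*} {g : Type*} [Field K] [AddCommGroup g] [Module K g]
    [SuperSpace K g] [LieSuperalgebra K g]

instance : CoeSort (LieSubsuperalgebra K g) (Type _) := ⟨fun h => h.toSubmodule⟩

instance (h : LieSubsuperalgebra K g) : SuperSpace K h := h.homogeneous.superSpace

instance (h : LieSubsuperalgebra K g) : LieSuperalgebra K h where
  bracket := LinearMap.mk₂ K (fun x y => ⟨br K x.1 y.1, h.br_mem' x.2 y.2⟩)
    (fun _ _ _ => Subtype.ext (by simp)) (fun _ _ _ => Subtype.ext (by simp))
    (fun _ _ _ => Subtype.ext (by simp)) (fun _ _ _ => Subtype.ext (by simp))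
  br_mem hx hy := LieSuperalgebra.br_mem (K := K) (g := g) hx hy
  skew hx hy := Subtype.ext (LieSuperalgebra.skew (K := K) (g := g) hx hy)
  jacobi hx hy hz := Subtype.ext (LieSuperalgebra.jacobi (K := K) (g := g) hx hy hz)

/-- A subalgebra is an ideal if `[g, k] ⊆ k`. (Conversely every ideal is a subalgebra.) -/
def LieSubsuperalgebra.IsIdeal (k : LieSubsuperalgebra K g) : Prop :=
  ∀ x y : g, y ∈ k.toSubmodule → br K x y ∈ k.toSubmodule

end subalgebra

/-! # Representations -/

/-- A representation of the Lie superalgebra `g` on the super vector space `V`: an even linear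
map from `g` to `End(V)` carrying the bracket to the supercommutator. -/
structure SuperRep (K : Type*) (g : Type*) (V : Type*) [Field K] [AddCommGroup g] [Module K g]
    [SuperSpace K g] [LieSuperalgebra K g] [AddCommGroup V] [Module K V] [SuperSpace K V] where
  /-- the action -/
  act : g →ₗ[K] Module.End K V
  act_mem : ∀ {i : ZMod 2} {x : g}, x ∈ deg (K := K) i → IsHomogeneousMap (K := K) i (act x)
  act_br : ∀ {i j : ZMod 2} {x y : g}, x ∈ deg (K := K) i → y ∈ deg (K := K) j →
    act (br K x y) = act x * act y - koszulSign K i j • (act y * act x)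

namespace SuperRep

variable {K : Type*} {g : Type*} {V : Type*} [Field K] [AddCommGroup g] [Module K g]
    [SuperSpace K g] [LieSuperalgebra K g] [AddCommGroup V] [Module K V] [SuperSpace K V]

/-- A representation is simple if it is nonzero and its only (graded) subrepresentations are `0`
and itself. -/
def IsSimple (ρ : SuperRep K g V) : Prop :=
  Nontrivial V ∧ ∀ N : Submodule K V, IsHomogeneousSub N →
    (∀ x : g, ∀ v ∈ N, ρ.act x v ∈ N) → N = ⊥ ∨ N = ⊤

/-- Restriction of a representation of a subalgebra `h` to a smaller subalgebra `k`. -/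
def restrict {h k : LieSubsuperalgebra K g} (ρ : SuperRep K h V)
    (hkh : k.toSubmodule ≤ h.toSubmodule) : SuperRep K k V where
  act := ρ.act ∘ₗ Submodule.inclusion hkh
  act_mem {i x} hx := ρ.act_mem (i := i) (x := Submodule.inclusion hkh x) hx
  act_br {i j x y} hx hy := ρ.act_br (i := i) (j := j) (x := Submodule.inclusion hkh x)
    (y := Submodule.inclusion hkh y) hx hy

/-- `ρ` is a direct sum of copies of `σ`, each copy being taken up to parity: there is a linear
isomorphism `e : ⨁_{λ ∈ Λ} U ≃ W` whose restriction to the summand with index `λ` is homogeneous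
of some degree `d λ` and satisfies `f (x u) = (-1)^{|x| |f|} x f(u)`, that is, identifies the
corresponding subrepresentation of `W` with `U` if `d λ = 0`, and with the parity changed
representation `Π U` if `d λ = 1`. -/
def IsSumOfCopies {U : Type*} {W : Type w} [AddCommGroup U] [Module K U] [SuperSpace K U]
    [AddCommGroup W] [Module K W] [SuperSpace K W]
    (ρ : SuperRep K g W) (σ : SuperRep K g U) : Prop :=
  ∃ (Λ : Type w) (d : Λ → ZMod 2) (e : (Λ →₀ U) ≃ₗ[K] W),
    (∀ l : Λ, IsHomogeneousMap (K := K) (d l) (e.toLinearMap ∘ₗ Finsupp.lsingle l)) ∧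
    ∀ (l : Λ) (j : ZMod 2) (x : g), x ∈ deg (K := K) j → ∀ u : U,
      e (Finsupp.single l (σ.act x u)) =
        koszulSign K j (d l) • ρ.act x (e (Finsupp.single l u))

end SuperRep

/-! # The stabilizer of a representation of an ideal -/

section stabilizer

variable {K : Type*} {g : Type*} {U : Type*} [Field K] [AddCommGroup g] [Module K g]
    [SuperSpace K g] [LieSuperalgebra K g] [AddCommGroup U] [Module K U] [SuperSpace K U]

/-- A homogeneous `y` of degree `i` stabilizes `σ` if there is an endomorphism `s` of `U`,
homogeneous of degree `i`, such that `σ([y, x]) = [s, σ(x)]` (supercommutator) for all homogeneous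
`x ∈ k`. -/
def Stabilizes (k : LieSubsuperalgebra K g) (hk : k.IsIdeal) (σ : SuperRep K k U)
    (i : ZMod 2) (y : g) : Prop :=
  y ∈ deg (K := K) i ∧ ∃ s : Module.End K U, IsHomogeneousMap (K := K) i s ∧
    ∀ (j : ZMod 2) (x : k), x ∈ deg (K := K) j →
      σ.act ⟨br K y x.1, hk y x.1 x.2⟩ = s * σ.act x - koszulSign K i j • (σ.act x * s)

/-- The supercommutator of two endomorphisms stabilizing `σ`. -/
theorem Stabilizes.br {k : LieSubsuperalgebra K g} {hk : k.IsIdeal} {σ : SuperRep K k U}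
    {i i' : ZMod 2} {y y' : g} (h : Stabilizes k hk σ i y) (h' : Stabilizes k hk σ i' y') :
    Stabilizes k hk σ (i + i') (LieSuperalgebra.br K y y') := by
  obtain ⟨hy, s, hs, e⟩ := h
  obtain ⟨hy', s', hs', e'⟩ := h'
  refine ⟨LieSuperalgebra.br_mem hy hy', s * s' - koszulSign K i i' • (s' * s), ?_, ?_⟩
  · intro j v hv
    refine Submodule.sub_mem _ ?_ (Submodule.smul_mem _ _ ?_)
    · rw [add_assoc]; exact hs _ _ (hs' _ _ hv)
    · rw [add_comm i i', add_assoc]; exact hs' _ _ (hs _ _ hv)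
  · intro j x hx
    have hj := LieSuperalgebra.jacobi (K := K) hy hy' (z := x.1) hx
    have hx1 : (⟨LieSuperalgebra.br K y' x.1, hk y' x.1 x.2⟩ : k) ∈ deg (K := K) (i' + j) :=
      LieSuperalgebra.br_mem (K := K) (g := g) hy' hx
    have hx2 : (⟨LieSuperalgebra.br K y x.1, hk y x.1 x.2⟩ : k) ∈ deg (K := K) (i + j) :=
      LieSuperalgebra.br_mem (K := K) (g := g) hy hx
    have e1 := e _ _ hx1
    have e2 := e' _ _ hx2
    rw [e' _ _ hx] at e1
    rw [e _ _ hx] at e2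
    have key : (⟨LieSuperalgebra.br K (LieSuperalgebra.br K y y') x.1, hk _ x.1 x.2⟩ : k) =
        ⟨LieSuperalgebra.br K y (LieSuperalgebra.br K y' x.1), hk y _ (hk y' x.1 x.2)⟩ -
        koszulSign K i i' •
          ⟨LieSuperalgebra.br K y' (LieSuperalgebra.br K y x.1), hk y' _ (hk y x.1 x.2)⟩ :=
      Subtype.ext (by simp [hj])
    rw [key, map_sub, map_smul, e1, e2]
    rcases zmodTwo_cases i with rfl | rfl <;> rcases zmodTwo_cases i' with rfl | rfl <;>
      rcases zmodTwo_cases j with rfl | rfl <;>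
      simp [zmodTwo_one_add_one] <;> noncomm_ring

theorem stabilizes_of_mem {k : LieSubsuperalgebra K g} (hk : k.IsIdeal) (σ : SuperRep K k U)
    {i : ZMod 2} {y : g} (hy : y ∈ deg (K := K) i) (hyk : y ∈ k.toSubmodule) :
    Stabilizes k hk σ i y :=
  ⟨hy, σ.act ⟨y, hyk⟩, σ.act_mem (x := ⟨y, hyk⟩) hy, fun _ _ hx =>
    σ.act_br (x := ⟨y, hyk⟩) hy hx⟩

/-- The stabilizer of `σ` in `g`: the subspace spanned by the homogeneous elements stabilizing
`σ`. It is a subalgebra of `g`. -/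
def stabilizer (k : LieSubsuperalgebra K g) (hk : k.IsIdeal) (σ : SuperRep K k U) :
    LieSubsuperalgebra K g where
  toSubmodule := Submodule.span K {y | ∃ i, Stabilizes k hk σ i y}
  homogeneous := by
    refine Submodule.span_le.mpr ?_
    rintro y ⟨i, hy⟩
    rcases zmodTwo_cases i with rfl | rfl
    · exact Submodule.mem_sup_left ⟨Submodule.subset_span ⟨_, hy⟩, hy.1⟩
    · exact Submodule.mem_sup_right ⟨Submodule.subset_span ⟨_, hy⟩, hy.1⟩
  br_mem' {x y} hx hy := by
    change x ∈ Submodule.span K _ at hx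
    change y ∈ Submodule.span K _ at hy
    induction hx, hy using Submodule.span_induction₂ with
    | mem_mem x y hx hy =>
      obtain ⟨i, hx⟩ := hx
      obtain ⟨j, hy⟩ := hy
      exact Submodule.subset_span ⟨_, hx.br hy⟩
    | zero_left y hy => simp
    | zero_right x hx => simp
    | add_left x y z _ _ _ h1 h2 => simpa using add_mem h1 h2
    | add_right x y z _ _ _ h1 h2 => simpa using add_mem h1 h2
    | smul_left r x y _ _ h => simpa using Submodule.smul_mem _ r h
    | smul_right r x y _ _ h => simpa using Submodule.smul_mem _ r h

theorem le_stabilizer (k : LieSubsuperalgebra K g) (hk : k.IsIdeal) (σ : SuperRep K k U) :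
    k.toSubmodule ≤ (stabilizer k hk σ).toSubmodule := by
  intro x hx
  obtain ⟨a, ha, b, hb, rfl⟩ := Submodule.mem_sup.mp (k.homogeneous hx)
  exact add_mem (Submodule.subset_span ⟨0, stabilizes_of_mem hk σ ha.2 ha.1⟩)
    (Submodule.subset_span ⟨1, stabilizes_of_mem hk σ hb.2 hb.1⟩)

end stabilizer

/-! # The universal enveloping algebra -/

section enveloping

variable (K : Type*) (g : Type*) [Field K] [AddCommGroup g] [Module K g]
    [SuperSpace K g] [LieSuperalgebra K g]

/-- The defining relations `x ⊗ y - (-1)^{|x||y|} y ⊗ x = [x, y]`. -/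
inductive SuperEnvelopingRel : TensorAlgebra K g → TensorAlgebra K g → Prop
  | rel (i j : ZMod 2) (x y : g) (hx : x ∈ deg (K := K) i) (hy : y ∈ deg (K := K) j) :
    SuperEnvelopingRel
      (TensorAlgebra.ι K x * TensorAlgebra.ι K y -
        koszulSign K i j • (TensorAlgebra.ι K y * TensorAlgebra.ι K x))
      (TensorAlgebra.ι K (br K x y))

/-- The universal enveloping algebra of a Lie superalgebra. -/
def SuperEnveloping : Type _ := RingQuot (SuperEnvelopingRel K g)

namespace SuperEnveloping

instance : Ring (SuperEnveloping K g) := inferInstanceAs (Ring (RingQuot (SuperEnvelopingRel K g)))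

instance : Algebra K (SuperEnveloping K g) :=
  inferInstanceAs (Algebra K (RingQuot (SuperEnvelopingRel K g)))

/-- The quotient map from the tensor algebra. -/
def mk : TensorAlgebra K g →ₐ[K] SuperEnveloping K g :=
  RingQuot.mkAlgHom K (SuperEnvelopingRel K g)

/-- The canonical map `g → U(g)`. -/
def ι : g →ₗ[K] SuperEnveloping K g := (mk K g).toLinearMap ∘ₗ TensorAlgebra.ι K

variable {K g}

theorem ι_br {i j : ZMod 2} {x y : g} (hx : x ∈ deg (K := K) i) (hy : y ∈ deg (K := K) j) :
    ι K g (br K x y) = ι K g x * ι K g y - koszulSign K i j • (ι K g y * ι K g x) := by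
  have h := RingQuot.mkAlgHom_rel K (SuperEnvelopingRel.rel i j x y hx hy)
  change mk K g _ = mk K g _ at h
  rw [map_sub, map_smul, map_mul, map_mul] at h
  exact h.symm

/-- The universal property of the enveloping algebra. -/
def lift {A : Type*} [Ring A] [Algebra K A] (f : g →ₗ[K] A)
    (hf : ∀ (i j : ZMod 2) (x y : g), x ∈ deg (K := K) i → y ∈ deg (K := K) j →
      f (br K x y) = f x * f y - koszulSign K i j • (f y * f x)) :
    SuperEnveloping K g →ₐ[K] A :=
  RingQuot.liftAlgHom K ⟨TensorAlgebra.lift K f, by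
    rintro _ _ ⟨i, j, x, y, hx, hy⟩
    simp [hf i j x y hx hy]⟩

theorem lift_ι {A : Type*} [Ring A] [Algebra K A] (f : g →ₗ[K] A)
    (hf : ∀ (i j : ZMod 2) (x y : g), x ∈ deg (K := K) i → y ∈ deg (K := K) j →
      f (br K x y) = f x * f y - koszulSign K i j • (f y * f x)) (x : g) :
    lift f hf (ι K g x) = f x := by
  have h := RingQuot.liftAlgHom_mkAlgHom_apply K (TensorAlgebra.lift K f)
    (s := SuperEnvelopingRel K g) (by
      rintro _ _ ⟨i, j, x, y, hx, hy⟩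
      simp [hf i j x y hx hy]) (TensorAlgebra.ι K x)
  rw [TensorAlgebra.lift_ι_apply] at h
  exact h

/-- `U(g)` is generated by `g`: an induction principle. -/
theorem induction {P : SuperEnveloping K g → Prop}
    (halg : ∀ r : K, P (algebraMap K _ r)) (hι : ∀ x : g, P (ι K g x))
    (hmul : ∀ a b, P a → P b → P (a * b)) (hadd : ∀ a b, P a → P b → P (a + b))
    (a : SuperEnveloping K g) : P a := by
  obtain ⟨t, rfl⟩ : ∃ t, mk K g t = a := RingQuot.mkAlgHom_surjective K _ a
  induction t using TensorAlgebra.induction with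
  | algebraMap r => rw [AlgHom.commutes]; exact halg r
  | ι x => exact hι x
  | mul a b ha hb => rw [map_mul]; exact hmul _ _ ha hb
  | add a b ha hb => rw [map_add]; exact hadd _ _ ha hb

variable (K g) in
/-- `IsMonomial i a`: `a` is a product `x₁ ⋯ xₙ` of homogeneous elements of `g` whose degrees add
up to `i`. -/
inductive IsMonomial : ZMod 2 → SuperEnveloping K g → Prop
  | one : IsMonomial 0 1
  | mul (i j : ZMod 2) (x : g) (a : SuperEnveloping K g) (hx : x ∈ deg (K := K) i)
    (ha : IsMonomial j a) : IsMonomial (i + j) (ι K g x * a)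

variable (K g) in
/-- The homogeneous components of `U(g)`. -/
def component (i : ZMod 2) : Submodule K (SuperEnveloping K g) :=
  Submodule.span K {a | IsMonomial K g i a}

theorem ι_mul_mem {i j : ZMod 2} {x : g} {a : SuperEnveloping K g} (hx : x ∈ deg (K := K) i)
    (ha : a ∈ component K g j) : ι K g x * a ∈ component K g (i + j) := by
  change a ∈ Submodule.span K _ at ha
  induction ha using Submodule.span_induction with
  | mem a ha => exact Submodule.subset_span (IsMonomial.mul i j x a hx ha)
  | zero => simp
  | add a b _ _ h1 h2 => rw [mul_add]; exact add_mem h1 h2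
  | smul r a _ h => rw [mul_smul_comm]; exact Submodule.smul_mem _ r h

theorem ι_mul_mem_sup (x : g) {a : SuperEnveloping K g}
    (ha : a ∈ component K g 0 ⊔ component K g 1) :
    ι K g x * a ∈ component K g 0 ⊔ component K g 1 := by
  obtain ⟨a₀, h₀, a₁, h₁, rfl⟩ := Submodule.mem_sup.mp ha
  obtain ⟨x₀, hx₀, x₁, hx₁, rfl⟩ := SuperSpace.exists_add K x
  rw [map_add, add_mul, mul_add, mul_add]
  have h00 := ι_mul_mem hx₀ h₀
  have h01 := ι_mul_mem hx₀ h₁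
  have h10 := ι_mul_mem hx₁ h₀
  have h11 := ι_mul_mem hx₁ h₁
  simp only [add_zero, zero_add, zmodTwo_one_add_one] at h00 h01 h10 h11
  exact add_mem (add_mem (Submodule.mem_sup_left h00) (Submodule.mem_sup_right h01))
    (add_mem (Submodule.mem_sup_right h10) (Submodule.mem_sup_left h11))

theorem sup_component : component K g 0 ⊔ component K g 1 = ⊤ := by
  rw [eq_top_iff]
  have main : ∀ a b : SuperEnveloping K g, b ∈ component K g 0 ⊔ component K g 1 →
      a * b ∈ component K g 0 ⊔ component K g 1 := by
    intro a
    induction a using SuperEnveloping.induction with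
    | halg r => intro b hb; rw [← Algebra.smul_def]; exact Submodule.smul_mem _ r hb
    | hι x => intro b hb; exact ι_mul_mem_sup x hb
    | hmul a a' h h' => intro b hb; rw [mul_assoc]; exact h _ (h' _ hb)
    | hadd a a' h h' => intro b hb; rw [add_mul]; exact add_mem (h _ hb) (h' _ hb)
  intro a _
  simpa using main a 1 (Submodule.mem_sup_left (Submodule.subset_span IsMonomial.one))

variable (K g) in
/-- The parity automorphism of `U(g)`. -/
def parity : SuperEnveloping K g →ₐ[K] SuperEnveloping K g :=
  lift (ι K g ∘ₗ parityMap K g) (by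
    intro i j x y hx hy
    simp only [LinearMap.comp_apply, parityMap_apply hx, parityMap_apply hy,
      parityMap_apply (LieSuperalgebra.br_mem hx hy), map_smul, ι_br hx hy]
    rcases zmodTwo_cases i with rfl | rfl <;> rcases zmodTwo_cases j with rfl | rfl <;>
      simp [zmodTwo_one_add_one] <;> noncomm_ring)

theorem parity_ι (x : g) : parity K g (ι K g x) = ι K g (parityMap K g x) :=
  lift_ι _ _ _

theorem parity_apply {i : ZMod 2} {a : SuperEnveloping K g} (ha : a ∈ component K g i) :
    parity K g a = koszulSign K i 1 • a := by
  change a ∈ Submodule.span K _ at ha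
  induction ha using Submodule.span_induction with
  | mem a ha =>
    induction ha with
    | one => simp
    | mul i j x a hx _ ih =>
      rw [map_mul, parity_ι, parityMap_apply hx, ih, map_smul]
      rcases zmodTwo_cases i with rfl | rfl <;> rcases zmodTwo_cases j with rfl | rfl <;>
        simp [zmodTwo_one_add_one]
  | zero => simp
  | add a b _ _ h1 h2 => rw [map_add, h1, h2, smul_add]
  | smul r a _ h => rw [map_smul, h, smul_comm]

instance [CharZero K] : SuperSpace K (SuperEnveloping K g) where
  deg := component K g
  isCompl := ⟨disjoint_of_sign (parity K g).toLinearMap (fun _ _ hv => parity_apply hv),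
    codisjoint_iff.mpr sup_component⟩

/-- The algebra map `U(h) → U(g)` induced by the inclusion of a subalgebra `h`. -/
def incl (h : LieSubsuperalgebra K g) : SuperEnveloping K h →ₐ[K] SuperEnveloping K g :=
  lift (ι K g ∘ₗ h.toSubmodule.subtype) (fun _ _ _ _ hx hy => ι_br (K := K) (g := g) hx hy)

theorem incl_ι (h : LieSubsuperalgebra K g) (x : h) :
    incl h (ι K h x) = ι K g x.1 := lift_ι _ _ _

theorem parityMap_sub (h : LieSubsuperalgebra K g) (x : h) :
    (parityMap K h x).1 = parityMap K g x.1 := by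
  obtain ⟨x₀, h₀, x₁, h₁, rfl⟩ := SuperSpace.exists_add K x
  have h₀' : x₀.1 ∈ deg (K := K) (V := g) 0 := h₀
  have h₁' : x₁.1 ∈ deg (K := K) (V := g) 1 := h₁
  rw [map_add, parityMap_apply h₀, parityMap_apply h₁, Submodule.coe_add, Submodule.coe_add,
    map_add, parityMap_apply h₀', parityMap_apply h₁']
  simp

theorem parity_incl (h : LieSubsuperalgebra K g) (b : SuperEnveloping K h) :
    parity K g (incl h b) = incl h (parity K h b) := by
  induction b using SuperEnveloping.induction with
  | halg r => simp
  | hι x => rw [incl_ι, parity_ι, parity_ι, incl_ι, parityMap_sub]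
  | hmul a b ha hb => simp [ha, hb]
  | hadd a b ha hb => simp [ha, hb]

end SuperEnveloping

end enveloping

/-! # Induced representations -/

namespace SuperRep

variable {K : Type*} {g : Type*} {W : Type*} [Field K] [AddCommGroup g] [Module K g]
    [SuperSpace K g] [LieSuperalgebra K g] [AddCommGroup W] [Module K W] [SuperSpace K W]

/-- The structure morphism `U(g) → End(W)` of a representation. -/
def structureMorphism (ρ : SuperRep K g W) : SuperEnveloping K g →ₐ[K] Module.End K W :=
  SuperEnveloping.lift ρ.act (fun _ _ _ _ hx hy => ρ.act_br hx hy)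

theorem structureMorphism_ι (ρ : SuperRep K g W) (x : g) :
    ρ.structureMorphism (SuperEnveloping.ι K g x) = ρ.act x :=
  SuperEnveloping.lift_ι _ _ _

theorem parityMap_act (ρ : SuperRep K g W) (x : g) (w : W) :
    parityMap K W (ρ.act x w) = ρ.act (parityMap K g x) (parityMap K W w) := by
  obtain ⟨x₀, hx₀, x₁, hx₁, rfl⟩ := SuperSpace.exists_add K x
  obtain ⟨w₀, hw₀, w₁, hw₁, rfl⟩ := SuperSpace.exists_add K w
  simp only [map_add, LinearMap.add_apply, parityMap_apply hx₀, parityMap_apply hx₁,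
    parityMap_apply hw₀, parityMap_apply hw₁, parityMap_apply (ρ.act_mem hx₀ _ _ hw₀),
    parityMap_apply (ρ.act_mem hx₀ _ _ hw₁), parityMap_apply (ρ.act_mem hx₁ _ _ hw₀),
    parityMap_apply (ρ.act_mem hx₁ _ _ hw₁)]
  simp [zmodTwo_one_add_one]

theorem parityMap_structureMorphism (ρ : SuperRep K g W) (a : SuperEnveloping K g) (w : W) :
    parityMap K W (ρ.structureMorphism a w) =
      ρ.structureMorphism (SuperEnveloping.parity K g a) (parityMap K W w) := by
  induction a using SuperEnveloping.induction generalizing w with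
  | halg r => simp
  | hι x => rw [SuperEnveloping.parity_ι, structureMorphism_ι, structureMorphism_ι, parityMap_act]
  | hmul a b ha hb => simp [ha, hb]
  | hadd a b ha hb => simp [ha, hb]

variable {h : LieSubsuperalgebra K g}

/-- The relations `a b ⊗ w = a ⊗ b w`, for `b ∈ U(h)`, that define `U(g) ⊗_{U(h)} W` as a quotient
of `U(g) ⊗_K W`. -/
def balancing (ρ : SuperRep K h W) : Submodule K (SuperEnveloping K g ⊗[K] W) :=
  Submodule.span K {t | ∃ (a : SuperEnveloping K g) (b : SuperEnveloping K h) (w : W),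
    t = (a * SuperEnveloping.incl h b) ⊗ₜ[K] w - a ⊗ₜ[K] (ρ.structureMorphism b w)}

/-- The space `U(g) ⊗_{U(h)} W`. -/
abbrev IndSpace (ρ : SuperRep K h W) : Type _ := (SuperEnveloping K g ⊗[K] W) ⧸ ρ.balancing

/-- The class of `a ⊗ w` in `U(g) ⊗_{U(h)} W`. -/
def indTmul (ρ : SuperRep K h W) (a : SuperEnveloping K g) (w : W) : ρ.IndSpace :=
  ρ.balancing.mkQ (a ⊗ₜ[K] w)

/-- The homogeneous components of `U(g) ⊗_{U(h)} W`: that of degree `n` is spanned by the classes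
of `a ⊗ w`, with `a`, `w` homogeneous and `|a| + |w| = n`. -/
def indComponent (ρ : SuperRep K h W) (n : ZMod 2) : Submodule K ρ.IndSpace :=
  Submodule.span K {t | ∃ (i j : ZMod 2) (a : SuperEnveloping K g) (w : W),
    a ∈ SuperEnveloping.component K g i ∧ w ∈ deg (K := K) j ∧ i + j = n ∧ t = ρ.indTmul a w}

/-- The parity map of `U(g) ⊗_{U(h)} W`. -/
def indParity (ρ : SuperRep K h W) : ρ.IndSpace →ₗ[K] ρ.IndSpace :=
  ρ.balancing.mapQ ρ.balancing
    (TensorProduct.map (SuperEnveloping.parity K g).toLinearMap (parityMap K W)) (by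
      refine Submodule.span_le.mpr ?_
      rintro _ ⟨a, b, w, rfl⟩
      refine Submodule.subset_span ⟨SuperEnveloping.parity K g a, SuperEnveloping.parity K h b,
        parityMap K W w, ?_⟩
      simp [SuperEnveloping.parity_incl, parityMap_structureMorphism])

theorem indParity_apply (ρ : SuperRep K h W) (n : ZMod 2) (t : ρ.IndSpace)
    (ht : t ∈ ρ.indComponent n) : ρ.indParity t = koszulSign K n 1 • t := by
  change t ∈ Submodule.span K _ at ht
  induction ht using Submodule.span_induction with
  | mem t ht =>
    obtain ⟨i, j, a, w, ha, hw, rfl, rfl⟩ := ht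
    have e : ρ.indParity (ρ.indTmul a w) =
      ρ.indTmul (SuperEnveloping.parity K g a) (parityMap K W w) := rfl
    rw [e, SuperEnveloping.parity_apply ha, parityMap_apply hw]
    simp only [indTmul, TensorProduct.smul_tmul', TensorProduct.tmul_smul]
    rcases zmodTwo_cases i with rfl | rfl <;> rcases zmodTwo_cases j with rfl | rfl <;>
      simp [zmodTwo_one_add_one, TensorProduct.neg_tmul]
  | zero => simp
  | add a b _ _ h1 h2 => rw [map_add, h1, h2, smul_add]
  | smul r a _ h => rw [map_smul, h, smul_comm]

theorem sup_indComponent (ρ : SuperRep K h W) : ρ.indComponent 0 ⊔ ρ.indComponent 1 = ⊤ := by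
  rw [eq_top_iff]
  intro t _
  obtain ⟨t, rfl⟩ := ρ.balancing.mkQ_surjective t
  induction t using TensorProduct.induction_on with
  | zero => simp
  | add a b ha hb => rw [map_add]; exact add_mem (ha trivial) (hb trivial)
  | tmul a w =>
    have ha : a ∈ SuperEnveloping.component K g 0 ⊔ SuperEnveloping.component K g 1 := by
      rw [SuperEnveloping.sup_component]; trivial
    obtain ⟨a₀, ha₀, a₁, ha₁, rfl⟩ := Submodule.mem_sup.mp ha
    obtain ⟨w₀, hw₀, w₁, hw₁, rfl⟩ := SuperSpace.exists_add K w
    rw [TensorProduct.add_tmul, TensorProduct.tmul_add, TensorProduct.tmul_add, map_add, map_add,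
      map_add]
    exact add_mem
      (add_mem
        (Submodule.mem_sup_left (Submodule.subset_span ⟨0, 0, a₀, w₀, ha₀, hw₀, rfl, rfl⟩))
        (Submodule.mem_sup_right (Submodule.subset_span ⟨0, 1, a₀, w₁, ha₀, hw₁, rfl, rfl⟩)))
      (add_mem
        (Submodule.mem_sup_right (Submodule.subset_span ⟨1, 0, a₁, w₀, ha₁, hw₀, rfl, rfl⟩))
        (Submodule.mem_sup_left (Submodule.subset_span ⟨1, 1, a₁, w₁, ha₁, hw₁,
          zmodTwo_one_add_one, rfl⟩)))

instance [CharZero K] (ρ : SuperRep K h W) : SuperSpace K ρ.IndSpace where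
  deg := ρ.indComponent
  isCompl := ⟨disjoint_of_sign ρ.indParity ρ.indParity_apply,
    codisjoint_iff.mpr ρ.sup_indComponent⟩

/-- Left multiplication by `c ∈ U(g)` on `U(g) ⊗_{U(h)} W`. -/
def indMul (ρ : SuperRep K h W) (c : SuperEnveloping K g) : Module.End K ρ.IndSpace :=
  ρ.balancing.mapQ ρ.balancing (LinearMap.rTensor W (LinearMap.mulLeft K c)) (by
    refine Submodule.span_le.mpr ?_
    rintro _ ⟨a, b, w, rfl⟩
    exact Submodule.subset_span ⟨c * a, b, w, by simp [mul_assoc]⟩)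

theorem indMul_indTmul (ρ : SuperRep K h W) (c a : SuperEnveloping K g) (w : W) :
    ρ.indMul c (ρ.indTmul a w) = ρ.indTmul (c * a) w := rfl

theorem ind_ext (ρ : SuperRep K h W) {f f' : Module.End K ρ.IndSpace}
    (hf : ∀ a w, f (ρ.indTmul a w) = f' (ρ.indTmul a w)) : f = f' := by
  refine Submodule.linearMap_qext _ (TensorProduct.ext' hf)

/-- The action of `g` on `U(g) ⊗_{U(h)} W` by left multiplication on the first factor. -/
def indAct (ρ : SuperRep K h W) : g →ₗ[K] Module.End K ρ.IndSpace where
  toFun x := ρ.indMul (SuperEnveloping.ι K g x)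
  map_add' x y := ρ.ind_ext fun a w => by
    rw [LinearMap.add_apply]
    simp only [indMul_indTmul, map_add, add_mul]
    simp only [indTmul, TensorProduct.add_tmul, map_add]
  map_smul' r x := ρ.ind_ext fun a w => by
    rw [RingHom.id_apply, LinearMap.smul_apply]
    simp only [indMul_indTmul, map_smul, smul_mul_assoc]
    simp only [indTmul, ← TensorProduct.smul_tmul', map_smul]

theorem indAct_indTmul (ρ : SuperRep K h W) (x : g) (a : SuperEnveloping K g) (w : W) :
    ρ.indAct x (ρ.indTmul a w) = ρ.indTmul (SuperEnveloping.ι K g x * a) w := rfl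

/-- The induced representation `ind(W, g) = U(g) ⊗_{U(h)} W`, on which `g` acts by left
multiplication on the first factor. -/
def ind [CharZero K] (ρ : SuperRep K h W) : SuperRep K g ρ.IndSpace where
  act := ρ.indAct
  act_mem {i x} hx j t ht := by
    change t ∈ Submodule.span K _ at ht
    change ρ.indAct x t ∈ ρ.indComponent (i + j)
    induction ht using Submodule.span_induction with
    | mem t ht =>
      obtain ⟨l, m, a, w, ha, hw, rfl, rfl⟩ := ht
      exact Submodule.subset_span ⟨i + l, m, _, w, SuperEnveloping.ι_mul_mem hx ha, hw,
        add_assoc _ _ _, rfl⟩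
    | zero => simp
    | add a b _ _ h1 h2 => rw [map_add]; exact add_mem h1 h2
    | smul r a _ h => rw [map_smul]; exact Submodule.smul_mem _ r h
  act_br {i j x y} hx hy := ρ.ind_ext fun a w => by
    rw [LinearMap.sub_apply, LinearMap.smul_apply, Module.End.mul_apply, Module.End.mul_apply]
    simp only [indAct_indTmul, SuperEnveloping.ι_br hx hy, sub_mul, smul_mul_assoc, mul_assoc]
    simp only [indTmul, TensorProduct.sub_tmul, ← TensorProduct.smul_tmul', map_sub, map_smul]

end SuperRep

end

/-! Filter `ind(W, g)` by the number of letters of `g` applied to `1 ⊗ W`. A graded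
subrepresentation `N` that meets the bottom layer `1 ⊗ W` nontrivially contains all of it, because
`W` is simple, and is then everything. So it is enough that a subrepresentation meeting one layer
nontrivially already meets the layer below (`inf_filt_succ_eq_bot`).

Suppose `N` contains nonzero elements of degree `n + 1` but none of lower degree. By a
Poincaré–Birkhoff–Witt theorem for induced modules (`exists_coef`), elements have coordinates in
`W`, indexed by ordered monomials in basis vectors completing a basis of `h`. As `k` is an ideal, it
acts on the top coordinates through `W` alone, up to sign. Hence this part of `N` embeds in a sum of
copies of `U` and contains a copy `T : U → N` (`exists_embedding`), normalised to be the identity in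
one coordinate, at a monomial `z_a β`.

Now compare the coordinates at `β`, one degree lower, in `T(x u) = ± x T(u)`. Moving `x ∈ k` through
a monomial leaves terms with `[z_b, x]`, so `∑ ± σ([z_b, x]) θ_b = ± σ(x) ψ - ψ σ(x)`, where the
`θ_b` are top coordinates of `T` and `ψ` is its coordinate at `β`. The `θ_b` are super endomorphisms
of `U`. By Schur's lemma the even ones are scalars, and the odd ones disappear on averaging with the
conjugate under an odd automorphism (`exists_stabilizes`). What remains says that some `y = ∑ c_b
z_b` stabilizes `σ`, that is, `y ∈ h`. But its coefficient at `z_a` is nonzero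
(`sum_insertIdx_ne_zero`) although `z_a` is not one of the basis vectors spanning `h`, a
contradiction.

Two tools are needed. Schur's lemma in arbitrary dimension (`exists_eq_smul`) is Quillen's argument,
resting on generic freeness (`exists_generic_basis`). The PBW theorem comes from Bergman's diamond
lemma (`exists_normalForm`), applied directly to `T(g) ⊗ W` with one further rule that lets a last
letter from `h` act on `W`; freeness of `U(g)` over `U(h)` is not used. -/

noncomputable section

/-! ### Generic freeness for operators that commute up to units and lower terms -/

section genericBasis

open Module

variable {A M ι : Type*} [CommRing A] [AddCommGroup M] [Module A M]

/-- The vector obtained by applying a word of operators to `u`. -/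
def wordApply (z : ι → End A M) (u : M) (l : List ι) : M := (l.map z).prod u

theorem wordApply_cons (z : ι → End A M) (u : M) (a : ι) (l : List ι) :
    wordApply z u (a :: l) = z a (wordApply z u l) := by
  simp [wordApply]

/-- The span of the words of length less than `n`. -/
def shortSpan (z : ι → End A M) (u : M) (n : ℕ) : Submodule A M :=
  Submodule.span A {v | ∃ l : List ι, l.length < n ∧ wordApply z u l = v}

theorem wordApply_mem_shortSpan (z : ι → End A M) (u : M) {l : List ι} {n : ℕ}
    (h : l.length < n) : wordApply z u l ∈ shortSpan z u n :=
  Submodule.subset_span ⟨l, h, rfl⟩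

theorem apply_mem_shortSpan (z : ι → End A M) (u : M) (a : ι) {n : ℕ} {v : M}
    (hv : v ∈ shortSpan z u n) : z a v ∈ shortSpan z u (n + 1) := by
  have h : shortSpan z u n ≤ (shortSpan z u (n + 1)).comap (z a) := by
    refine Submodule.span_le.mpr ?_
    rintro _ ⟨l, hl, rfl⟩
    rw [SetLike.mem_coe, Submodule.mem_comap, ← wordApply_cons]
    exact wordApply_mem_shortSpan z u (by simpa using hl)
  exact h hv

theorem shortSpan_mono (z : ι → End A M) (u : M) {m n : ℕ} (h : m ≤ n) :
    shortSpan z u m ≤ shortSpan z u n :=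
  Submodule.span_mono fun _ ⟨l, hl, e⟩ => ⟨l, hl.trans_le h, e⟩

/-- The operators commute up to units and up to linear combinations of the operators. -/
def CommuteUpTo (z : ι → End A M) : Prop :=
  ∀ a b, ∃ κ : Aˣ, z a * z b - (κ : A) • (z b * z a) ∈ Submodule.span A (Set.range z)

/-- Each adjacent swap costs a unit and a linear combination of the operators, which replaces two
letters by one. The error therefore always consists of strictly shorter words. -/
theorem wordApply_perm {z : ι → End A M} (u : M) (hz : CommuteUpTo z) {l l' : List ι}
    (h : l.Perm l') :
    ∃ κ : Aˣ, wordApply z u l - (κ : A) • wordApply z u l' ∈ shortSpan z u l.length := by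
  induction h with
  | nil => exact ⟨1, by simp⟩
  | @cons a l l' _ ih =>
    obtain ⟨κ, hκ⟩ := ih
    refine ⟨κ, ?_⟩
    have := apply_mem_shortSpan z u a hκ
    simpa [wordApply_cons] using this
  | swap a b l =>
    obtain ⟨κ, hκ⟩ := hz b a
    refine ⟨κ, ?_⟩
    have h : ∀ T ∈ Submodule.span A (Set.range z),
        T (wordApply z u l) ∈ shortSpan z u (l.length + 2) := by
      intro T hT
      induction hT using Submodule.span_induction with
      | mem T hT =>
        obtain ⟨c, rfl⟩ := hT
        rw [← wordApply_cons]
        exact wordApply_mem_shortSpan z u (by simp)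
      | zero => simp
      | add S T _ _ h1 h2 => exact add_mem h1 h2
      | smul r T _ h => exact Submodule.smul_mem _ r h
    simpa [wordApply_cons] using h _ hκ
  | @trans l₁ l₂ l₃ h₁ _ ih₁ ih₂ =>
    obtain ⟨κ₁, h₁'⟩ := ih₁
    obtain ⟨κ₂, h₂'⟩ := ih₂
    refine ⟨κ₁ * κ₂, ?_⟩
    rw [← h₁.length_eq] at h₂'
    have := add_mem h₁' (Submodule.smul_mem _ (κ₁ : A) h₂')
    rwa [smul_sub, sub_add_sub_cancel, smul_smul] at this

/-- The vector attached to a monomial. -/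
def monomialVec (z : ι → End A M) (u : M) (m : ι →₀ ℕ) : M :=
  wordApply z u (Finsupp.toMultiset m).toList

theorem wordApply_eq_monomialVec {z : ι → End A M} (u : M) (hz : CommuteUpTo z)
    {l : List ι} {m : ι →₀ ℕ} (h : (l : Multiset ι) = Finsupp.toMultiset m) :
    ∃ κ : Aˣ, wordApply z u l - (κ : A) • monomialVec z u m ∈ shortSpan z u l.length := by
  refine wordApply_perm u hz ?_
  rw [← Multiset.coe_eq_coe, h, Multiset.coe_toList]

theorem card_toMultiset_eq_degree (m : ι →₀ ℕ) :
    Multiset.card (Finsupp.toMultiset m) = m.degree := by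
  rw [Finsupp.card_toMultiset]; rfl

theorem shortSpan_le {z : ι → End A M} (u : M) (hz : CommuteUpTo z) (n : ℕ) :
    shortSpan z u n ≤ Submodule.span A (monomialVec z u '' {m | m.degree < n}) := by
  classical
  induction n using Nat.strong_induction_on with
  | _ n ih =>
    refine Submodule.span_le.mpr ?_
    rintro _ ⟨l, hl, rfl⟩
    obtain ⟨κ, hκ⟩ := wordApply_eq_monomialVec u hz (l := l)
      (m := Multiset.toFinsupp (l : Multiset ι)) (by simp)
    have hsub : monomialVec z u '' {m | m.degree < l.length} ⊆
        monomialVec z u '' {m | m.degree < n} :=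
      Set.image_mono fun m (hm : m.degree < l.length) => lt_trans hm hl
    have h1 := Submodule.span_mono hsub (ih _ hl hκ)
    have h2 : monomialVec z u (Multiset.toFinsupp (l : Multiset ι)) ∈
        Submodule.span A (monomialVec z u '' {m | m.degree < n}) := by
      refine Submodule.subset_span ⟨_, ?_, rfl⟩
      have : (Multiset.toFinsupp (l : Multiset ι)).degree = l.length := by
        rw [← card_toMultiset_eq_degree, Multiset.toFinsupp_toMultiset, Multiset.coe_card]
      simpa [this] using hl
    simpa using add_mem h1 (Submodule.smul_mem _ (κ : A) h2)

theorem apply_monomialVec {z : ι → End A M} (u : M) (hz : CommuteUpTo z) (i : ι) (m : ι →₀ ℕ) :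
    ∃ κ : Aˣ, z i (monomialVec z u m) - (κ : A) • monomialVec z u (m + Finsupp.single i 1) ∈
      shortSpan z u (m.degree + 1) := by
  obtain ⟨κ, hκ⟩ := wordApply_eq_monomialVec u hz (l := i :: (Finsupp.toMultiset m).toList)
    (m := m + Finsupp.single i 1) (by
      rw [← Multiset.cons_coe, Multiset.coe_toList, map_add, Finsupp.toMultiset_single,
        one_nsmul, ← Multiset.singleton_add, add_comm])
  refine ⟨κ, ?_⟩
  rw [wordApply_cons] at hκ
  rw [List.length_cons, Multiset.length_toList, card_toMultiset_eq_degree] at hκ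
  exact hκ

open scoped MonomialOrder in
/-- The span of the monomials smaller than `m`. -/
def lowerSpan [LinearOrder ι] [WellFoundedGT ι] (z : ι → End A M) (u : M) (m : ι →₀ ℕ) :
    Submodule A M :=
  Submodule.span A (monomialVec z u '' {m' | m' ≺[MonomialOrder.degLex] m})

open scoped MonomialOrder

variable [LinearOrder ι] [WellFoundedGT ι]

theorem degLex_lt_of_degree_lt {m m' : ι →₀ ℕ} (h : m.degree < m'.degree) :
    m ≺[MonomialOrder.degLex] m' := by
  rw [MonomialOrder.degLex_lt_iff, Finsupp.DegLex.lt_iff]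
  exact Or.inl h

theorem shortSpan_le_lowerSpan {z : ι → End A M} (u : M) (hz : CommuteUpTo z) (m : ι →₀ ℕ) :
    shortSpan z u m.degree ≤ lowerSpan z u m :=
  (shortSpan_le u hz _).trans
    (Submodule.span_mono (Set.image_mono fun _ h => degLex_lt_of_degree_lt h))

theorem apply_mem_lowerSpan {z : ι → End A M} (u : M) (hz : CommuteUpTo z) (i : ι) {m : ι →₀ ℕ}
    {v : M} (hv : v ∈ lowerSpan z u m) : z i v ∈ lowerSpan z u (m + Finsupp.single i 1) := by
  have h : lowerSpan z u m ≤ (lowerSpan z u (m + Finsupp.single i 1)).comap (z i) := by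
    refine Submodule.span_le.mpr ?_
    rintro _ ⟨m', hm', rfl⟩
    rw [SetLike.mem_coe, Submodule.mem_comap]
    obtain ⟨κ, hκ⟩ := apply_monomialVec u hz i m'
    have hlt : m' + Finsupp.single i 1 ≺[MonomialOrder.degLex] m + Finsupp.single i 1 := by
      simpa using hm'
    -- The order compares degrees first, so the shorter words produced when `z i` is sorted into
    -- place cannot compete with the leading monomial.
    have h1 : shortSpan z u (m'.degree + 1) ≤ lowerSpan z u (m + Finsupp.single i 1) := by
      refine le_trans ?_ (shortSpan_le_lowerSpan u hz _)
      refine shortSpan_mono z u ?_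
      have h2 := (MonomialOrder.degLex_lt_iff.mp hm')
      rw [Finsupp.DegLex.lt_iff] at h2
      rw [map_add]
      simp only [Finsupp.degree_single, add_le_add_iff_right]
      rcases h2 with h2 | h2
      · exact h2.le
      · exact h2.1.le
    simpa using add_mem (h1 hκ) (Submodule.smul_mem _ (κ : A)
      (Submodule.subset_span (s := monomialVec z u '' {m' | m' ≺[MonomialOrder.degLex]
        m + Finsupp.single i 1}) ⟨_, hlt, rfl⟩))
  exact h hv

/-- The monomials whose vector is torsion modulo the smaller ones. -/
def torsionSet (z : ι → End A M) (u : M) : Set (ι →₀ ℕ) :=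
  {m | ∃ a : A, a ≠ 0 ∧ a • monomialVec z u m ∈ lowerSpan z u m}

/-- Torsion passes to multiples of a monomial with the same annihilating scalar `a`. This is what
makes one scalar per minimal element of `torsionSet` sufficient. -/
theorem smul_monomialVec_add_single {z : ι → End A M} (u : M) (hz : CommuteUpTo z) {a : A}
    {m : ι →₀ ℕ} (h : a • monomialVec z u m ∈ lowerSpan z u m) (i : ι) :
    a • monomialVec z u (m + Finsupp.single i 1) ∈ lowerSpan z u (m + Finsupp.single i 1) := by
  obtain ⟨κ, hκ⟩ := apply_monomialVec u hz i m
  have h1 : shortSpan z u (m.degree + 1) ≤ lowerSpan z u (m + Finsupp.single i 1) := by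
    have := shortSpan_le_lowerSpan u hz (m + Finsupp.single i 1)
    rwa [map_add, Finsupp.degree_single] at this
  have h2 := apply_mem_lowerSpan u hz i h
  rw [map_smul] at h2
  have h3 := sub_mem h2 (Submodule.smul_mem _ a (h1 hκ))
  rw [← smul_sub, sub_sub_cancel, smul_comm] at h3
  have h4 := Submodule.smul_mem _ ((κ⁻¹ : Aˣ) : A) h3
  rwa [smul_smul, Units.inv_mul, one_smul] at h4

theorem smul_monomialVec_of_le {z : ι → End A M} (u : M) (hz : CommuteUpTo z) {a : A}
    {m m' : ι →₀ ℕ} (h : a • monomialVec z u m ∈ lowerSpan z u m) (hm : m ≤ m') :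
    a • monomialVec z u m' ∈ lowerSpan z u m' := by
  obtain ⟨d, rfl⟩ := exists_add_of_le hm
  clear hm
  induction d using Finsupp.induction_linear generalizing m with
  | zero => simpa using h
  | add d d' h1 h2 =>
    rw [← add_assoc]
    exact h2 (h1 h)
  | single i n =>
    induction n with
    | zero => simpa using h
    | succ n ih =>
      rw [Finsupp.single_add, ← add_assoc]
      exact smul_monomialVec_add_single u hz ih i

variable [IsDomain A] [Finite ι]

theorem exists_uniform_torsion {z : ι → End A M} (u : M) (hz : CommuteUpTo z) :
    ∃ f : A, f ≠ 0 ∧ ∀ m ∈ torsionSet z u, f • monomialVec z u m ∈ lowerSpan z u m := by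
  -- Dickson's lemma: an antichain of monomials in finitely many letters is finite. The product of
  -- the scalars attached to the minimal torsion monomials then works for all torsion monomials.
  have hfin : {m | Minimal (· ∈ torsionSet z u) m}.Finite :=
    WellQuasiOrderedLE.finite_of_isAntichain (setOfPred_minimal_antichain _)
  have hc : ∀ m : ι →₀ ℕ, ∃ a : A, a ≠ 0 ∧ (m ∈ torsionSet z u →
      a • monomialVec z u m ∈ lowerSpan z u m) := by
    intro m
    by_cases hm : m ∈ torsionSet z u
    · obtain ⟨a, h0, ha⟩ := hm
      exact ⟨a, h0, fun _ => ha⟩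
    · exact ⟨1, one_ne_zero, fun h => absurd h hm⟩
  choose c hc0 hc using hc
  refine ⟨∏ m ∈ hfin.toFinset, c m, Finset.prod_ne_zero_iff.mpr fun m _ => hc0 m, ?_⟩
  intro m hm
  obtain ⟨m', hle, hmin⟩ := exists_minimal_le_of_wellFoundedLT (· ∈ torsionSet z u) m hm
  obtain ⟨b, hb⟩ := Finset.dvd_prod_of_mem c (hfin.mem_toFinset.mpr hmin)
  rw [hb, mul_comm, mul_smul]
  exact Submodule.smul_mem _ b (smul_monomialVec_of_le u hz (hc m' hmin.1) hle)

/-- Generic freeness: after inverting one nonzero element of `A`, the module is spanned by a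
linearly independent family of monomials. -/
theorem exists_generic_basis {z : ι → End A M} (u : M) (hz : CommuteUpTo z)
    (hu : ∀ v, ∃ n, v ∈ shortSpan z u n) :
    ∃ f : A, f ≠ 0 ∧ ∃ (B : Set (ι →₀ ℕ)) (e : (ι →₀ ℕ) → M), LinearIndepOn A e B ∧
      ∀ v, ∃ r : ℕ, f ^ r • v ∈ Submodule.span A (e '' B) := by
  obtain ⟨f, hf0, hf⟩ := exists_uniform_torsion u hz
  refine ⟨f, hf0, (torsionSet z u)ᶜ, monomialVec z u, ?_, ?_⟩
  · rw [linearIndepOn_iff]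
    intro l hl h0
    by_contra hne
    have hne' : l.support.Nonempty := Finsupp.support_nonempty_iff.mpr hne
    -- The largest monomial of a nontrivial relation would be torsion modulo the smaller ones, with
    -- its own coefficient as the scalar.
    obtain ⟨m, hm, hmax⟩ := Finset.exists_max_image l.support
      (fun m => MonomialOrder.degLex.toSyn m) hne'
    have hmem : m ∈ (torsionSet z u)ᶜ := (Finsupp.mem_supported A l).mp hl hm
    refine hmem ⟨l m, Finsupp.mem_support_iff.mp hm, ?_⟩
    rw [Finsupp.linearCombination_apply, Finsupp.sum, ← Finset.add_sum_erase _ _ hm] at h0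
    rw [eq_neg_of_add_eq_zero_left h0]
    refine neg_mem (sum_mem fun m' hm' => Submodule.smul_mem _ _ (Submodule.subset_span ⟨m', ?_, rfl⟩))
    have h1 := hmax m' (Finset.mem_of_mem_erase hm')
    refine lt_of_le_of_ne h1 fun h => (Finset.ne_of_mem_erase hm') ?_
    exact MonomialOrder.degLex.toSyn.injective h
  · have hsp : ∀ s : Set (ι →₀ ℕ), (∀ m ∈ s, ∃ r : ℕ, f ^ r • monomialVec z u m ∈
        Submodule.span A (monomialVec z u '' (torsionSet z u)ᶜ)) →
        ∀ v ∈ Submodule.span A (monomialVec z u '' s), ∃ r : ℕ, f ^ r • v ∈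
        Submodule.span A (monomialVec z u '' (torsionSet z u)ᶜ) := by
      intro s hs v hv
      induction hv using Submodule.span_induction with
      | mem v hv =>
        obtain ⟨m, hm, rfl⟩ := hv
        exact hs m hm
      | zero => exact ⟨0, by simp⟩
      | add v w _ _ h1 h2 =>
        obtain ⟨r, hr⟩ := h1
        obtain ⟨t, ht⟩ := h2
        refine ⟨r + t, ?_⟩
        rw [smul_add]
        refine add_mem ?_ ?_
        · rw [pow_add, mul_comm, mul_smul]
          exact Submodule.smul_mem _ _ hr
        · rw [pow_add, mul_smul]
          exact Submodule.smul_mem _ _ ht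
      | smul a v _ h =>
        obtain ⟨r, hr⟩ := h
        refine ⟨r, ?_⟩
        rw [smul_comm]
        exact Submodule.smul_mem _ _ hr
    have hall : ∀ m, ∃ r : ℕ, f ^ r • monomialVec z u m ∈
        Submodule.span A (monomialVec z u '' (torsionSet z u)ᶜ) := by
      intro m
      have hwf : WellFounded fun m m' : ι →₀ ℕ => m ≺[MonomialOrder.degLex] m' :=
        InvImage.wf _ (wellFounded_lt (α := MonomialOrder.degLex.syn))
      induction m using hwf.induction with
      | _ m ih =>
        by_cases hm : m ∈ torsionSet z u
        · obtain ⟨r, hr⟩ := hsp _ (fun m' hm' => ih m' hm') _ (hf m hm)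
          refine ⟨r + 1, ?_⟩
          rwa [pow_succ, mul_smul]
        · refine ⟨0, ?_⟩
          rw [pow_zero, one_smul]
          exact Submodule.subset_span ⟨m, hm, rfl⟩
    intro v
    obtain ⟨n, hn⟩ := hu v
    exact hsp _ (fun m _ => hall m) v (shortSpan_le u hz n hn)

end genericBasis

end

noncomputable section
open SuperSpace (deg)
open LieSuperalgebra (br)

/-! ### Gradings through the parity involution; homogeneous adapted bases -/

section parity

variable {K : Type*} {V : Type*} [Field K] [AddCommGroup V] [Module K V]
  [SuperSpace K V]

variable [CharZero K]

theorem mem_deg_iff {i : ZMod 2} {v : V} :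
    v ∈ deg (K := K) i ↔ parityMap K V v = koszulSign K i 1 • v := by
  refine ⟨parityMap_apply, fun h => ?_⟩
  obtain ⟨v₀, h₀, v₁, h₁, rfl⟩ := SuperSpace.exists_add K v
  rw [map_add, parityMap_apply h₀, parityMap_apply h₁] at h
  rcases zmodTwo_cases i with rfl | rfl
  · have : (2 : K) • v₁ = 0 := by
      simp only [koszulSign_zero_left, koszulSign_one_one, one_smul, neg_smul] at h
      rw [two_smul]
      nth_rewrite 1 [← add_left_cancel h]
      simp
    rw [(smul_eq_zero.mp this).resolve_left two_ne_zero, add_zero]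
    exact h₀
  · have : (2 : K) • v₀ = 0 := by
      simp only [koszulSign_zero_left, koszulSign_one_one, one_smul, neg_smul, neg_add] at h
      rw [two_smul]
      nth_rewrite 1 [add_right_cancel h]
      simp
    rw [(smul_eq_zero.mp this).resolve_left two_ne_zero, zero_add]
    exact h₁

/-- Since `2` is invertible, the homogeneous parts of `v` are half the sum and half the difference
of `v` and its parity image. Being graded thus becomes stability under a single operator. -/
theorem isHomogeneousSub_iff {N : Submodule K V} :
    IsHomogeneousSub N ↔ ∀ v ∈ N, parityMap K V v ∈ N := by
  constructor
  · intro h v hv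
    obtain ⟨v₀, h₀, v₁, h₁, rfl⟩ := Submodule.mem_sup.mp (h hv)
    rw [map_add, parityMap_apply h₀.2, parityMap_apply h₁.2]
    exact add_mem (Submodule.smul_mem _ _ h₀.1) (Submodule.smul_mem _ _ h₁.1)
  · intro h v hv
    have hP := h v hv
    obtain ⟨v₀, h₀, v₁, h₁, rfl⟩ := SuperSpace.exists_add K v
    rw [map_add, parityMap_apply h₀, parityMap_apply h₁] at hP
    simp only [koszulSign_zero_left, koszulSign_one_one, one_smul, neg_smul] at hP
    have e₀ : v₀ = (2⁻¹ : K) • ((v₀ + v₁) + (v₀ + -v₁)) := by module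
    have e₁ : v₁ = (2⁻¹ : K) • ((v₀ + v₁) - (v₀ + -v₁)) := by module
    refine Submodule.mem_sup.mpr ⟨v₀, ⟨?_, h₀⟩, v₁, ⟨?_, h₁⟩, rfl⟩
    · rw [e₀]; exact Submodule.smul_mem _ _ (add_mem hv hP)
    · rw [e₁]; exact Submodule.smul_mem _ _ (sub_mem hv hP)

/-- A graded subspace of a finite dimensional super vector space has a homogeneous basis which
extends to a homogeneous basis of the whole space. -/
theorem exists_adapted_basis [FiniteDimensional K V] {H : Submodule K V}
    (hH : IsHomogeneousSub H) :
    ∃ (m r : ℕ) (z : Module.Basis (Fin m ⊕ Fin r) K V) (p : Fin m ⊕ Fin r → ZMod 2),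
      (∀ a, z a ∈ deg (K := K) (p a)) ∧ Submodule.span K (Set.range (z ∘ Sum.inr)) = H := by
  classical
  -- Bases are extracted from spanning sets of homogeneous vectors, once inside `H` and then in the
  -- whole space starting from the first one, so every basis vector is automatically homogeneous.
  obtain ⟨s, hs, -, hts, hsi⟩ := exists_linearIndepOn_id_extension (K := K)
    (s := ∅) (t := {v : V | v ∈ H ∧ ∃ i, v ∈ deg (K := K) i})
    (linearIndepOn_empty K id) (Set.empty_subset _)
  have hsH : Submodule.span K s = H := by
    apply le_antisymm
    · exact Submodule.span_le.mpr fun v hv => (hs hv).1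
    · intro v hv
      obtain ⟨v₀, h₀, v₁, h₁, rfl⟩ := Submodule.mem_sup.mp (hH hv)
      exact add_mem (hts ⟨h₀.1, 0, h₀.2⟩) (hts ⟨h₁.1, 1, h₁.2⟩)
  obtain ⟨b, hb, hsb, htb, hbi⟩ := exists_linearIndepOn_id_extension (K := K)
    (s := s) (t := {v : V | ∃ i, v ∈ deg (K := K) i}) hsi (fun v hv => (hs hv).2)
  have hbtop : ⊤ ≤ Submodule.span K b := by
    intro v _
    obtain ⟨v₀, h₀, v₁, h₁, rfl⟩ := SuperSpace.exists_add K v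
    exact add_mem (htb ⟨0, h₀⟩) (htb ⟨1, h₁⟩)
  have hfin : b.Finite := hbi.linearIndependent.setFinite
  have hfs : s.Finite := hfin.subset hsb
  have hfd : (b \ s).Finite := hfin.subset Set.sdiff_subset
  have := hfd.to_subtype
  have := hfs.to_subtype
  let e₁ : Fin _ ≃ ↥(b \ s) := (Finite.equivFin ↥(b \ s)).symm
  let e₂ : Fin _ ≃ s := (Finite.equivFin s).symm
  let e : (↥(b \ s) ⊕ s) ≃ b := (Equiv.sumComm _ _).trans (Equiv.Set.sumDiffSubset hsb)
  let z₀ : Module.Basis b K V := Module.Basis.mk hbi.linearIndependent (by simpa using hbtop)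
  let z := z₀.reindex ((Equiv.sumCongr e₁ e₂).trans e).symm
  have hze : ∀ a, z a = (((Equiv.sumCongr e₁ e₂).trans e) a : V) := fun a => by
    rw [Module.Basis.reindex_apply, Module.Basis.mk_apply, Equiv.symm_symm, id_eq]
  have hz : ∀ a, z a ∈ b := fun a => by rw [hze]; exact Subtype.coe_prop _
  have hzr : ∀ a, z (Sum.inr a) = (e₂ a : V) := fun a => by rw [hze]; rfl
  choose p hp using fun a => hb (hz a)
  refine ⟨_, _, z, p, hp, ?_⟩
  rw [← hsH]
  congr 1
  ext v
  constructor
  · rintro ⟨a, rfl⟩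
    rw [Function.comp_apply, hzr]; exact Subtype.coe_prop _
  · intro hv
    exact ⟨e₂.symm ⟨v, hv⟩, by rw [Function.comp_apply, hzr, Equiv.apply_symm_apply]⟩

end parity

/-! ### Schur's lemma by Quillen's method -/

section schur

variable {K : Type*} {g : Type*} {U : Type*} [Field K] [AddCommGroup g] [Module K g]
  [SuperSpace K g] [LieSuperalgebra K g] [AddCommGroup U] [Module K U] [SuperSpace K U]

namespace SuperRep

/-- `f` is a homomorphism of representations, homogeneous of degree `i`, in the super sense. -/
structure IsSuperHom {V : Type*} [AddCommGroup V] [Module K V] [SuperSpace K V]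
    (σ : SuperRep K g U) (τ : SuperRep K g V) (i : ZMod 2) (f : U →ₗ[K] V) : Prop where
  parity : ∀ u, f (parityMap K U u) = koszulSign K i 1 • parityMap K V (f u)
  act : ∀ {j : ZMod 2} {x : g}, x ∈ deg (K := K) j → ∀ u,
    f (σ.act x u) = koszulSign K j i • τ.act x (f u)

theorem IsSimple.eq_bot_or_eq_top [CharZero K] {σ : SuperRep K g U} (hσ : σ.IsSimple)
    {N : Submodule K U} (hP : ∀ v ∈ N, parityMap K U v ∈ N)
    (hN : ∀ (j : ZMod 2) (x : g), x ∈ deg (K := K) j → ∀ v ∈ N, σ.act x v ∈ N) :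
    N = ⊥ ∨ N = ⊤ := by
  refine hσ.2 N (isHomogeneousSub_iff.mpr hP) fun x v hv => ?_
  obtain ⟨x₀, h₀, x₁, h₁, rfl⟩ := SuperSpace.exists_add K x
  rw [map_add]
  exact add_mem (hN 0 x₀ h₀ v hv) (hN 1 x₁ h₁ v hv)

theorem koszulSign_ne_zero (i j : ZMod 2) : koszulSign K i j ≠ 0 := by
  simp [koszulSign]

theorem IsSuperHom.bijective [CharZero K] {σ : SuperRep K g U} (hσ : σ.IsSimple)
    {i : ZMod 2} {f : U →ₗ[K] U} (hf : IsSuperHom σ σ i f) (h0 : f ≠ 0) :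
    Function.Bijective f := by
  have hk := hσ.eq_bot_or_eq_top (N := LinearMap.ker f)
    (fun v hv => by rw [LinearMap.mem_ker] at hv ⊢; rw [hf.parity, hv]; simp)
    (fun j x hx v hv => by rw [LinearMap.mem_ker] at hv ⊢; rw [hf.act hx, hv]; simp)
  have hr := hσ.eq_bot_or_eq_top (N := LinearMap.range f)
    (by
      rintro _ ⟨v, rfl⟩
      refine ⟨(koszulSign K i 1)⁻¹ • parityMap K U v, ?_⟩
      rw [map_smul, hf.parity, smul_smul, inv_mul_cancel₀ (koszulSign_ne_zero _ _), one_smul])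
    (by
      rintro j x hx _ ⟨v, rfl⟩
      refine ⟨(koszulSign K j i)⁻¹ • σ.act x v, ?_⟩
      rw [map_smul, hf.act hx, smul_smul, inv_mul_cancel₀ (koszulSign_ne_zero _ _), one_smul])
  constructor
  · refine LinearMap.ker_eq_bot.mp (hk.resolve_right fun h => h0 ?_)
    exact LinearMap.ker_eq_top.mp h
  · refine LinearMap.range_eq_top.mp (hr.resolve_left fun h => h0 ?_)
    exact LinearMap.range_eq_bot.mp h

theorem IsSuperHom.sub_smul {σ : SuperRep K g U} {i : ZMod 2} {f f' : U →ₗ[K] U}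
    (hf : IsSuperHom σ σ i f) (hf' : IsSuperHom σ σ i f') (c : K) :
    IsSuperHom σ σ i (f - c • f') where
  parity u := by simp [hf.parity, hf'.parity, smul_sub, smul_comm c]
  act hx u := by simp [hf.act hx, hf'.act hx, smul_sub, smul_comm c]

theorem isSuperHom_id (σ : SuperRep K g U) : IsSuperHom σ σ 0 LinearMap.id where
  parity u := by simp
  act hx u := by simp

theorem IsSuperHom.comp {U' U'' : Type*} [AddCommGroup U'] [Module K U'] [SuperSpace K U']
    [AddCommGroup U''] [Module K U''] [SuperSpace K U''] {σ : SuperRep K g U}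
    {τ : SuperRep K g U'} {υ : SuperRep K g U''} {i j : ZMod 2} {f' : U' →ₗ[K] U''}
    {f : U →ₗ[K] U'} (hf' : IsSuperHom τ υ j f') (hf : IsSuperHom σ τ i f) :
    IsSuperHom σ υ (i + j) (f' ∘ₗ f) where
  parity u := by
    simp only [LinearMap.comp_apply, hf.parity, map_smul, hf'.parity, smul_smul]
    congr 1
    rcases zmodTwo_cases i with rfl | rfl <;> rcases zmodTwo_cases j with rfl | rfl <;>
      simp [zmodTwo_one_add_one]
  act {l x} hx u := by
    simp only [LinearMap.comp_apply, hf.act hx, map_smul, hf'.act hx, smul_smul]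
    congr 1
    rcases zmodTwo_cases i with rfl | rfl <;> rcases zmodTwo_cases j with rfl | rfl <;>
      rcases zmodTwo_cases l with rfl | rfl <;> simp [zmodTwo_one_add_one]

open Polynomial in
theorem commute_aeval {R : Type*} [Ring R] [Algebra K R] {T θ : R} (h : Commute T θ)
    (q : K[X]) : Commute T (aeval θ q) := by
  induction q using Polynomial.induction_on' with
  | add p q hp hq => rw [map_add]; exact hp.add_right hq
  | monomial n c =>
    rw [aeval_monomial]
    exact Commute.mul_right (Algebra.commutes c T).symm (h.pow_right n)

open Polynomial in
/-- Quillen's lemma in the form of a Schur lemma: an even endomorphism of a simple representation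
of a finite dimensional Lie superalgebra over an algebraically closed field is a scalar. -/
theorem IsSimple.exists_eq_smul [IsAlgClosed K] [CharZero K] [FiniteDimensional K g]
    {σ : SuperRep K g U} (hσ : σ.IsSimple) {θ : U →ₗ[K] U} (hθ : IsSuperHom σ σ 0 θ) :
    ∃ c : K, θ = c • LinearMap.id := by
  -- If `θ` is not a scalar, every `θ - c` is bijective. Then `U` is a torsion free `K[X]`-module on
  -- which all `X - c` act surjectively, which generic freeness over `K[X]` forbids.
  by_contra! hne
  have hbij : ∀ c : K, Function.Bijective ⇑(θ - c • LinearMap.id : U →ₗ[K] U) := fun c =>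
    (hθ.sub_smul σ.isSuperHom_id c).bijective hσ (sub_ne_zero.mpr (hne c))
  have hC : ∀ c : K, aeval θ (X - C c) = (θ - c • LinearMap.id : U →ₗ[K] U) := fun c => by
    rw [map_sub, aeval_X, aeval_C]; rfl
  have hinj : ∀ (n : ℕ) (p : K[X]), p.natDegree = n → p ≠ 0 →
      Function.Injective (aeval θ p) := by
    intro n
    induction n with
    | zero =>
      intro p hp h0
      rw [eq_C_of_natDegree_eq_zero hp] at h0 ⊢
      rw [injective_iff_map_eq_zero]
      intro u hu
      rw [aeval_C] at hu
      exact (smul_eq_zero.mp hu).resolve_left fun h => h0 (by rw [h, C_0])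
    | succ n ih =>
      intro p hp h0
      obtain ⟨c, hc⟩ := IsAlgClosed.exists_root p (by
        rw [degree_eq_natDegree h0, hp]; exact_mod_cast Nat.succ_ne_zero n)
      obtain ⟨q, rfl⟩ := dvd_iff_isRoot.mpr hc
      have hq : q ≠ 0 := right_ne_zero_of_mul h0
      rw [natDegree_mul (X_sub_C_ne_zero c) hq, natDegree_X_sub_C] at hp
      rw [map_mul, hC]
      exact (hbij c).1.comp (ih q (by omega) hq)
  let _ : Module K[X] U := Module.compHom U (aeval θ).toRingHom
  have hsm : ∀ (p : K[X]) (u : U), p • u = aeval θ p u := fun _ _ => rfl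
  obtain ⟨m, r, z, p, hz, -⟩ := exists_adapted_basis (K := K) (V := g) (H := ⊥)
    (fun v hv => by rw [(Submodule.mem_bot K).mp hv]; exact zero_mem _)
  have hcomm : ∀ (q : K[X]) (x : g), aeval θ q * σ.act x = σ.act x * aeval θ q := by
    intro q x
    have h : Commute (σ.act x) θ := by
      obtain ⟨x₀, h₀, x₁, h₁, rfl⟩ := SuperSpace.exists_add K x
      refine LinearMap.ext fun u => ?_
      have e₀ := hθ.act h₀ u
      have e₁ := hθ.act h₁ u
      simp only [koszulSign_zero_right, one_smul] at e₀ e₁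
      simp [e₀, e₁]
    exact (commute_aeval h q).symm
  -- The action of `g` commutes with `θ`, hence is `K[X]`-linear. The lexicographic sum only serves
  -- to give the index set the linear order needed for `degLex`.
  let Z : (Fin m ⊕ₗ Fin r) → Module.End K[X] U := fun a =>
    { toFun := σ.act (z (ofLex a))
      map_add' := map_add _
      map_smul' := fun q u => by
        have := LinearMap.congr_fun (hcomm q (z (ofLex a))) u
        exact this.symm }
  have hCs : ∀ (c : K) (u : U), (C c : K[X]) • u = c • u := fun c u => by
    rw [hsm, aeval_C]; rfl
  have hcz : CommuteUpTo Z := by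
    intro a b
    have hu : IsUnit (C (koszulSign K (p (ofLex a)) (p (ofLex b)))) :=
      isUnit_C.mpr (isUnit_iff_ne_zero.mpr (koszulSign_ne_zero _ _))
    refine ⟨hu.unit, ?_⟩
    have e : Z a * Z b - (hu.unit : K[X]) • (Z b * Z a) =
        ∑ c, (C (z.repr (br K (z (ofLex a)) (z (ofLex b))) c) : K[X]) • Z (toLex c) := by
      ext u
      have h1 := LinearMap.congr_fun (σ.act_br (hz (ofLex a)) (hz (ofLex b))) u
      rw [← z.sum_repr (br K (z (ofLex a)) (z (ofLex b)))] at h1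
      simp only [map_sum, map_smul, LinearMap.sum_apply, LinearMap.smul_apply] at h1
      simp only [LinearMap.sum_apply, LinearMap.smul_apply, LinearMap.sub_apply, hCs,
        IsUnit.unit_spec]
      exact h1.symm
    rw [e]
    exact sum_mem fun c _ => Submodule.smul_mem _ _ (Submodule.subset_span ⟨_, rfl⟩)
  have hPc : ∀ (q : K[X]) (u : U), parityMap K U (q • u) = q • parityMap K U u := by
    intro q u
    have h : Commute (parityMap K U : Module.End K U) θ := by
      refine LinearMap.ext fun u => ?_
      have e := hθ.parity u
      simp only [koszulSign_zero_left, one_smul] at e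
      exact e.symm
    exact LinearMap.congr_fun (commute_aeval h q).eq u
  have hnt := hσ.1
  obtain ⟨i, u₀, hu₀, hu₀'⟩ : ∃ (i : ZMod 2) (u : U), u ∈ deg (K := K) i ∧ u ≠ 0 := by
    obtain ⟨u, hu⟩ := exists_ne (0 : U)
    obtain ⟨v₀, h₀, v₁, h₁, rfl⟩ := SuperSpace.exists_add K u
    by_cases h : v₀ = 0
    · exact ⟨1, v₁, h₁, fun h' => hu (by rw [h, h', add_zero])⟩
    · exact ⟨0, v₀, h₀, h⟩
  have hword : ∀ l : List (Fin m ⊕ₗ Fin r), ∃ c : K,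
      parityMap K U (wordApply Z u₀ l) = c • wordApply Z u₀ l := by
    intro l
    induction l with
    | nil => exact ⟨_, by simpa [wordApply] using parityMap_apply hu₀⟩
    | cons a l ih =>
      obtain ⟨c, hc⟩ := ih
      refine ⟨koszulSign K (p (ofLex a)) 1 * c, ?_⟩
      rw [wordApply_cons]
      change parityMap K U (σ.act (z (ofLex a)) _) = _ • σ.act (z (ofLex a)) _
      rw [σ.parityMap_act, hc, parityMap_apply (hz (ofLex a)), map_smul, map_smul,
        LinearMap.smul_apply, smul_smul, mul_comm]
  have hPs : ∀ n, ∀ v ∈ shortSpan Z u₀ n, parityMap K U v ∈ shortSpan Z u₀ n := by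
    intro n v hv
    unfold shortSpan at hv
    induction hv using Submodule.span_induction with
    | mem v hv =>
      obtain ⟨l, hl, rfl⟩ := hv
      obtain ⟨c, hc⟩ := hword l
      rw [hc, ← hCs]
      exact Submodule.smul_mem _ _ (wordApply_mem_shortSpan Z u₀ hl)
    | zero => simp
    | add v w _ _ h1 h2 => rw [map_add]; exact add_mem h1 h2
    | smul q v _ h => rw [hPc]; exact Submodule.smul_mem _ _ h
  -- The union of the filtration is a nonzero graded subrepresentation, so `u₀` generates `U` under
  -- words and polynomials in `θ`.
  let N : Submodule K U :=
    { carrier := {v | ∃ n, v ∈ shortSpan Z u₀ n}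
      add_mem' := by
        rintro v w ⟨n, hn⟩ ⟨n', hn'⟩
        exact ⟨max n n', add_mem (shortSpan_mono Z u₀ (le_max_left _ _) hn)
          (shortSpan_mono Z u₀ (le_max_right _ _) hn')⟩
      zero_mem' := ⟨0, zero_mem _⟩
      smul_mem' := by
        rintro c v ⟨n, hn⟩
        exact ⟨n, by rw [← hCs]; exact Submodule.smul_mem _ _ hn⟩ }
  have hN : N = ⊤ := by
    refine (hσ.eq_bot_or_eq_top (N := N) (fun v ⟨n, hn⟩ => ⟨n, hPs n v hn⟩) ?_).resolve_left ?_
    · rintro j x - v ⟨n, hn⟩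
      rw [← z.sum_repr x]
      simp only [map_sum, map_smul, LinearMap.sum_apply, LinearMap.smul_apply]
      exact sum_mem fun c _ => Submodule.smul_mem N _
        ⟨n + 1, apply_mem_shortSpan Z u₀ (toLex c) hn⟩
    · intro h
      have : u₀ ∈ N := ⟨1, wordApply_mem_shortSpan Z u₀ (l := []) (by simp)⟩
      rw [h] at this
      exact hu₀' ((Submodule.mem_bot K).mp this)
  obtain ⟨f, hf0, B, e, hli, hsp⟩ := exists_generic_basis u₀ hcz fun v => by
    have : v ∈ N := hN ▸ trivial
    exact this
  have hsinj : ∀ q : K[X], q ≠ 0 → ∀ u : U, q • u = 0 → u = 0 := fun q hq u hu =>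
    (injective_iff_map_eq_zero _).mp (hinj _ q rfl hq) u hu
  obtain ⟨b, hb⟩ : B.Nonempty := by
    by_contra hB
    rw [Set.not_nonempty_iff_eq_empty] at hB
    obtain ⟨n, hn⟩ := hsp u₀
    rw [hB, Set.image_empty, Submodule.span_empty, Submodule.mem_bot] at hn
    exact hu₀' (hsinj _ (pow_ne_zero n hf0) _ hn)
  -- For this `c`, inverting `f` does not make `X - c` a unit. Solving `(X - c) v = e b` and
  -- comparing coordinates at `b` gives an identity `(X - c) p = f ^ n`, which fails on evaluation
  -- at `c`.
  obtain ⟨c, hc⟩ : ∃ c, f.eval c ≠ 0 := by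
    by_contra! h
    exact hf0 (Polynomial.funext fun c => by rw [h, eval_zero])
  obtain ⟨v, hv⟩ := (hbij c).2 (e b)
  have hv' : (X - C c : K[X]) • v = e b := by rw [hsm, hC]; exact hv
  obtain ⟨n, hn⟩ := hsp v
  obtain ⟨l, hl, hlv⟩ := (Finsupp.mem_span_image_iff_linearCombination K[X]).mp hn
  have hmem : (X - C c : K[X]) • l - Finsupp.single b (f ^ n) ∈
      Finsupp.supported K[X] K[X] B :=
    sub_mem (Submodule.smul_mem _ _ hl) (Finsupp.single_mem_supported _ _ hb)
  have hz0 := linearIndepOn_iff.mp hli _ hmem (by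
    rw [map_sub, map_smul, hlv, Finsupp.linearCombination_single, smul_comm, hv', sub_self])
  have := congrArg (eval c) (DFunLike.congr_fun (sub_eq_zero.mp hz0) b)
  simp only [Finsupp.smul_apply, smul_eq_mul, eval_mul, eval_sub, eval_X, eval_C, sub_self,
    zero_mul, Finsupp.single_eq_same, eval_pow] at this
  exact pow_ne_zero n hc this.symm

end SuperRep
end schur
end

noncomputable section

/-! ### The diamond lemma with coefficients in a vector space -/

section diamond

variable {K T W X : Type*} [Field K] [AddCommGroup T] [Module K T] [AddCommGroup W] [Module K W]

/-- The span of the vectors `b y ⊗ w` with `y ∈ S`. -/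
def tensorSpan (b : Module.Basis X K T) (W : Type*) [AddCommGroup W] [Module K W] (S : Set X) :
    Submodule K (T ⊗[K] W) :=
  Submodule.span K {t | ∃ y ∈ S, ∃ w : W, t = b y ⊗ₜ w}

/-- The span of the differences between the two sides of the rewriting rules applicable to the
elements of `S`. -/
def ruleSpan (b : Module.Basis X K T) (R : X → (W →ₗ[K] T ⊗[K] W) → Prop) (S : Set X) :
    Submodule K (T ⊗[K] W) :=
  Submodule.span K {t | ∃ y ∈ S, ∃ r, R y r ∧ ∃ w : W, t = b y ⊗ₜ w - r w}

/-- The linear map with prescribed values on the vectors `b x ⊗ w`. -/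
def tensorConstr (b : Module.Basis X K T) {V : Type*} [AddCommGroup V] [Module K V]
    (N : X → W →ₗ[K] V) : T ⊗[K] W →ₗ[K] V :=
  TensorProduct.lift (b.constr K N)

@[simp] theorem tensorConstr_tmul (b : Module.Basis X K T) {V : Type*} [AddCommGroup V]
    [Module K V] (N : X → W →ₗ[K] V) (x : X) (w : W) :
    tensorConstr b N (b x ⊗ₜ w) = N x w := by
  simp [tensorConstr]

theorem tensorConstr_eqOn (b : Module.Basis X K T) {V : Type*} [AddCommGroup V]
    [Module K V] {f f' : T ⊗[K] W →ₗ[K] V} {S : Set X}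
    (h : ∀ y ∈ S, ∀ w, f (b y ⊗ₜ w) = f' (b y ⊗ₜ w)) {t : T ⊗[K] W}
    (ht : t ∈ tensorSpan b W S) : f t = f' t := by
  have : tensorSpan b W S ≤ LinearMap.eqLocus f f' := by
    refine Submodule.span_le.mpr ?_
    rintro _ ⟨y, hy, w, rfl⟩
    exact h y hy w
  exact this ht

open Classical in
/-- One step of the recursive definition of the normal form. -/
def normalFormStep (b : Module.Basis X K T) (lt : X → X → Prop)
    (R : X → (W →ₗ[K] T ⊗[K] W) → Prop) (x : X)
    (N : ∀ y, lt y x → (W →ₗ[K] T ⊗[K] W)) : W →ₗ[K] T ⊗[K] W :=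
  if h : ∃ r, R x r then
    -- The default `0` is never met: by `hlow` the right-hand side of a rule involves only elements
    -- below `x`.
    tensorConstr b (fun y => if hy : lt y x then N y hy else 0) ∘ₗ h.choose
  else TensorProduct.mk K T W (b x)

/-- Bergman's diamond lemma: a terminating and locally confluent system of linear rewriting rules
has normal forms. -/
theorem exists_normalForm (b : Module.Basis X K T) {lt : X → X → Prop} (hwf : WellFounded lt)
    (R : X → (W →ₗ[K] T ⊗[K] W) → Prop)
    (hlow : ∀ x r, R x r → ∀ w, r w ∈ tensorSpan b W {y | lt y x})
    (hconf : ∀ x r r', R x r → R x r' → ∀ w, r w - r' w ∈ ruleSpan b R {y | lt y x}) :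
    ∃ N : T ⊗[K] W →ₗ[K] T ⊗[K] W, (∀ x r, R x r → ∀ w, N (b x ⊗ₜ w) = N (r w)) ∧
      ∀ x, (¬ ∃ r, R x r) → ∀ w, N (b x ⊗ₜ w) = b x ⊗ₜ w := by
  -- The recursion uses an arbitrarily chosen rule at each reducible element; confluence shows
  -- afterwards that the choice is immaterial.
  let n : X → (W →ₗ[K] T ⊗[K] W) := hwf.fix (normalFormStep b lt R)
  have hn : ∀ x, n x = normalFormStep b lt R x fun y _ => n y := fun x => hwf.fix_eq _ x
  have hstep : ∀ x r, R x r → ∃ r', R x r' ∧ ∀ w, n x w = tensorConstr b n (r' w) := by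
    intro x r hr
    have h : ∃ r, R x r := ⟨r, hr⟩
    refine ⟨h.choose, h.choose_spec, fun w => ?_⟩
    rw [hn, normalFormStep, dif_pos h, LinearMap.comp_apply]
    refine tensorConstr_eqOn b (fun y hy w => ?_) (hlow x _ h.choose_spec w)
    rw [tensorConstr_tmul, tensorConstr_tmul, dif_pos (show lt y x from hy)]
  have main : ∀ x r, R x r → ∀ w, n x w = tensorConstr b n (r w) := by
    intro x
    induction x using hwf.induction with
    | _ x ih =>
      intro r hr w
      obtain ⟨r', hr', h'⟩ := hstep x r hr
      -- By induction the normal form respects every rule below `x`, so it kills the difference of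
      -- two reductions of `x`, which lies in the span of those lower relations.
      have hker : ruleSpan b R {y | lt y x} ≤ LinearMap.ker (tensorConstr b n) := by
        refine Submodule.span_le.mpr ?_
        rintro _ ⟨y, hy, s, hs, w, rfl⟩
        rw [SetLike.mem_coe, LinearMap.mem_ker, map_sub, tensorConstr_tmul, ih y hy s hs w,
          sub_self]
      have := hker (hconf x r' r hr' hr w)
      rw [LinearMap.mem_ker, map_sub, sub_eq_zero] at this
      rw [h', this]
  refine ⟨tensorConstr b n, fun x r hr w => ?_, fun x hx w => ?_⟩
  · rw [tensorConstr_tmul, main x r hr w]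
  · rw [tensorConstr_tmul, hn, normalFormStep, dif_neg hx, TensorProduct.mk_apply]

end diamond

end

/-! ### The rewriting system on `T(g) ⊗ W` and its consequences -/

noncomputable section
open SuperSpace (deg)
open LieSuperalgebra (br)

/-- A homogeneous basis of `g`, indexed by a linearly ordered set, such that a final segment of it
is a basis of the subalgebra `h`. -/
structure AdaptedBasis {K : Type*} {g : Type*} [Field K] [AddCommGroup g] [Module K g]
    [SuperSpace K g] [LieSuperalgebra K g] (h : LieSubsuperalgebra K g) (ι : Type*)
    [LinearOrder ι] where
  /-- the basis -/
  z : Module.Basis ι K g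
  /-- the parities of the basis vectors -/
  p : ι → ZMod 2
  z_mem : ∀ a, z a ∈ deg (K := K) (p a)
  /-- the final segment -/
  isSub : ι → Prop
  mem_sub : ∀ a, isSub a → z a ∈ h.toSubmodule
  le_span : h.toSubmodule ≤ Submodule.span K (z '' {a | isSub a})
  -- Letters of `h` come last, so a weakly increasing word containing such a letter ends with one,
  -- where it can be absorbed into `W`. Also, an out-of-order pair whose second letter is in `h` has
  -- its first letter in `h`.
  upper : ∀ {a b}, a ≤ b → isSub a → isSub b

namespace AdaptedBasis

set_option linter.unusedSectionVars false

variable {K : Type*} {g : Type*} {W : Type*} [Field K] [AddCommGroup g] [Module K g]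
  [SuperSpace K g] [LieSuperalgebra K g] [AddCommGroup W] [Module K W] [SuperSpace K W]
  {h : LieSubsuperalgebra K g} {ι : Type*} [LinearOrder ι] (B : AdaptedBasis h ι)

/-- The generator of the tensor algebra attached to a basis vector. -/
abbrev X (a : ι) : TensorAlgebra K g := TensorAlgebra.ι K (B.z a)

/-- The generator of the tensor algebra attached to the bracket of two basis vectors. -/
abbrev Y (a b : ι) : TensorAlgebra K g := TensorAlgebra.ι K (br K (B.z a) (B.z b))

/-- The element of the tensor algebra attached to a word. -/
def word (l : List ι) : TensorAlgebra K g := (l.map B.X).prod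

@[simp] theorem word_nil : B.word [] = 1 := rfl

@[simp] theorem word_cons (a : ι) (l : List ι) : B.word (a :: l) = B.X a * B.word l := by
  simp [word]

@[simp] theorem word_append (l l' : List ι) : B.word (l ++ l') = B.word l * B.word l' := by
  simp [word]

/-- The basis of the tensor algebra consisting of the words. -/
def wordBasis : Module.Basis (List ι) K (TensorAlgebra K g) :=
  B.z.tensorAlgebra.reindex FreeMonoid.toList

@[simp] theorem wordBasis_apply (l : List ι) : B.wordBasis l = B.word l := by
  have hhom : ((TensorAlgebra.equivFreeAlgebra B.z).symm.toAlgHom.comp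
      (FreeAlgebra.equivMonoidAlgebraFreeMonoid (R := K) (X := ι)).symm.toAlgHom :
        MonoidAlgebra K (FreeMonoid ι) →* TensorAlgebra K g).comp
      (MonoidAlgebra.of K (FreeMonoid ι)) = FreeMonoid.lift B.X := by
    ext a
    simp [FreeAlgebra.equivMonoidAlgebraFreeMonoid]
  have this : ∀ m : FreeMonoid ι, B.z.tensorAlgebra m = B.word (FreeMonoid.toList m) :=
    fun m => (DFunLike.congr_fun hhom m).trans (FreeMonoid.lift_apply _ _)
  rw [wordBasis, Module.Basis.reindex_apply, this]
  rfl

/-- The shortlex order on words. -/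
abbrev lt : List ι → List ι → Prop := List.Shortlex (· < ·)

/-- Compatibility with multiplication on both sides is what allows rules for short words to be used
inside long ones without losing termination. -/
theorem lt_sandwich {l l' : List ι} (h : lt l l') (u v : List ι) :
    lt (u ++ l ++ v) (u ++ l' ++ v) := by
  have h' : lt (l ++ v) (l' ++ v) := by
    rcases List.shortlex_def.mp h with h1 | ⟨h1, h2⟩
    · exact List.Shortlex.of_length_lt (by simpa using h1)
    · refine List.Shortlex.of_lex (by simp [h1]) ?_
      clear h
      induction h2 with
      | nil => simp at h1
      | rel h => exact List.Lex.rel h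
      | cons _ ih => exact List.Lex.cons (ih (by simpa using h1))
  rw [List.append_assoc, List.append_assoc]
  exact h'.append_left u

/-- The span of the words smaller than a given one. -/
def lowT (l : List ι) : Submodule K (TensorAlgebra K g) :=
  Submodule.span K (B.word '' {l' | lt l' l})

theorem sandwich_mem_lowT {l : List ι} {t : TensorAlgebra K g} (ht : t ∈ B.lowT l)
    (u v : List ι) : B.word u * t * B.word v ∈ B.lowT (u ++ l ++ v) := by
  unfold lowT at ht
  induction ht using Submodule.span_induction with
  | mem t ht =>
    obtain ⟨l', hl', rfl⟩ := ht
    rw [← word_append, ← word_append]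
    exact Submodule.subset_span ⟨_, lt_sandwich hl' u v, rfl⟩
  | zero => simp
  | add s t _ _ h1 h2 => rw [mul_add, add_mul]; exact add_mem h1 h2
  | smul c t _ h => rw [mul_smul_comm, smul_mul_assoc]; exact Submodule.smul_mem _ c h

theorem word_mem_lowT {l l' : List ι} (h : lt l' l) : B.word l' ∈ B.lowT l :=
  Submodule.subset_span ⟨l', h, rfl⟩

theorem ι_mem_lowT (x : g) {l : List ι} (hl : 1 < l.length) :
    TensorAlgebra.ι K x ∈ B.lowT l := by
  have hx := B.z.mem_span x
  induction hx using Submodule.span_induction with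
  | mem x hx =>
    obtain ⟨a, rfl⟩ := hx
    have := B.word_mem_lowT (l := l) (l' := [a]) (List.Shortlex.of_length_lt (by simpa using hl))
    simpa using this
  | zero => simp
  | add s t _ _ h1 h2 => rw [map_add]; exact add_mem h1 h2
  | smul c t _ h => rw [map_smul]; exact Submodule.smul_mem _ c h

theorem tmul_mem_tensorSpan {l : List ι} {t : TensorAlgebra K g} (ht : t ∈ B.lowT l) (w : W) :
    t ⊗ₜ[K] w ∈ tensorSpan B.wordBasis W {l' | lt l' l} := by
  unfold lowT at ht
  induction ht using Submodule.span_induction with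
  | mem t ht =>
    obtain ⟨l', hl', rfl⟩ := ht
    exact Submodule.subset_span ⟨l', hl', w, by rw [wordBasis_apply]⟩
  | zero => simp
  | add s t _ _ h1 h2 => rw [TensorProduct.add_tmul]; exact add_mem h1 h2
  | smul c t _ h => rw [← TensorProduct.smul_tmul']; exact Submodule.smul_mem _ c h

/-- The pairs of letters to which a rewriting rule applies. -/
def Cond (a b : ι) : Prop := b < a ∨ (a = b ∧ B.p a = 1)

/-- The sign attached to two letters. -/
abbrev κ (a b : ι) : K := koszulSign K (B.p a) (B.p b)

open Classical in
/-- The element by which the pair `a b` is replaced. -/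
def red (a b : ι) : TensorAlgebra K g :=
  if a = b then (2⁻¹ : K) • B.Y a a else B.κ a b • (B.X b * B.X a) + B.Y a b

theorem red_of_lt {a b : ι} (hab : b < a) :
    B.red a b = B.κ a b • (B.X b * B.X a) + B.Y a b := by
  rw [red, if_neg hab.ne']

theorem red_self (a : ι) : B.red a a = (2⁻¹ : K) • B.Y a a := by
  rw [red, if_pos rfl]

theorem lt_swap {a b : ι} (hab : b < a) (l : List ι) : lt (b :: a :: l) (a :: b :: l) :=
  List.Shortlex.of_lex (by simp) (List.Lex.rel hab)

theorem red_mem_lowT {a b : ι} (hab : B.Cond a b) : B.red a b ∈ B.lowT [a, b] := by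
  rcases hab with hab | ⟨rfl, -⟩
  · rw [red_of_lt B hab]
    refine add_mem (Submodule.smul_mem _ _ ?_) (B.ι_mem_lowT _ (by simp))
    simpa using B.word_mem_lowT (lt_swap hab [])
  · rw [red_self]
    exact Submodule.smul_mem _ _ (B.ι_mem_lowT _ (by simp))

/-- The rewriting rules. -/
def Rule (ρ : SuperRep K h W) (l : List ι) (r : W →ₗ[K] TensorAlgebra K g ⊗[K] W) : Prop :=
  (∃ u v a b, B.Cond a b ∧ l = u ++ a :: b :: v ∧
    r = TensorProduct.mk K _ W (B.word u * B.red a b * B.word v)) ∨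
  ∃ u a, ∃ ha : B.isSub a, l = u ++ [a] ∧
    r = TensorProduct.mk K _ W (B.word u) ∘ₗ ρ.act ⟨B.z a, B.mem_sub a ha⟩

theorem rule_low (ρ : SuperRep K h W) (l : List ι) (r : W →ₗ[K] TensorAlgebra K g ⊗[K] W)
    (hr : B.Rule ρ l r) (w : W) : r w ∈ tensorSpan B.wordBasis W {l' | lt l' l} := by
  rcases hr with ⟨u, v, a, b, hab, rfl, rfl⟩ | ⟨u, a, ha, rfl, rfl⟩
  · refine B.tmul_mem_tensorSpan ?_ w
    have := B.sandwich_mem_lowT (B.red_mem_lowT hab) u v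
    simpa using this
  · exact B.tmul_mem_tensorSpan (B.word_mem_lowT (List.Shortlex.of_length_lt (by simp))) _

/-- `rel S` is spanned by the rewriting relations for words in `S`. -/
abbrev rel (ρ : SuperRep K h W) (S : Set (List ι)) : Submodule K (TensorAlgebra K g ⊗[K] W) :=
  ruleSpan B.wordBasis (B.Rule ρ) S

/-- The map `t ↦ u t v ⊗ w`. -/
def sand (u v : List ι) (w : W) : TensorAlgebra K g →ₗ[K] TensorAlgebra K g ⊗[K] W :=
  (TensorProduct.mk K _ W).flip w ∘ₗ LinearMap.mulRight K (B.word v) ∘ₗ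
    LinearMap.mulLeft K (B.word u)

theorem sand_apply (u v : List ι) (w : W) (t : TensorAlgebra K g) :
    B.sand u v w t = (B.word u * t * B.word v) ⊗ₜ w := rfl

theorem sand_mul_left (u v l : List ι) (w : W) (t : TensorAlgebra K g) :
    B.sand u v w (B.word l * t) = B.sand (u ++ l) v w t := by
  simp [sand_apply, mul_assoc]

theorem sand_mul_right (u v l : List ι) (w : W) (t : TensorAlgebra K g) :
    B.sand u v w (t * B.word l) = B.sand u (l ++ v) w t := by
  simp [sand_apply, mul_assoc]

variable (ρ : SuperRep K h W)

theorem pair_mem {S : Set (List ι)} {a b : ι} (hab : B.Cond a b) {u v : List ι}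
    (hS : u ++ a :: b :: v ∈ S) (w : W) :
    B.sand u v w (B.X a * B.X b - B.red a b) ∈ B.rel ρ S := by
  refine Submodule.subset_span ⟨_, hS, _, Or.inl ⟨u, v, a, b, hab, rfl, rfl⟩, w, ?_⟩
  rw [wordBasis_apply, sand_apply, mul_sub, sub_mul, TensorProduct.sub_tmul]
  simp [mul_assoc]

theorem last_mem {S : Set (List ι)} {a : ι} (ha : B.isSub a) {u : List ι}
    (hS : u ++ [a] ∈ S) (w : W) :
    (B.word u * B.X a) ⊗ₜ[K] w - B.word u ⊗ₜ[K] ρ.act ⟨B.z a, B.mem_sub a ha⟩ w ∈ B.rel ρ S := by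
  refine Submodule.subset_span ⟨_, hS, _, Or.inr ⟨u, a, ha, rfl, rfl⟩, w, ?_⟩
  simp

/-- Linear extension of the absorption rule from basis letters to all of `h`. An element of `h` may
involve any letter of `h`, whence the requirement that `S` contain all words of the given length. -/
theorem last_mem_of_mem {S : Set (List ι)} {u : List ι}
    (hS : ∀ l : List ι, l.length = u.length + 1 → l ∈ S) (w : W) (x : h) :
    (B.word u * TensorAlgebra.ι K x.1) ⊗ₜ[K] w - B.word u ⊗ₜ[K] ρ.act x w ∈ B.rel ρ S := by
  obtain ⟨x, hx⟩ := x
  have hx' := B.le_span hx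
  -- Membership in `h` is part of the claim because the action of `x` needs it as data during the
  -- span induction.
  have key : ∃ hx : x ∈ h.toSubmodule, (B.word u * TensorAlgebra.ι K x) ⊗ₜ[K] w -
      B.word u ⊗ₜ[K] ρ.act ⟨x, hx⟩ w ∈ B.rel ρ S := by
    clear hx
    induction hx' using Submodule.span_induction with
    | mem x hx =>
      obtain ⟨a, ha, rfl⟩ := hx
      exact ⟨B.mem_sub a ha, B.last_mem ρ ha (hS _ (by simp)) w⟩
    | zero => 
      refine ⟨zero_mem _, ?_⟩
      have : (⟨0, zero_mem _⟩ : h) = 0 := rfl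
      rw [this]; simp
    | add x y _ _ h1 h2 =>
      obtain ⟨hx, h1⟩ := h1
      obtain ⟨hy, h2⟩ := h2
      refine ⟨add_mem hx hy, ?_⟩
      have : (⟨x + y, add_mem hx hy⟩ : h) = ⟨x, hx⟩ + ⟨y, hy⟩ := rfl
      rw [this, map_add, map_add, mul_add, TensorProduct.add_tmul, LinearMap.add_apply,
        TensorProduct.tmul_add, add_sub_add_comm]
      exact add_mem h1 h2
    | smul c x _ h1 =>
      obtain ⟨hx, h1⟩ := h1
      refine ⟨Submodule.smul_mem _ c hx, ?_⟩
      have : (⟨c • x, Submodule.smul_mem _ c hx⟩ : h) = c • ⟨x, hx⟩ := rfl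
      convert Submodule.smul_mem _ c h1 using 1
      rw [smul_sub, this, map_smul, map_smul, mul_smul_comm, LinearMap.smul_apply,
        TensorProduct.tmul_smul]
      rfl
  exact key.2

variable [CharZero K]

/-- Applying the parity map changes the sign of exactly the odd coordinates; comparing with the sign
on `x` forces twice each coordinate of the wrong parity to vanish. -/
theorem mem_span_of_mem_deg [Finite ι] {i : ZMod 2} {x : g} (hx : x ∈ deg (K := K) i) :
    x ∈ Submodule.span K (B.z '' {a | B.p a = i}) := by
  have := Fintype.ofFinite ι
  have hP := parityMap_apply hx
  have hz : ∀ a, B.p a ≠ i → B.z.repr x a = 0 := by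
    intro a ha
    have e : parityMap K g x = ∑ b, (B.z.repr x b * koszulSign K (B.p b) 1) • B.z b := by
      conv_lhs => rw [← B.z.sum_repr x]
      simp only [map_sum, map_smul, parityMap_apply (B.z_mem _), smul_smul]
    rw [hP] at e
    have e' := congrArg (fun y => B.z.repr y a) e
    simp only [map_smul, Finsupp.smul_apply, B.z.repr_sum_self, smul_eq_mul] at e'
    have h2 : (2 : K) * B.z.repr x a = 0 := by
      rcases zmodTwo_cases i with rfl | rfl <;> rcases zmodTwo_cases (B.p a) with h | h <;>
        simp only [h, ne_eq, not_true_eq_false, koszulSign_zero_left, koszulSign_one_one] at ha e'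
      · linear_combination e'
      · linear_combination -e'
    exact (mul_eq_zero.mp h2).resolve_left two_ne_zero
  rw [← B.z.sum_repr x]
  refine sum_mem fun a _ => ?_
  by_cases ha : B.p a = i
  · exact Submodule.smul_mem _ _ (Submodule.subset_span ⟨a, ha, rfl⟩)
  · rw [hz a ha]; simp

/-- The rules cover only decreasing pairs and repeated odd letters. Increasing pairs follow by super
skew symmetry, and for a repeated even letter the bracket is zero. -/
theorem commutator_mem_basis {S : Set (List ι)} {u v : List ι}
    (hS : ∀ l : List ι, l.length = u.length + v.length + 2 → l ∈ S) (w : W) (a b : ι) :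
    B.sand u v w (B.X a * B.X b - B.κ a b • (B.X b * B.X a) - B.Y a b) ∈ B.rel ρ S := by
  have key : ∀ a b, b < a →
      B.sand u v w (B.X a * B.X b - B.κ a b • (B.X b * B.X a) - B.Y a b) ∈ B.rel ρ S := by
    intro a b hab
    have := B.pair_mem ρ (S := S) (Or.inl hab) (u := u) (v := v)
      (hS _ (by simp only [List.length_append, List.length_cons]; omega)) w
    rwa [red_of_lt B hab, ← sub_sub] at this
  have hsk := LieSuperalgebra.skew (B.z_mem a) (B.z_mem b)
  rcases lt_trichotomy a b with hab | rfl | hab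
  · have := Submodule.smul_mem _ (-B.κ a b) (key b a hab)
    rw [← map_smul] at this
    convert this using 2
    rw [Y, Y, hsk, map_neg, map_smul]
    simp only [κ]
    rcases zmodTwo_cases (B.p a) with h1 | h1 <;> rcases zmodTwo_cases (B.p b) with h2 | h2 <;>
      simp only [h1, h2, koszulSign_zero_left, koszulSign_zero_right, koszulSign_one_one] <;>
      module
  · rcases zmodTwo_cases (B.p a) with h1 | h1
    · have h0 : br K (B.z a) (B.z a) = 0 := by
        simp only [h1, koszulSign_zero_left, one_smul] at hsk
        have : (2 : K) • br K (B.z a) (B.z a) = 0 := by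
          rw [two_smul]; nth_rewrite 1 [hsk]; simp
        exact (smul_eq_zero.mp this).resolve_left two_ne_zero
      simp [κ, h1, Y, h0]
    · have := Submodule.smul_mem _ (2 : K) (B.pair_mem ρ (S := S) (Or.inr ⟨rfl, h1⟩) (u := u) (v := v)
        (hS _ (by simp only [List.length_append, List.length_cons]; omega)) w)
      rw [← map_smul] at this
      convert this using 2
      simp only [κ, h1, koszulSign_one_one, red_self]
      module
  · exact key a b hab

/-- Bilinear extension to homogeneous elements, needed for commutators with a bracket such as `[z_a,
[z_b, z_c]]`, which is not a basis letter. -/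
theorem commutator_mem [Finite ι] {S : Set (List ι)} {u v : List ι}
    (hS : ∀ l : List ι, l.length = u.length + v.length + 2 → l ∈ S) (w : W) {i j : ZMod 2}
    {x y : g} (hx : x ∈ deg (K := K) i) (hy : y ∈ deg (K := K) j) :
    B.sand u v w (TensorAlgebra.ι K x * TensorAlgebra.ι K y -
      koszulSign K i j • (TensorAlgebra.ι K y * TensorAlgebra.ι K x) -
      TensorAlgebra.ι K (br K x y)) ∈ B.rel ρ S := by
  have hx' := B.mem_span_of_mem_deg hx
  have hy' := B.mem_span_of_mem_deg hy
  clear hx hy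
  induction hx', hy' using Submodule.span_induction₂ with
  | mem_mem x y hx hy =>
    obtain ⟨a, rfl, rfl⟩ := hx
    obtain ⟨b, rfl, rfl⟩ := hy
    exact B.commutator_mem_basis ρ hS w a b
  | zero_left y hy => simp
  | zero_right x hx => simp
  | add_left x x' y _ _ _ h1 h2 =>
    convert add_mem h1 h2 using 1
    rw [← map_add]
    congr 1
    simp only [map_add, LinearMap.add_apply, add_mul, mul_add]
    module
  | add_right x x' y _ _ _ h1 h2 =>
    convert add_mem h1 h2 using 1
    rw [← map_add]
    congr 1
    simp only [map_add, add_mul, mul_add]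
    module
  | smul_left c x y _ _ h1 =>
    convert Submodule.smul_mem _ c h1 using 1
    rw [← map_smul]
    congr 1
    simp only [map_smul, LinearMap.smul_apply, smul_mul_assoc, mul_smul_comm]
    module
  | smul_right c x y _ _ h1 =>
    convert Submodule.smul_mem _ c h1 using 1
    rw [← map_smul]
    congr 1
    simp only [map_smul, smul_mul_assoc, mul_smul_comm]
    module

end AdaptedBasis

end

/-! ### Overlapping pairs: the Jacobi identity -/

noncomputable section
open SuperSpace (deg)
open LieSuperalgebra (br)

/-- This lists the possible ambiguities: the same pair, an overlap in one letter on either side, or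
disjoint pairs in either order. -/
theorem List.append_cons_cons_cases {α : Type*} {u v u' v' : List α} {a b a' b' : α}
    (h : u ++ a :: b :: v = u' ++ a' :: b' :: v') :
    (u = u' ∧ a = a' ∧ b = b' ∧ v = v') ∨
    (u' = u ++ [a] ∧ a' = b ∧ v = b' :: v') ∨ (u = u' ++ [a'] ∧ a = b' ∧ v' = b :: v) ∨
    (∃ m, v = m ++ a' :: b' :: v' ∧ u' = u ++ a :: b :: m) ∨
    (∃ m, v' = m ++ a :: b :: v ∧ u = u' ++ a' :: b' :: m) := by
  rcases List.append_eq_append_iff.mp h with ⟨m, rfl, hm⟩ | ⟨m, rfl, hm⟩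
  · match m, hm with
    | [], hm => simp_all
    | [c], hm =>
      simp only [List.cons_append, List.nil_append, List.cons.injEq] at hm
      obtain ⟨rfl, rfl, rfl⟩ := hm
      exact Or.inr (Or.inl ⟨rfl, rfl, rfl⟩)
    | c :: d :: m, hm =>
      simp only [List.cons_append, List.cons.injEq] at hm
      obtain ⟨rfl, rfl, rfl⟩ := hm
      exact Or.inr (Or.inr (Or.inr (Or.inl ⟨m, rfl, rfl⟩)))
  · match m, hm with
    | [], hm => simp_all
    | [c], hm =>
      simp only [List.cons_append, List.nil_append, List.cons.injEq] at hm
      obtain ⟨rfl, rfl, rfl⟩ := hm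
      exact Or.inr (Or.inr (Or.inl ⟨rfl, rfl, rfl⟩))
    | c :: d :: m, hm =>
      simp only [List.cons_append, List.cons.injEq] at hm
      obtain ⟨rfl, rfl, rfl⟩ := hm
      exact Or.inr (Or.inr (Or.inr (Or.inr ⟨m, rfl, rfl⟩)))

namespace AdaptedBasis

set_option linter.unusedSectionVars false

variable {K : Type*} {g : Type*} {W : Type*} [Field K] [AddCommGroup g] [Module K g]
  [SuperSpace K g] [LieSuperalgebra K g] [AddCommGroup W] [Module K W] [SuperSpace K W]
  {h : LieSubsuperalgebra K g} {ι : Type*} [LinearOrder ι] [Finite ι] (B : AdaptedBasis h ι)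
  [CharZero K] (ρ : SuperRep K h W)

/-- The elements `t` such that `u t v ⊗ w` is a combination of relations for smaller words than
`u a b c v`. -/
def tripleRel (u v : List ι) (w : W) (a b c : ι) : Submodule K (TensorAlgebra K g) :=
  (B.rel ρ {l | lt l (u ++ a :: b :: c :: v)}).comap (B.sand u v w)

variable {ρ} {u v : List ι} {w : W} {a b c : ι}

theorem left_mem_tripleRel {d e f : ι} (hde : B.Cond d e) (hlt : lt [d, e, f] [a, b, c]) :
    (B.X d * B.X e - B.red d e) * B.X f ∈ B.tripleRel ρ u v w a b c := by
  have hS : u ++ d :: e :: ([f] ++ v) ∈ {l | lt l (u ++ a :: b :: c :: v)} := by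
    simpa using lt_sandwich hlt u v
  have := B.pair_mem ρ hde hS w
  rw [← sand_mul_right] at this
  simpa [tripleRel] using this

theorem right_mem_tripleRel {d e f : ι} (hde : B.Cond e f) (hlt : lt [d, e, f] [a, b, c]) :
    B.X d * (B.X e * B.X f - B.red e f) ∈ B.tripleRel ρ u v w a b c := by
  have hS : (u ++ [d]) ++ e :: f :: v ∈ {l | lt l (u ++ a :: b :: c :: v)} := by
    simpa using lt_sandwich hlt u v
  have := B.pair_mem ρ hde hS w
  rw [← sand_mul_left] at this
  simpa [tripleRel] using this

theorem commutator_mem_tripleRel {i j : ZMod 2} {x y : g} (hx : x ∈ deg (K := K) i)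
    (hy : y ∈ deg (K := K) j) :
    TensorAlgebra.ι K x * TensorAlgebra.ι K y -
      koszulSign K i j • (TensorAlgebra.ι K y * TensorAlgebra.ι K x) -
      TensorAlgebra.ι K (br K x y) ∈ B.tripleRel ρ u v w a b c :=
  B.commutator_mem ρ (fun l hl => List.Shortlex.of_length_lt (by
    rw [hl]; simp only [List.length_append, List.length_cons]; omega)) w hx hy

theorem ι_jacobi (a b c : ι) :
    TensorAlgebra.ι K (br K (B.z a) (br K (B.z b) (B.z c))) =
      TensorAlgebra.ι K (br K (br K (B.z a) (B.z b)) (B.z c)) +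
      B.κ a b • TensorAlgebra.ι K (br K (B.z b) (br K (B.z a) (B.z c))) := by
  rw [LieSuperalgebra.jacobi (B.z_mem a) (B.z_mem b) (B.z_mem c), map_add, map_smul]

/-- Both reductions can be continued to the word `c b a`. The leftover terms contain brackets of a
letter with a bracket, and these cancel by the Jacobi identity. -/
theorem triple_distinct (hab : b < a) (hbc : c < b) :
    B.red a b * B.X c - B.X a * B.red b c ∈ B.tripleRel ρ u v w a b c := by
  have hac := hbc.trans hab
  have l1 : lt [b, a, c] [a, b, c] := lt_swap hab _
  have l2 : lt [b, c, a] [a, b, c] := List.Shortlex.of_lex (by simp) (List.Lex.rel hab)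
  have l3 : lt [a, c, b] [a, b, c] :=
    List.Shortlex.of_lex (by simp) (List.Lex.cons (List.Lex.rel hbc))
  have l4 : lt [c, a, b] [a, b, c] := List.Shortlex.of_lex (by simp) (List.Lex.rel hac)
  have m1 := B.right_mem_tripleRel (ρ := ρ) (u := u) (v := v) (w := w) (Or.inl hac) l1
  have m2 := B.left_mem_tripleRel (ρ := ρ) (u := u) (v := v) (w := w) (Or.inl hbc) l2
  have m3 := B.left_mem_tripleRel (ρ := ρ) (u := u) (v := v) (w := w) (Or.inl hac) l3
  have m4 := B.right_mem_tripleRel (ρ := ρ) (u := u) (v := v) (w := w) (Or.inl hab) l4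
  have d1 := B.commutator_mem_tripleRel (ρ := ρ) (u := u) (v := v) (w := w) (a := a) (b := b)
    (c := c) (B.z_mem a) (LieSuperalgebra.br_mem (B.z_mem b) (B.z_mem c))
  have d2 := B.commutator_mem_tripleRel (ρ := ρ) (u := u) (v := v) (w := w) (a := a) (b := b)
    (c := c) (B.z_mem b) (LieSuperalgebra.br_mem (B.z_mem a) (B.z_mem c))
  have d3 := B.commutator_mem_tripleRel (ρ := ρ) (u := u) (v := v) (w := w) (a := a) (b := b)
    (c := c) (LieSuperalgebra.br_mem (B.z_mem a) (B.z_mem b)) (B.z_mem c)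
  have J := B.ι_jacobi a b c
  rw [red_of_lt B hab] at m4 ⊢
  rw [red_of_lt B hbc] at m2 ⊢
  rw [red_of_lt B hac] at m1 m3
  rw [J] at d1
  -- `m1` and `m2` sort `b a c` through `b c a`, while `m3` and `m4` sort `a c b` through `c a b`;
  -- `d1`, `d2`, `d3` commute a letter with a bracket. The coefficients are the signs acquired on
  -- the way.
  have key := add_mem (add_mem (sub_mem (sub_mem (add_mem (Submodule.smul_mem _ (B.κ a b) m1)
    (Submodule.smul_mem _ (B.κ a b * B.κ a c) m2)) (Submodule.smul_mem _ (B.κ b c) m3))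
    (Submodule.smul_mem _ (B.κ b c * B.κ a c) m4)) (Submodule.smul_mem _ (B.κ a b) d2))
    (sub_mem d3 d1)
  convert key using 1
  simp only [κ, Y]
  rcases zmodTwo_cases (B.p a) with h1 | h1 <;> rcases zmodTwo_cases (B.p b) with h2 | h2 <;>
    rcases zmodTwo_cases (B.p c) with h3 | h3 <;>
    simp only [h1, h2, h3, koszulSign_zero_left, koszulSign_zero_right, koszulSign_one_one,
      add_zero, zero_add, zmodTwo_one_add_one, one_smul, mul_one, mul_neg, neg_neg, neg_smul] <;>
    noncomm_ring

/-- For odd `a`, the Jacobi identity gives `[[a, a], c] = 2 [a, [a, c]]`, which matches the factor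
one half in the rule for `a a`. -/
theorem triple_left_eq (hab : c < a) (ha : B.p a = 1) :
    B.red a a * B.X c - B.X a * B.red a c ∈ B.tripleRel ρ u v w a a c := by
  have l1 : lt [a, c, a] [a, a, c] :=
    List.Shortlex.of_lex (by simp) (List.Lex.cons (List.Lex.rel hab))
  have l2 : lt [c, a, a] [a, a, c] := List.Shortlex.of_lex (by simp) (List.Lex.rel hab)
  have m1 := B.left_mem_tripleRel (ρ := ρ) (u := u) (v := v) (w := w) (Or.inl hab) l1
  have m2 := B.right_mem_tripleRel (ρ := ρ) (u := u) (v := v) (w := w) (Or.inr ⟨rfl, ha⟩) l2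
  have d1 := B.commutator_mem_tripleRel (ρ := ρ) (u := u) (v := v) (w := w) (a := a) (b := a)
    (c := c) (B.z_mem a) (LieSuperalgebra.br_mem (B.z_mem a) (B.z_mem c))
  have d2 := B.commutator_mem_tripleRel (ρ := ρ) (u := u) (v := v) (w := w) (a := a) (b := a)
    (c := c) (LieSuperalgebra.br_mem (B.z_mem a) (B.z_mem a)) (B.z_mem c)
  have J := B.ι_jacobi a a c
  rw [red_self] at m2 ⊢
  rw [red_of_lt B hab] at m1 ⊢
  simp only [κ, ha, koszulSign_one_one, neg_smul, one_smul] at J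
  have J' : TensorAlgebra.ι K (br K (br K (B.z a) (B.z a)) (B.z c)) =
      (2 : K) • TensorAlgebra.ι K (br K (B.z a) (br K (B.z a) (B.z c))) := by
    rw [two_smul]; nth_rewrite 1 [J]; abel
  rw [J'] at d2
  have key := add_mem (sub_mem (sub_mem (Submodule.smul_mem _ (-B.κ a c) m1) m2) d1)
    (Submodule.smul_mem _ (2⁻¹ : K) d2)
  convert key using 1
  simp only [κ, Y, ha]
  rcases zmodTwo_cases (B.p c) with h3 | h3 <;>
    simp only [h3, koszulSign_zero_right, koszulSign_one_one,
      add_zero, zero_add, zmodTwo_one_add_one, koszulSign_zero_left, mul_sub, sub_mul, mul_add,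
      add_mul, smul_mul_assoc, mul_smul_comm, mul_assoc] <;>
    module

theorem triple_right_eq (hab : b < a) (hb : B.p b = 1) :
    B.red a b * B.X b - B.X a * B.red b b ∈ B.tripleRel ρ u v w a b b := by
  have l1 : lt [b, a, b] [a, b, b] := lt_swap hab _
  have l2 : lt [b, b, a] [a, b, b] := List.Shortlex.of_lex (by simp) (List.Lex.rel hab)
  have m1 := B.right_mem_tripleRel (ρ := ρ) (u := u) (v := v) (w := w) (Or.inl hab) l1
  have m2 := B.left_mem_tripleRel (ρ := ρ) (u := u) (v := v) (w := w) (Or.inr ⟨rfl, hb⟩) l2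
  have d1 := B.commutator_mem_tripleRel (ρ := ρ) (u := u) (v := v) (w := w) (a := a) (b := b)
    (c := b) (B.z_mem b) (LieSuperalgebra.br_mem (B.z_mem a) (B.z_mem b))
  have d2 := B.commutator_mem_tripleRel (ρ := ρ) (u := u) (v := v) (w := w) (a := a) (b := b)
    (c := b) (B.z_mem a) (LieSuperalgebra.br_mem (B.z_mem b) (B.z_mem b))
  have J := B.ι_jacobi a b b
  have sk := congrArg (TensorAlgebra.ι K) (LieSuperalgebra.skew (K := K)
    (LieSuperalgebra.br_mem (K := K) (B.z_mem a) (B.z_mem b)) (B.z_mem b))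
  rw [map_neg, map_smul] at sk
  rw [sk] at J
  rw [red_self] at m2 ⊢
  rw [red_of_lt B hab] at m1 ⊢
  rw [J] at d2
  have key := sub_mem (add_mem (add_mem (Submodule.smul_mem _ (B.κ a b) m1) m2)
    (Submodule.smul_mem _ (B.κ a b) d1)) (Submodule.smul_mem _ (2⁻¹ : K) d2)
  convert key using 1
  simp only [κ, Y, hb]
  rcases zmodTwo_cases (B.p a) with h3 | h3 <;>
    simp only [h3, koszulSign_zero_right, koszulSign_one_one,
      add_zero, zero_add, zmodTwo_one_add_one, koszulSign_zero_left, mul_sub, sub_mul, mul_add,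
      add_mul, smul_mul_assoc, mul_smul_comm, mul_assoc] <;>
    module

/-- For odd `a`, Jacobi and skew symmetry give `3 [a, [a, a]] = 0`. Here `3` must be invertible, so
that `a` and `[a, a]` commute. -/
theorem triple_all_eq (ha : B.p a = 1) :
    B.red a a * B.X a - B.X a * B.red a a ∈ B.tripleRel ρ u v w a a a := by
  have d1 := B.commutator_mem_tripleRel (ρ := ρ) (u := u) (v := v) (w := w) (a := a) (b := a)
    (c := a) (B.z_mem a) (LieSuperalgebra.br_mem (B.z_mem a) (B.z_mem a))
  have J := B.ι_jacobi a a a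
  have sk := congrArg (TensorAlgebra.ι K) (LieSuperalgebra.skew (K := K)
    (LieSuperalgebra.br_mem (K := K) (B.z_mem a) (B.z_mem a)) (B.z_mem a))
  rw [map_neg, map_smul] at sk
  rw [sk] at J
  simp only [κ, ha, zmodTwo_one_add_one, koszulSign_zero_left, koszulSign_one_one, one_smul,
    neg_smul] at J
  have J0 : TensorAlgebra.ι K (br K (B.z a) (br K (B.z a) (B.z a))) = 0 := by
    have : (3 : K) • TensorAlgebra.ι K (br K (B.z a) (br K (B.z a) (B.z a))) = 0 := by
      have e : ∀ y : TensorAlgebra K g, (3 : K) • y = y - (-y + -y) := fun y => by module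
      rw [e, ← J, sub_self]
    exact (smul_eq_zero.mp this).resolve_left three_ne_zero
  rw [J0] at d1
  convert Submodule.smul_mem _ (-2⁻¹ : K) d1 using 1
  simp only [ha, zmodTwo_one_add_one, koszulSign_zero_right, red_self, Y, smul_mul_assoc,
    mul_smul_comm]
  module

theorem triple_mem (hab : B.Cond a b) (hbc : B.Cond b c) :
    B.red a b * B.X c - B.X a * B.red b c ∈ B.tripleRel ρ u v w a b c := by
  rcases hab with hab | ⟨rfl, ha⟩
  · rcases hbc with hbc | ⟨rfl, hb⟩
    · exact B.triple_distinct hab hbc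
    · exact B.triple_right_eq hab hb
  · rcases hbc with hbc | ⟨rfl, hb⟩
    · exact B.triple_left_eq hbc ha
    · exact B.triple_all_eq ha

end AdaptedBasis

end

/-! ### Confluence of the rewriting system -/

noncomputable section
open SuperSpace (deg)
open LieSuperalgebra (br)

namespace AdaptedBasis

set_option linter.unusedSectionVars false

variable {K : Type*} {g : Type*} {W : Type*} [Field K] [AddCommGroup g] [Module K g]
  [SuperSpace K g] [LieSuperalgebra K g] [AddCommGroup W] [Module K W] [SuperSpace K W]
  {h : LieSubsuperalgebra K g} {ι : Type*} [LinearOrder ι] [Finite ι] (B : AdaptedBasis h ι)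
  [CharZero K] (ρ : SuperRep K h W)

theorem disjoint_right_mem {u v v' : List ι} {a b a' b' : ι} (hab' : B.Cond a' b') (w : W)
    {t : TensorAlgebra K g} (ht : t ∈ B.lowT [a, b]) :
    (B.word u * t * B.word v * (B.X a' * B.X b' - B.red a' b') * B.word v') ⊗ₜ[K] w ∈
      B.rel ρ {l | lt l (u ++ a :: b :: (v ++ a' :: b' :: v'))} := by
  unfold lowT at ht
  induction ht using Submodule.span_induction with
  | mem t ht =>
    obtain ⟨l, hl, rfl⟩ := ht
    have hS : (u ++ l ++ v) ++ a' :: b' :: v' ∈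
        {l | lt l (u ++ a :: b :: (v ++ a' :: b' :: v'))} := by
      simpa using lt_sandwich hl u (v ++ a' :: b' :: v')
    have := B.pair_mem ρ hab' hS w
    rw [sand_apply] at this
    simpa [mul_assoc] using this
  | zero => simp
  | add s t _ _ h1 h2 =>
    simp only [mul_add, add_mul, TensorProduct.add_tmul] at h1 h2 ⊢
    exact add_mem h1 h2
  | smul c t _ h =>
    simp only [mul_smul_comm, smul_mul_assoc]
    exact Submodule.smul_mem _ c h

theorem disjoint_left_mem {u v v' : List ι} {a b a' b' : ι} (hab : B.Cond a b) (w : W)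
    {t : TensorAlgebra K g} (ht : t ∈ B.lowT [a', b']) :
    (B.word u * (B.X a * B.X b - B.red a b) * B.word v * t * B.word v') ⊗ₜ[K] w ∈
      B.rel ρ {l | lt l (u ++ a :: b :: (v ++ a' :: b' :: v'))} := by
  unfold lowT at ht
  induction ht using Submodule.span_induction with
  | mem t ht =>
    obtain ⟨l, hl, rfl⟩ := ht
    have hS : u ++ a :: b :: (v ++ l ++ v') ∈
        {l | lt l (u ++ a :: b :: (v ++ a' :: b' :: v'))} := by
      simpa using lt_sandwich hl (u ++ a :: b :: v) v'
    have := B.pair_mem ρ hab hS w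
    rw [sand_apply] at this
    simpa [mul_assoc] using this
  | zero => simp
  | add s t _ _ h1 h2 =>
    simp only [mul_add, add_mul, TensorProduct.add_tmul] at h1 h2 ⊢
    exact add_mem h1 h2
  | smul c t _ h =>
    simp only [mul_smul_comm, smul_mul_assoc]
    exact Submodule.smul_mem _ c h

/-- Both sides reduce to the word with both pairs replaced. After one replacement only smaller words
remain, so applying the other rule to them is legitimate. -/
theorem confluent_disjoint {u v v' : List ι} {a b a' b' : ι} (hab : B.Cond a b)
    (hab' : B.Cond a' b') (w : W) :
    (B.word u * B.red a b * B.word (v ++ a' :: b' :: v')) ⊗ₜ[K] w -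
      (B.word (u ++ a :: b :: v) * B.red a' b' * B.word v') ⊗ₜ[K] w ∈
      B.rel ρ {l | lt l (u ++ a :: b :: (v ++ a' :: b' :: v'))} := by
  have h1 := B.disjoint_right_mem ρ (u := u) (v := v) (v' := v') hab' w (B.red_mem_lowT hab)
  have h2 := B.disjoint_left_mem ρ (u := u) (v := v) (v' := v') hab w (B.red_mem_lowT hab')
  convert sub_mem h1 h2 using 1
  rw [← TensorProduct.sub_tmul, ← TensorProduct.sub_tmul]
  congr 1
  simp only [word_append, word_cons, mul_sub, sub_mul, mul_assoc]
  abel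

theorem confluent_overlap {u v : List ι} {a b c : ι} (hab : B.Cond a b) (hbc : B.Cond b c)
    (w : W) :
    (B.word u * B.red a b * B.word (c :: v)) ⊗ₜ[K] w -
      (B.word (u ++ [a]) * B.red b c * B.word v) ⊗ₜ[K] w ∈
      B.rel ρ {l | lt l (u ++ a :: b :: c :: v)} := by
  have := B.triple_mem (ρ := ρ) (u := u) (v := v) (w := w) hab hbc
  rw [tripleRel, Submodule.mem_comap, sand_apply] at this
  have e : B.word u * B.red a b * B.word (c :: v) - B.word (u ++ [a]) * B.red b c * B.word v =
      B.word u * (B.red a b * B.X c - B.X a * B.red b c) * B.word v := by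
    simp [mul_sub, sub_mul, mul_assoc]
  rw [← TensorProduct.sub_tmul, e]
  exact this

theorem pair_last_disjoint_aux {u v : List ι} {a b c : ι} (hc : B.isSub c)
    {t : TensorAlgebra K g} (ht : t ∈ B.lowT [a, b]) (w : W) :
    (B.word u * t * B.word v * B.X c) ⊗ₜ[K] w -
      (B.word u * t * B.word v) ⊗ₜ[K] ρ.act ⟨B.z c, B.mem_sub c hc⟩ w ∈
      B.rel ρ {l | lt l (u ++ a :: b :: (v ++ [c]))} := by
  unfold lowT at ht
  induction ht using Submodule.span_induction with
  | mem t ht =>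
    obtain ⟨l, hl, rfl⟩ := ht
    have hS : (u ++ l ++ v) ++ [c] ∈ {l | lt l (u ++ a :: b :: (v ++ [c]))} := by
      simpa using lt_sandwich hl u (v ++ [c])
    have := B.last_mem ρ hc hS w
    simpa [mul_assoc] using this
  | zero => simp
  | add s t _ _ h1 h2 =>
    simp only [mul_add, add_mul, TensorProduct.add_tmul] at h1 h2 ⊢
    convert add_mem h1 h2 using 1
    abel
  | smul k t _ h =>
    simp only [mul_smul_comm, smul_mul_assoc]
    convert Submodule.smul_mem _ k h using 1
    rw [smul_sub]
    rfl

theorem confluent_last_disjoint {u v : List ι} {a b c : ι} (hab : B.Cond a b) (hc : B.isSub c)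
    (w : W) :
    (B.word u * B.red a b * B.word (v ++ [c])) ⊗ₜ[K] w -
      B.word (u ++ a :: b :: v) ⊗ₜ[K] ρ.act ⟨B.z c, B.mem_sub c hc⟩ w ∈
      B.rel ρ {l | lt l (u ++ a :: b :: (v ++ [c]))} := by
  have h1 := B.pair_last_disjoint_aux ρ (u := u) (v := v) hc (B.red_mem_lowT hab) w
  have h2 := B.pair_mem ρ (S := {l | lt l (u ++ a :: b :: (v ++ [c]))}) hab (u := u) (v := v)
    (List.Shortlex.of_length_lt (by simp)) (ρ.act ⟨B.z c, B.mem_sub c hc⟩ w)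
  convert sub_mem h1 h2 using 1
  rw [sand_apply, mul_sub, sub_mul, TensorProduct.sub_tmul]
  simp [mul_assoc]

/-- This ambiguity is resolved by `W` being a representation of `h`: both letters lie in `h`, and
letting them act on `W` in either way agrees by the commutator formula for `ρ`. -/
theorem confluent_last_overlap {u : List ι} {a b : ι} (hab : B.Cond a b) (hb : B.isSub b)
    (w : W) :
    (B.word u * B.red a b) ⊗ₜ[K] w -
      B.word (u ++ [a]) ⊗ₜ[K] ρ.act ⟨B.z b, B.mem_sub b hb⟩ w ∈
      B.rel ρ {l | lt l (u ++ [a, b])} := by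
  have ha : B.isSub a := B.upper (hab.elim le_of_lt fun h => h.1.ge) hb
  have hz : ∀ c (hc : B.isSub c), (⟨B.z c, B.mem_sub c hc⟩ : h) ∈ deg (K := K) (B.p c) :=
    fun c _ => B.z_mem c
  have hbr := LinearMap.congr_fun (ρ.act_br (hz a ha) (hz b hb)) w
  have m1 := B.last_mem_of_mem ρ (S := {l | lt l (u ++ [a, b])}) (u := u)
    (fun l hl => List.Shortlex.of_length_lt (by rw [hl]; simp)) w
    (br K (⟨B.z a, B.mem_sub a ha⟩ : h) ⟨B.z b, B.mem_sub b hb⟩)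
  rw [hbr] at m1
  have m2 := B.last_mem ρ (S := {l | lt l (u ++ [a, b])}) ha (u := u)
    (List.Shortlex.of_length_lt (by simp)) (ρ.act ⟨B.z b, B.mem_sub b hb⟩ w)
  have eY : TensorAlgebra.ι K ((br K (⟨B.z a, B.mem_sub a ha⟩ : h) ⟨B.z b, B.mem_sub b hb⟩ : h) : g)
      = B.Y a b := rfl
  rw [eY] at m1
  rcases hab with hab | ⟨rfl, hp⟩
  · have m3 := B.last_mem ρ (S := {l | lt l (u ++ [a, b])}) ha (u := u ++ [b])
      (by simpa using (lt_swap hab []).append_left u) w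
    have m4 := B.last_mem ρ (S := {l | lt l (u ++ [a, b])}) hb (u := u)
      (List.Shortlex.of_length_lt (by simp)) (ρ.act ⟨B.z a, B.mem_sub a ha⟩ w)
    convert sub_mem (add_mem m1 (Submodule.smul_mem _ (B.κ a b) (add_mem m3 m4))) m2 using 1
    rw [red_of_lt B hab]
    simp only [word_append, word_cons, word_nil, mul_one, mul_add, mul_smul_comm,
      TensorProduct.add_tmul, LinearMap.sub_apply, LinearMap.smul_apply, Module.End.mul_apply,
      TensorProduct.tmul_sub, TensorProduct.tmul_smul, smul_sub, smul_add, mul_assoc,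
      ← TensorProduct.smul_tmul']
    abel
  · convert sub_mem (Submodule.smul_mem _ (2⁻¹ : K) m1) m2 using 1
    rw [red_self]
    simp only [word_append, word_cons, word_nil, mul_one, mul_smul_comm, LinearMap.sub_apply,
      LinearMap.smul_apply, Module.End.mul_apply, TensorProduct.tmul_sub, TensorProduct.tmul_smul,
      smul_sub, ← TensorProduct.smul_tmul', hp, koszulSign_one_one]
    module

theorem confluent (l : List ι) (r r' : W →ₗ[K] TensorAlgebra K g ⊗[K] W) (hr : B.Rule ρ l r)
    (hr' : B.Rule ρ l r') (w : W) : r w - r' w ∈ B.rel ρ {l' | lt l' l} := by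
  have hlast : ∀ u v a b, B.Cond a b → ∀ u' c (hc : B.isSub c), u ++ a :: b :: v = u' ++ [c] →
      (B.word u * B.red a b * B.word v) ⊗ₜ[K] w -
        B.word u' ⊗ₜ[K] ρ.act ⟨B.z c, B.mem_sub c hc⟩ w ∈
          B.rel ρ {l | lt l (u ++ a :: b :: v)} := by
    intro u v a b hab u' c hc e
    rcases List.eq_nil_or_concat' v with rfl | ⟨v, d, rfl⟩
    · have e' : (u ++ [a]) ++ [b] = u' ++ [c] := by simpa using e
      obtain ⟨rfl, e2⟩ := List.append_inj' e' rfl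
      obtain rfl : b = c := by simpa using e2
      simpa using B.confluent_last_overlap ρ hab hc w
    · have e' : (u ++ a :: b :: v) ++ [d] = u' ++ [c] := by simpa using e
      obtain ⟨rfl, e2⟩ := List.append_inj' e' rfl
      obtain rfl : d = c := by simpa using e2
      exact B.confluent_last_disjoint ρ hab hc w
  rcases hr with ⟨u, v, a, b, hab, rfl, rfl⟩ | ⟨u, a, ha, rfl, rfl⟩
  · rcases hr' with ⟨u', v', a', b', hab', e, rfl⟩ | ⟨u', a', ha', e, rfl⟩
    · rcases List.append_cons_cons_cases e with ⟨rfl, rfl, rfl, rfl⟩ | ⟨rfl, rfl, rfl⟩ |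
        ⟨rfl, rfl, rfl⟩ | ⟨m, rfl, rfl⟩ | ⟨m, rfl, rfl⟩
      · simp
      · exact B.confluent_overlap ρ hab hab' w
      · have := B.confluent_overlap ρ (u := u') (v := v) hab' hab w
        rw [← neg_mem_iff, neg_sub, e]
        exact this
      · exact B.confluent_disjoint ρ hab hab' w
      · have := B.confluent_disjoint ρ (u := u') (v := m) (v' := v) hab' hab w
        rw [← neg_mem_iff, neg_sub, e]
        exact this
    · exact hlast u v a b hab u' a' ha' e
  · rcases hr' with ⟨u', v', a', b', hab', e, rfl⟩ | ⟨u', a', ha', e, rfl⟩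
    · have := hlast u' v' a' b' hab' u a ha e.symm
      rw [← neg_mem_iff, neg_sub, e]
      exact this
    · obtain ⟨rfl, e2⟩ := List.append_inj' e rfl
      obtain rfl : a = a' := by simpa using e2
      simp

end AdaptedBasis

end

/-! ### The Poincaré–Birkhoff–Witt theorem for the induced representation -/

noncomputable section
open SuperSpace (deg)
open LieSuperalgebra (br)

namespace AdaptedBasis

set_option linter.unusedSectionVars false

variable {K : Type*} {g : Type*} {W : Type*} [Field K] [AddCommGroup g] [Module K g]
  [SuperSpace K g] [LieSuperalgebra K g] [AddCommGroup W] [Module K W] [SuperSpace K W]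
  {h : LieSubsuperalgebra K g} {ι : Type*} [LinearOrder ι] (B : AdaptedBasis h ι)
  (ρ : SuperRep K h W)

/-- The irreducible words: weakly increasing words, strictly increasing in the odd letters,
without letters from the subalgebra. -/
def Irr (l : List ι) : Prop :=
  l.Pairwise (fun a b => a < b ∨ (a = b ∧ B.p a = 0)) ∧ ∀ a ∈ l, ¬ B.isSub a

theorem not_cond_iff {a b : ι} : ¬ B.Cond a b ↔ a < b ∨ (a = b ∧ B.p a = 0) := by
  unfold Cond
  rcases lt_trichotomy a b with hab | rfl | hab
  · simp [hab, hab.not_gt, hab.ne]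
  · rcases zmodTwo_cases (B.p a) with h | h <;> simp [h]
  · simp [hab, hab.not_gt, hab.ne']

theorem Irr.not_rule {l : List ι} (hl : B.Irr l) : ¬ ∃ r, B.Rule ρ l r := by
  rintro ⟨r, ⟨u, v, a, b, hab, rfl, rfl⟩ | ⟨u, a, ha, rfl, rfl⟩⟩
  · refine (B.not_cond_iff.mpr ?_) hab
    have := (List.pairwise_append.mp hl.1).2.1
    exact (List.pairwise_cons.mp this).1 b (by simp)
  · exact hl.2 a (by simp) ha

/-- The rules test only neighbouring letters; transitivity extends the order to all pairs. A letter
of `h` would then force the last letter into `h`, where the absorption rule applies. -/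
theorem irr_of_not_rule {l : List ι} (hl : ¬ ∃ r, B.Rule ρ l r) : B.Irr l := by
  have htr : IsTrans ι (fun a b => a < b ∨ (a = b ∧ B.p a = 0)) := ⟨by
    rintro a b c (hab | ⟨rfl, h1⟩) (hbc | ⟨rfl, h2⟩)
    · exact Or.inl (hab.trans hbc)
    · exact Or.inl hab
    · exact Or.inl hbc
    · exact Or.inr ⟨rfl, h1⟩⟩
  have hp : l.Pairwise (fun a b => a < b ∨ (a = b ∧ B.p a = 0)) := by
    rw [← List.isChain_iff_pairwise, List.isChain_iff_forall_rel_of_append_cons_cons]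
    intro a b u v e
    rw [← B.not_cond_iff]
    exact fun hab => hl ⟨_, Or.inl ⟨u, v, a, b, hab, e, rfl⟩⟩
  refine ⟨hp, fun a ha hs => ?_⟩
  rcases List.eq_nil_or_concat' l with rfl | ⟨u, c, rfl⟩
  · simp at ha
  · have hac : a ≤ c := by
      rcases List.mem_append.mp ha with h | h
      · rcases (List.pairwise_append.mp hp).2.2 a h c (by simp) with h | h
        · exact h.le
        · exact h.1.le
      · exact (List.mem_singleton.mp h).le
    exact hl ⟨_, Or.inr ⟨u, c, B.upper hac hs, rfl, rfl⟩⟩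

/-- The vector `z_{l₁} ⋯ z_{lₙ} ⊗ w` of the induced representation. -/
def indWord (l : List ι) (w : W) : ρ.IndSpace :=
  ρ.indTmul ((l.map fun a => SuperEnveloping.ι K g (B.z a)).prod) w

/-- The canonical map from `T(g) ⊗ W` to the induced representation. -/
def toInd : TensorAlgebra K g ⊗[K] W →ₗ[K] ρ.IndSpace :=
  ρ.balancing.mkQ ∘ₗ LinearMap.rTensor W (SuperEnveloping.mk K g).toLinearMap

theorem toInd_tmul (t : TensorAlgebra K g) (w : W) :
    toInd ρ (t ⊗ₜ w) = ρ.indTmul (SuperEnveloping.mk K g t) w := rfl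

theorem mk_ι (x : g) :
    SuperEnveloping.mk K g (TensorAlgebra.ι K x) = SuperEnveloping.ι K g x := rfl

theorem mk_word (l : List ι) :
    SuperEnveloping.mk K g (B.word l) = (l.map fun a => SuperEnveloping.ι K g (B.z a)).prod := by
  rw [word, map_list_prod, List.map_map]
  rfl

theorem toInd_word (l : List ι) (w : W) : toInd ρ (B.word l ⊗ₜ w) = B.indWord ρ l w := by
  rw [toInd_tmul, mk_word, indWord]

theorem mk_red [CharZero K] {a b : ι} (hab : B.Cond a b) :
    SuperEnveloping.mk K g (B.red a b) = SuperEnveloping.mk K g (B.X a * B.X b) := by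
  have e := SuperEnveloping.ι_br (B.z_mem a) (B.z_mem b)
  rcases hab with hab | ⟨rfl, hp⟩
  · rw [red_of_lt B hab, map_add, map_smul, map_mul, map_mul, mk_ι, mk_ι, mk_ι, e]
    abel
  · rw [red_self, map_smul, map_mul, mk_ι, mk_ι, e, hp, koszulSign_one_one]
    module

theorem indTmul_mul_ι (a : SuperEnveloping K g) (x : h) (w : W) :
    ρ.indTmul (a * SuperEnveloping.ι K g x.1) w = ρ.indTmul a (ρ.act x w) := by
  rw [← SuperEnveloping.incl_ι, ← ρ.structureMorphism_ι, ← sub_eq_zero]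
  change ρ.balancing.mkQ _ - ρ.balancing.mkQ _ = 0
  rw [← map_sub, Submodule.mkQ_apply, Submodule.Quotient.mk_eq_zero]
  exact Submodule.subset_span ⟨_, _, _, rfl⟩

theorem toInd_rule [CharZero K] {l : List ι} {r : W →ₗ[K] TensorAlgebra K g ⊗[K] W}
    (hr : B.Rule ρ l r) (w : W) : toInd ρ (r w) = B.indWord ρ l w := by
  rcases hr with ⟨u, v, a, b, hab, rfl, rfl⟩ | ⟨u, a, ha, rfl, rfl⟩
  · rw [← toInd_word, TensorProduct.mk_apply, toInd_tmul, toInd_tmul, map_mul, map_mul,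
      B.mk_red hab]
    congr 1
    simp [mul_assoc]
  · rw [LinearMap.comp_apply, TensorProduct.mk_apply, toInd_tmul, ← indTmul_mul_ι,
      ← toInd_word, toInd_tmul]
    simp [mk_ι]

/-- The span of the words of length less than `n`. -/
def filt (n : ℕ) : Submodule K ρ.IndSpace :=
  Submodule.span K {t | ∃ l w, l.length < n ∧ t = B.indWord ρ l w}

/-- Every rule holds in the induced representation and leads to shortlex smaller words, which are
never longer. Rewriting therefore terminates without leaving the filtration layer. -/
theorem indWord_mem_span_irr [Finite ι] [CharZero K] (l : List ι) (w : W) :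
    B.indWord ρ l w ∈ Submodule.span K
      {t | ∃ l' w', B.Irr l' ∧ l'.length ≤ l.length ∧ t = B.indWord ρ l' w'} := by
  have hwf : WellFounded (lt (ι := ι)) :=
    List.Shortlex.wf (wellFounded_lt)
  induction l using hwf.induction generalizing w with
  | _ l ih =>
    by_cases hl : ∃ r, B.Rule ρ l r
    · obtain ⟨r, hr⟩ := hl
      rw [← B.toInd_rule ρ hr]
      have hle : tensorSpan B.wordBasis W {l' | lt l' l} ≤ (Submodule.span K
          {t | ∃ l' w', B.Irr l' ∧ l'.length ≤ l.length ∧ t = B.indWord ρ l' w'}).comap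
          (toInd ρ) := by
        refine Submodule.span_le.mpr ?_
        rintro _ ⟨l', hl', w', rfl⟩
        rw [SetLike.mem_coe, Submodule.mem_comap, wordBasis_apply, toInd_word]
        refine Submodule.span_mono ?_ (ih l' hl' w')
        rintro _ ⟨l'', w'', h1, h2, rfl⟩
        refine ⟨l'', w'', h1, h2.trans ?_, rfl⟩
        rcases List.shortlex_def.mp hl' with h | h
        · exact h.le
        · exact h.1.le
      exact hle (B.rule_low ρ l r hr w)
    · exact Submodule.subset_span ⟨l, w, B.irr_of_not_rule ρ hl, le_rfl, rfl⟩

/-- The spanning half of the Poincaré–Birkhoff–Witt theorem. -/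
theorem filt_le [Finite ι] [CharZero K] (n : ℕ) : B.filt ρ n ≤ Submodule.span K
    {t | ∃ l w, B.Irr l ∧ l.length < n ∧ t = B.indWord ρ l w} := by
  refine Submodule.span_le.mpr ?_
  rintro _ ⟨l, w, hl, rfl⟩
  refine Submodule.span_mono ?_ (B.indWord_mem_span_irr ρ l w)
  rintro _ ⟨l', w', h1, h2, rfl⟩
  exact ⟨l', w', h1, h2.trans_lt hl, rfl⟩

variable [Finite ι] [CharZero K]

/-- The quotient of `T(g) ⊗ W` by the rewriting relations. -/
abbrev RelQuot : Type _ := (TensorAlgebra K g ⊗[K] W) ⧸ B.rel ρ Set.univ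

theorem relQuot_ext {V : Type*} [AddCommGroup V] [Module K V] {f f' : B.RelQuot ρ →ₗ[K] V}
    (hf : ∀ l w, f ((B.rel ρ Set.univ).mkQ (B.word l ⊗ₜ w)) =
      f' ((B.rel ρ Set.univ).mkQ (B.word l ⊗ₜ w))) : f = f' := by
  refine Submodule.linearMap_qext _ (TensorProduct.ext (B.wordBasis.ext fun l =>
    LinearMap.ext fun w => ?_))
  rw [wordBasis_apply]
  exact hf l w

/-- A rule remains a rule when letters are added on the left. Hence left multiplication descends to
the quotient, which becomes a `g`-module comparable with the induced one. -/
theorem rel_le_comap (x : g) : B.rel ρ Set.univ ≤ (B.rel ρ Set.univ).comap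
    (LinearMap.rTensor W (LinearMap.mulLeft K (TensorAlgebra.ι K x))) := by
  have hx := B.z.mem_span x
  induction hx using Submodule.span_induction with
  | mem x hx =>
    obtain ⟨a, rfl⟩ := hx
    refine Submodule.span_le.mpr ?_
    rintro _ ⟨l, -, r, hr, w, rfl⟩
    rw [SetLike.mem_coe, Submodule.mem_comap, map_sub, wordBasis_apply, LinearMap.rTensor_tmul,
      LinearMap.mulLeft_apply]
    refine Submodule.subset_span ⟨a :: l, trivial,
      LinearMap.rTensor W (LinearMap.mulLeft K (B.X a)) ∘ₗ r, ?_, w, ?_⟩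
    · rcases hr with ⟨u, v, b, c, hbc, rfl, rfl⟩ | ⟨u, b, hb, rfl, rfl⟩
      · refine Or.inl ⟨a :: u, v, b, c, hbc, rfl, ?_⟩
        ext w
        simp [mul_assoc]
      · refine Or.inr ⟨a :: u, b, hb, rfl, ?_⟩
        ext w
        simp
    · rw [wordBasis_apply, word_cons]
      rfl
  | zero =>
    intro t _
    simp
  | add x y _ _ h1 h2 =>
    intro t ht
    have e : LinearMap.mulLeft K (TensorAlgebra.ι K (x + y)) =
        LinearMap.mulLeft K (TensorAlgebra.ι K x) + LinearMap.mulLeft K (TensorAlgebra.ι K y) := by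
      ext; simp [add_mul]
    rw [Submodule.mem_comap, e, LinearMap.rTensor_add, LinearMap.add_apply]
    exact add_mem (h1 ht) (h2 ht)
  | smul c x _ h1 =>
    intro t ht
    have e : LinearMap.mulLeft K (TensorAlgebra.ι K (c • x)) =
        c • LinearMap.mulLeft K (TensorAlgebra.ι K x) := by
      ext; simp
    rw [Submodule.mem_comap, e, LinearMap.rTensor_smul, LinearMap.smul_apply]
    exact Submodule.smul_mem _ c (h1 ht)

/-- The action of `g` on the quotient by the rewriting relations. -/
def relAct : g →ₗ[K] Module.End K (B.RelQuot ρ) where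
  toFun x := Submodule.mapQ _ _ (LinearMap.rTensor W (LinearMap.mulLeft K (TensorAlgebra.ι K x)))
    (B.rel_le_comap ρ x)
  map_add' x y := B.relQuot_ext ρ fun l w => by
    simp [add_mul, TensorProduct.add_tmul]
  map_smul' c x := B.relQuot_ext ρ fun l w => by
    simp
    rfl

theorem relAct_mkQ (x : g) (t : TensorAlgebra K g) (w : W) :
    B.relAct ρ x ((B.rel ρ Set.univ).mkQ (t ⊗ₜ w)) =
      (B.rel ρ Set.univ).mkQ ((TensorAlgebra.ι K x * t) ⊗ₜ w) := rfl

theorem relAct_br {i j : ZMod 2} {x y : g} (hx : x ∈ deg (K := K) i) (hy : y ∈ deg (K := K) j) :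
    B.relAct ρ (br K x y) = B.relAct ρ x * B.relAct ρ y -
      koszulSign K i j • (B.relAct ρ y * B.relAct ρ x) := by
  refine B.relQuot_ext ρ fun l w => ?_
  have := B.commutator_mem ρ (S := Set.univ) (u := []) (v := l) (fun _ _ => trivial) w hx hy
  rw [LinearMap.sub_apply, LinearMap.smul_apply, Module.End.mul_apply, Module.End.mul_apply,
    relAct_mkQ, relAct_mkQ, relAct_mkQ, relAct_mkQ, relAct_mkQ, ← map_smul, ← map_sub, eq_comm,
    ← sub_eq_zero, ← map_sub, Submodule.mkQ_apply, Submodule.Quotient.mk_eq_zero]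
  convert this using 1
  rw [sand_apply]
  simp only [word_nil, one_mul, sub_mul, smul_mul_assoc, TensorProduct.sub_tmul, mul_assoc,
    TensorProduct.smul_tmul']

/-- The action of `U(g)` on the quotient by the rewriting relations. -/
def relMorphism : SuperEnveloping K g →ₐ[K] Module.End K (B.RelQuot ρ) :=
  SuperEnveloping.lift (B.relAct ρ) fun _ _ _ _ hx hy => B.relAct_br ρ hx hy

/-- This is the balancing condition over `U(h)`, so the universal property of the tensor product
yields a map from the induced representation. -/
theorem relMorphism_incl (b : SuperEnveloping K h) (w : W) :
    B.relMorphism ρ (SuperEnveloping.incl h b) ((B.rel ρ Set.univ).mkQ (1 ⊗ₜ w)) =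
      (B.rel ρ Set.univ).mkQ (1 ⊗ₜ ρ.structureMorphism b w) := by
  induction b using SuperEnveloping.induction generalizing w with
  | halg r => simp
  | hι x =>
    rw [SuperEnveloping.incl_ι, relMorphism, SuperEnveloping.lift_ι, relAct_mkQ,
      ρ.structureMorphism_ι, ← sub_eq_zero, ← map_sub, Submodule.mkQ_apply,
      Submodule.Quotient.mk_eq_zero]
    have := B.last_mem_of_mem ρ (S := Set.univ) (u := []) (fun _ _ => trivial) w x
    simpa using this
  | hmul a b ha hb =>
    rw [map_mul, map_mul, Module.End.mul_apply, hb, ha, map_mul, Module.End.mul_apply]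
  | hadd a b ha hb =>
    rw [map_add, map_add, LinearMap.add_apply, hb, ha, map_add, LinearMap.add_apply,
      TensorProduct.tmul_add, map_add]

/-- The canonical map from the induced representation to the quotient by the rewriting
relations. -/
def indToRel : ρ.IndSpace →ₗ[K] B.RelQuot ρ :=
  ρ.balancing.liftQ (TensorProduct.lift
    (((B.rel ρ Set.univ).mkQ ∘ₗ TensorProduct.mk K _ W 1).lcomp K _ ∘ₗ
      (B.relMorphism ρ).toLinearMap)) (by
    refine Submodule.span_le.mpr ?_
    rintro _ ⟨a, b, w, rfl⟩
    rw [SetLike.mem_coe, LinearMap.mem_ker, map_sub, TensorProduct.lift.tmul,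
      TensorProduct.lift.tmul]
    change B.relMorphism ρ (a * _) _ - B.relMorphism ρ a _ = 0
    rw [map_mul, Module.End.mul_apply]
    change B.relMorphism ρ a (B.relMorphism ρ _ ((B.rel ρ Set.univ).mkQ (1 ⊗ₜ w))) -
      B.relMorphism ρ a ((B.rel ρ Set.univ).mkQ (1 ⊗ₜ _)) = 0
    rw [relMorphism_incl, sub_self])

theorem indToRel_indTmul (a : SuperEnveloping K g) (w : W) :
    B.indToRel ρ (ρ.indTmul a w) =
      B.relMorphism ρ a ((B.rel ρ Set.univ).mkQ (1 ⊗ₜ w)) := rfl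

theorem indToRel_indWord (l : List ι) (w : W) :
    B.indToRel ρ (B.indWord ρ l w) = (B.rel ρ Set.univ).mkQ (B.word l ⊗ₜ w) := by
  rw [indWord, indToRel_indTmul]
  induction l with
  | nil => simp
  | cons a l ih =>
    rw [List.map_cons, List.prod_cons, map_mul, Module.End.mul_apply, ih, relMorphism,
      SuperEnveloping.lift_ι, relAct_mkQ, word_cons]

open Classical in
/-- The independence half of the Poincaré–Birkhoff–Witt theorem: the coordinates of the induced
representation with respect to the irreducible words are well defined. -/
theorem exists_coef : ∃ coef : List ι → ρ.IndSpace →ₗ[K] W,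
    ∀ l l' w, B.Irr l → coef l' (B.indWord ρ l w) = if l = l' then w else 0 := by
  -- The normal form factors through the quotient by the rules and fixes irreducible words, so its
  -- components are the desired coordinates.
  obtain ⟨N, hN, hN'⟩ := exists_normalForm B.wordBasis
    (List.Shortlex.wf (wellFounded_lt (α := ι))) (B.Rule ρ) (B.rule_low ρ) (B.confluent ρ)
  have hker : B.rel ρ Set.univ ≤ LinearMap.ker N := by
    refine Submodule.span_le.mpr ?_
    rintro _ ⟨l, -, r, hr, w, rfl⟩
    rw [SetLike.mem_coe, LinearMap.mem_ker, map_sub, hN l r hr, sub_self]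
  refine ⟨fun l' => tensorConstr B.wordBasis
    (fun l => if l = l' then LinearMap.id else 0) ∘ₗ (B.rel ρ Set.univ).liftQ N hker ∘ₗ
      B.indToRel ρ, fun l l' w hl => ?_⟩
  rw [LinearMap.comp_apply, LinearMap.comp_apply, indToRel_indWord, Submodule.mkQ_apply,
    Submodule.liftQ_apply, ← wordBasis_apply, hN' l (hl.not_rule B ρ), tensorConstr_tmul]
  split <;> rfl

end AdaptedBasis

end

/-! ### The action of the ideal on the filtration, up to second order -/

noncomputable section
open SuperSpace (deg)
open LieSuperalgebra (br)

theorem koszulSign_add_left {K : Type*} [Field K] (i j l : ZMod 2) :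
    koszulSign K (i + j) l = koszulSign K i l * koszulSign K j l := by
  rcases zmodTwo_cases i with rfl | rfl <;> rcases zmodTwo_cases j with rfl | rfl <;>
    rcases zmodTwo_cases l with rfl | rfl <;> simp [zmodTwo_one_add_one]

theorem koszulSign_comm {K : Type*} [Field K] (i j : ZMod 2) :
    koszulSign K i j = koszulSign K j i := by
  simp [koszulSign, mul_comm]

theorem koszulSign_add_right {K : Type*} [Field K] (i j l : ZMod 2) :
    koszulSign K i (j + l) = koszulSign K i j * koszulSign K i l := by
  rw [koszulSign_comm, koszulSign_add_left, koszulSign_comm j, koszulSign_comm l]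

theorem koszulSign_mul_self {K : Type*} [Field K] (i j : ZMod 2) :
    koszulSign K i j * koszulSign K i j = 1 := by
  simp [koszulSign, ← mul_pow]

/-- The adjoint action of a Lie superalgebra on an ideal. -/
def adIdeal {K : Type*} {g : Type*} [Field K] [AddCommGroup g] [Module K g]
    [SuperSpace K g] [LieSuperalgebra K g] {k : LieSubsuperalgebra K g} (hk : k.IsIdeal) :
    g →ₗ[K] k →ₗ[K] k :=
  LinearMap.mk₂ K (fun y x => ⟨br K y x.1, hk y x.1 x.2⟩)
    (fun _ _ _ => Subtype.ext (by simp)) (fun _ _ _ => Subtype.ext (by simp))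
    (fun _ _ _ => Subtype.ext (by simp)) (fun _ _ _ => Subtype.ext (by simp))

namespace AdaptedBasis

set_option linter.unusedSectionVars false

variable {K : Type*} {g : Type*} {W : Type*} [Field K] [AddCommGroup g] [Module K g]
  [SuperSpace K g] [LieSuperalgebra K g] [AddCommGroup W] [Module K W] [SuperSpace K W]
  {h : LieSubsuperalgebra K g} {ι : Type*} [LinearOrder ι] (B : AdaptedBasis h ι)
  (ρ : SuperRep K h W)

/-- The parity of a word. -/
def par (l : List ι) : ZMod 2 := (l.map B.p).sum

@[simp] theorem par_nil : B.par [] = 0 := rfl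

@[simp] theorem par_cons (a : ι) (l : List ι) : B.par (a :: l) = B.p a + B.par l := by
  simp [par]

theorem indAct_indWord (a : ι) (l : List ι) (w : W) :
    ρ.indAct (B.z a) (B.indWord ρ l w) = B.indWord ρ (a :: l) w := by
  rw [indWord, SuperRep.indAct_indTmul, indWord, List.map_cons, List.prod_cons]

theorem indWord_mem_filt {l : List ι} {n : ℕ} (hl : l.length < n) (w : W) :
    B.indWord ρ l w ∈ B.filt ρ n :=
  Submodule.subset_span ⟨l, w, hl, rfl⟩

theorem filt_mono {m n : ℕ} (hmn : m ≤ n) : B.filt ρ m ≤ B.filt ρ n :=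
  Submodule.span_mono fun _ ⟨l, w, hl, e⟩ => ⟨l, w, hl.trans_le hmn, e⟩

theorem filt_zero : B.filt ρ 0 = ⊥ := by
  rw [filt, Submodule.span_eq_bot]
  rintro _ ⟨l, w, hl, -⟩
  exact absurd hl (Nat.not_lt_zero _)

theorem indAct_basis_mem_filt (a : ι) {n : ℕ} {t : ρ.IndSpace} (ht : t ∈ B.filt ρ n) :
    ρ.indAct (B.z a) t ∈ B.filt ρ (n + 1) := by
  have hle : B.filt ρ n ≤ (B.filt ρ (n + 1)).comap (ρ.indAct (B.z a)) := by
    refine Submodule.span_le.mpr ?_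
    rintro _ ⟨l, w, hl, rfl⟩
    rw [SetLike.mem_coe, Submodule.mem_comap, indAct_indWord]
    exact B.indWord_mem_filt ρ (by simpa using hl) w
  exact hle ht

theorem indAct_mem_filt (x : g) {n : ℕ} {t : ρ.IndSpace} (ht : t ∈ B.filt ρ n) :
    ρ.indAct x t ∈ B.filt ρ (n + 1) := by
  have hx := B.z.mem_span x
  induction hx using Submodule.span_induction with
  | mem x hx =>
    obtain ⟨a, rfl⟩ := hx
    exact B.indAct_basis_mem_filt ρ a ht
  | zero => simp
  | add x y _ _ h1 h2 => rw [map_add]; exact add_mem h1 h2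
  | smul c x _ h1 => rw [map_smul]; exact Submodule.smul_mem _ c h1

theorem indAct_mem_filt_pred (x : g) {n : ℕ} {t : ρ.IndSpace} (ht : t ∈ B.filt ρ (n - 1)) :
    ρ.indAct x t ∈ B.filt ρ n := by
  cases n with
  | zero =>
    rw [filt_zero, Submodule.mem_bot] at ht
    simp [ht]
  | succ n => exact B.indAct_mem_filt ρ x ht

theorem exists_mem_filt (t : ρ.IndSpace) : ∃ n, t ∈ B.filt ρ n := by
  let N : Submodule K ρ.IndSpace :=
    { carrier := {t | ∃ n, t ∈ B.filt ρ n}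
      add_mem' := by
        rintro s t ⟨n, hn⟩ ⟨m, hm⟩
        exact ⟨max n m, add_mem (B.filt_mono ρ (le_max_left _ _) hn)
          (B.filt_mono ρ (le_max_right _ _) hm)⟩
      zero_mem' := ⟨0, zero_mem _⟩
      smul_mem' := fun c t ⟨n, hn⟩ => ⟨n, Submodule.smul_mem _ c hn⟩ }
  have hmul : ∀ (a : SuperEnveloping K g), ∀ t ∈ N, ρ.indMul a t ∈ N := by
    intro a
    induction a using SuperEnveloping.induction with
    | halg r =>
      intro t ht
      have e : ρ.indMul (algebraMap K _ r) = r • LinearMap.id := ρ.ind_ext fun a w => by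
        rw [SuperRep.indMul_indTmul, ← Algebra.smul_def]
        rfl
      rw [e]
      exact Submodule.smul_mem N r ht
    | hι x => exact fun t ⟨n, hn⟩ => ⟨n + 1, B.indAct_mem_filt ρ x hn⟩
    | hmul a b ha hb =>
      intro t ht
      have e : ρ.indMul (a * b) = ρ.indMul a * ρ.indMul b := ρ.ind_ext fun c w => by
        rw [Module.End.mul_apply]
        simp only [SuperRep.indMul_indTmul, mul_assoc]
      rw [e]
      exact ha _ (hb t ht)
    | hadd a b ha hb =>
      intro t ht
      have e : ρ.indMul (a + b) = ρ.indMul a + ρ.indMul b := ρ.ind_ext fun c w => by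
        rw [LinearMap.add_apply]
        simp only [SuperRep.indMul_indTmul, add_mul]
        simp only [SuperRep.indTmul, TensorProduct.add_tmul, map_add]
      rw [e]
      exact add_mem (ha t ht) (hb t ht)
  have : ∀ t : ρ.IndSpace, t ∈ N := by
    intro t
    obtain ⟨t, rfl⟩ := ρ.balancing.mkQ_surjective t
    induction t using TensorProduct.induction_on with
    | zero => simp
    | add a b ha hb => rw [map_add]; exact add_mem ha hb
    | tmul a w =>
      have e : ρ.balancing.mkQ (a ⊗ₜ w) = ρ.indMul a (B.indWord ρ [] w) := by
        rw [indWord, SuperRep.indMul_indTmul, List.map_nil, List.prod_nil, mul_one]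
        rfl
      rw [e]
      exact hmul a _ ⟨1, B.indWord_mem_filt ρ (by simp) w⟩
  exact this t

variable {k : LieSubsuperalgebra K g} (hk : k.IsIdeal) (hkh : k.toSubmodule ≤ h.toSubmodule)

theorem indAct_nil (x : h) (w : W) :
    ρ.indAct x.1 (B.indWord ρ [] w) = B.indWord ρ [] (ρ.act x w) := by
  rw [indWord, SuperRep.indAct_indTmul, List.map_nil, List.prod_nil, mul_one, indWord,
    List.map_nil, List.prod_nil, ← indTmul_mul_ι, one_mul]

variable [CharZero K]

/-- The part of degree `n - 1` of the action of `x ∈ k` on a word of length `n`. -/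
def firstOrder (x : k) (l : List ι) (w : W) : ρ.IndSpace :=
  ∑ i : Fin l.length, koszulSign K (B.p (l.get i)) (B.par (l.drop (i + 1))) •
    B.indWord ρ (l.eraseIdx i) ((ρ.restrict hkh).act (adIdeal hk (B.z (l.get i)) x) w)

theorem firstOrder_cons (x : k) (a : ι) (l : List ι) (w : W) :
    B.firstOrder ρ hk hkh x (a :: l) w =
      koszulSign K (B.p a) (B.par l) •
        B.indWord ρ l ((ρ.restrict hkh).act (adIdeal hk (B.z a) x) w) +
      ρ.indAct (B.z a) (B.firstOrder ρ hk hkh x l w) := by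
  rw [firstOrder, firstOrder]
  simp only [List.length_cons, map_sum, map_smul, indAct_indWord]
  rw [Fin.sum_univ_succ]
  simp

theorem firstOrder_mem (x : k) (l : List ι) (w : W) :
    B.firstOrder ρ hk hkh x l w ∈ B.filt ρ l.length := by
  refine sum_mem fun i _ => Submodule.smul_mem _ _ (B.indWord_mem_filt ρ ?_ _)
  rw [List.length_eraseIdx, if_pos i.2]
  have := i.2
  omega

theorem adIdeal_mem {i j : ZMod 2} {y : g} {x : k} (hy : y ∈ deg (K := K) i)
    (hx : x ∈ deg (K := K) j) : adIdeal hk y x ∈ deg (K := K) (i + j) :=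
  LieSuperalgebra.br_mem (K := K) (g := g) hy hx

theorem indAct_swap {i j : ZMod 2} {y : g} {x : k} (hy : y ∈ deg (K := K) i)
    (hx : x ∈ deg (K := K) j) (t : ρ.IndSpace) :
    ρ.indAct x.1 (ρ.indAct y t) = koszulSign K j i •
      (ρ.indAct y (ρ.indAct x.1 t) - ρ.indAct (adIdeal hk y x).1 t) := by
  have hx' : x.1 ∈ deg (K := K) j := hx
  have := LinearMap.congr_fun (ρ.ind.act_br hy hx') t
  have e : ρ.indAct (adIdeal hk y x).1 t = ρ.indAct y (ρ.indAct x.1 t) -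
      koszulSign K i j • ρ.indAct x.1 (ρ.indAct y t) := this
  rw [e, sub_sub_cancel, smul_smul, koszulSign_comm, koszulSign_mul_self, one_smul]

/-- Moving `x` to the right past each letter either keeps `x` or replaces letter and `x` by a
bracket, again in `k`. Terms with two or more letters lost are discarded. For the empty word `filt 0
= ⊥`, so the formula is exact. -/
theorem indAct_indWord_sub_mem (l : List ι) {j : ZMod 2} {x : k} (hx : x ∈ deg (K := K) j)
    (w : W) :
    ρ.indAct x.1 (B.indWord ρ l w) - koszulSign K j (B.par l) •
      (B.indWord ρ l ((ρ.restrict hkh).act x w) - B.firstOrder ρ hk hkh x l w) ∈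
      B.filt ρ (l.length - 1) := by
  induction l generalizing j x with
  | nil =>
    have e := B.indAct_nil ρ (Submodule.inclusion hkh x) w
    have e' : ρ.indAct x.1 (B.indWord ρ [] w) =
      B.indWord ρ [] ((ρ.restrict hkh).act x w) := e
    rw [e']
    simp [firstOrder]
  | cons a l ih =>
    rw [← indAct_indWord, indAct_swap ρ hk (B.z_mem a) hx]
    have h1 := B.indAct_mem_filt_pred ρ (B.z a) (ih hx)
    have h2 := B.filt_mono ρ (Nat.sub_le _ _) (ih (adIdeal_mem hk (B.z_mem a) hx))
    have h3 := B.firstOrder_mem ρ hk hkh (adIdeal hk (B.z a) x) l w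
    rw [List.length_cons, Nat.add_sub_cancel]
    -- In the branch where `x` has become `[z_a, x]` one letter is already lost, so only the leading
    -- term counts and its `firstOrder` part (`h3`) goes into the error.
    have key := Submodule.smul_mem _ (koszulSign K j (B.p a)) (sub_mem h1 (sub_mem h2
      (Submodule.smul_mem _ (koszulSign K (B.p a + j) (B.par l)) h3)))
    convert key using 1
    rw [firstOrder_cons, par_cons, koszulSign_add_right, koszulSign_add_left, ← indAct_indWord]
    simp only [map_sub, map_smul, smul_sub, smul_add, smul_smul]
    module

end AdaptedBasis

end

/-! ### Coordinates of the induced representation and the action of `k` on them -/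

noncomputable section
open SuperSpace (deg)
open LieSuperalgebra (br)

theorem List.eq_insertIdx_iff {α : Type*} {l β : List α} {i : ℕ} (hi : i < l.length)
    (hlen : l.length = β.length + 1) (a : α) :
    l = β.insertIdx i a ↔ l.eraseIdx i = β ∧ l.get ⟨i, hi⟩ = a := by
  constructor
  · rintro rfl
    exact ⟨List.eraseIdx_insertIdx_self _, List.getElem_insertIdx_self _⟩
  · rintro ⟨rfl, rfl⟩
    rw [List.get_eq_getElem, List.insertIdx_eraseIdx_getElem]

theorem List.drop_eraseIdx_self {α : Type*} {l : List α} (i : Fin l.length) :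
    (l.eraseIdx i).drop i = l.drop (i + 1) := by
  rw [List.eraseIdx_eq_take_drop_succ]
  exact List.drop_left' (by rw [List.length_take, min_eq_left i.2.le])

namespace AdaptedBasis

set_option linter.unusedSectionVars false

variable {K : Type*} {g : Type*} {W : Type*} [Field K] [AddCommGroup g] [Module K g]
  [SuperSpace K g] [LieSuperalgebra K g] [AddCommGroup W] [Module K W] [SuperSpace K W]
  {h : LieSubsuperalgebra K g} {ι : Type*} [LinearOrder ι] (B : AdaptedBasis h ι)
  (ρ : SuperRep K h W) [CharZero K]

section parity

theorem parityMap_ind (t : ρ.IndSpace) : parityMap K ρ.IndSpace t = ρ.indParity t := by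
  obtain ⟨t₀, h₀, t₁, h₁, rfl⟩ := SuperSpace.exists_add K t
  rw [map_add, map_add, parityMap_apply h₀, parityMap_apply h₁, ρ.indParity_apply 0 t₀ h₀,
    ρ.indParity_apply 1 t₁ h₁]

theorem parityMap_indWord (l : List ι) (w : W) :
    parityMap K ρ.IndSpace (B.indWord ρ l w) =
      koszulSign K (B.par l) 1 • B.indWord ρ l (parityMap K W w) := by
  induction l with
  | nil =>
    have e : ρ.indParity (ρ.indTmul 1 w) =
      ρ.indTmul (SuperEnveloping.parity K g 1) (parityMap K W w) := rfl
    rw [parityMap_ind, indWord, List.map_nil, List.prod_nil, e, map_one]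
    simp [indWord]
  | cons a l ih =>
    have e := ρ.ind.parityMap_act (B.z a) (B.indWord ρ l w)
    rw [parityMap_apply (B.z_mem a), ih, map_smul, map_smul, LinearMap.smul_apply] at e
    have e' : ∀ t, ρ.ind.act (B.z a) t = ρ.indAct (B.z a) t := fun _ => rfl
    rw [e', e', indAct_indWord, indAct_indWord] at e
    rw [e, smul_smul, par_cons, koszulSign_add_left, mul_comm]

theorem parityMap_mem_filt {n : ℕ} {t : ρ.IndSpace} (ht : t ∈ B.filt ρ n) :
    parityMap K ρ.IndSpace t ∈ B.filt ρ n := by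
  have hle : B.filt ρ n ≤ (B.filt ρ n).comap (parityMap K ρ.IndSpace) := by
    refine Submodule.span_le.mpr ?_
    rintro _ ⟨l, w, hl, rfl⟩
    rw [SetLike.mem_coe, Submodule.mem_comap, parityMap_indWord]
    exact Submodule.smul_mem _ _ (B.indWord_mem_filt ρ hl _)
  exact hle ht

end parity

theorem Irr.eraseIdx {l : List ι} (hl : B.Irr l) (i : ℕ) : B.Irr (l.eraseIdx i) :=
  ⟨hl.1.sublist (List.eraseIdx_sublist l i),
    fun a ha => hl.2 a ((List.eraseIdx_sublist l i).subset ha)⟩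

variable [Finite ι]

/-- Coordinates are given explicitly only on irreducible words; the spanning half of PBW allows
checking linear identities there while keeping the bound on the length. -/
theorem filt_induction {n : ℕ} {P : ρ.IndSpace → Prop}
    (hw : ∀ l w, B.Irr l → l.length < n → P (B.indWord ρ l w)) (h0 : P 0)
    (hadd : ∀ s t, s ∈ B.filt ρ n → t ∈ B.filt ρ n → P s → P t → P (s + t))
    (hsmul : ∀ (c : K) t, t ∈ B.filt ρ n → P t → P (c • t)) {t : ρ.IndSpace}
    (ht : t ∈ B.filt ρ n) : P t := by
  have hback : ∀ s ∈ Submodule.span K {t | ∃ l w, B.Irr l ∧ l.length < n ∧ t = B.indWord ρ l w},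
      s ∈ B.filt ρ n := by
    refine Submodule.span_le.mpr ?_
    rintro _ ⟨l, w, -, h2, rfl⟩
    exact B.indWord_mem_filt ρ h2 w
  have ht' := B.filt_le ρ n ht
  clear ht
  induction ht' using Submodule.span_induction with
  | mem t ht =>
    obtain ⟨l, w, h1, h2, rfl⟩ := ht
    exact hw l w h1 h2
  | zero => exact h0
  | add s t hs ht h1 h2 => exact hadd s t (hback s hs) (hback t ht) h1 h2
  | smul c t ht h => exact hsmul c t (hback t ht) h

/-- The coordinates with respect to the irreducible words. -/
def coef (l : List ι) : ρ.IndSpace →ₗ[K] W := (B.exists_coef ρ).choose l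

open Classical in
theorem coef_indWord {l : List ι} (hl : B.Irr l) (l' : List ι) (w : W) :
    B.coef ρ l' (B.indWord ρ l w) = if l = l' then w else 0 :=
  (B.exists_coef ρ).choose_spec l l' w hl

theorem coef_of_mem_filt {n : ℕ} {t : ρ.IndSpace} (ht : t ∈ B.filt ρ n) {l : List ι}
    (hl : n ≤ l.length) : B.coef ρ l t = 0 := by
  refine B.filt_induction ρ (P := fun t => B.coef ρ l t = 0) ?_ (map_zero _) ?_ ?_ ht
  · intro l' w h1 h2
    rw [B.coef_indWord ρ h1, if_neg]
    rintro rfl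
    omega
  · intro s t _ _ h1 h2
    rw [map_add, h1, h2, add_zero]
  · intro c t _ h
    rw [map_smul, h, smul_zero]

theorem coef_of_not_irr {l : List ι} (hl : ¬ B.Irr l) (t : ρ.IndSpace) : B.coef ρ l t = 0 := by
  obtain ⟨n, ht⟩ := B.exists_mem_filt ρ t
  refine B.filt_induction ρ (P := fun t => B.coef ρ l t = 0) ?_ (map_zero _) ?_ ?_ ht
  · intro l' w h1 h2
    rw [B.coef_indWord ρ h1, if_neg]
    rintro rfl
    exact hl h1
  · intro s t _ _ h1 h2
    rw [map_add, h1, h2, add_zero]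
  · intro c t _ h
    rw [map_smul, h, smul_zero]

/-- Modulo shorter words, an element is a combination of irreducible words of length `n`, and its
coordinates there are precisely the coefficients. -/
theorem mem_filt_of_coef_eq_zero {n : ℕ} {t : ρ.IndSpace} (ht : t ∈ B.filt ρ (n + 1))
    (h0 : ∀ l : List ι, l.length = n → B.coef ρ l t = 0) : t ∈ B.filt ρ n := by
  classical
  have key : ∃ c : List ι →₀ W, (∀ l ∈ c.support, B.Irr l ∧ l.length = n) ∧
      t - c.sum (fun l w => B.indWord ρ l w) ∈ B.filt ρ n := by
    have hadd : ∀ (c c' : List ι →₀ W), (c + c').sum (fun l w => B.indWord ρ l w) =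
        c.sum (fun l w => B.indWord ρ l w) + c'.sum (fun l w => B.indWord ρ l w) := by
      intro c c'
      refine Finsupp.sum_add_index' (fun l => ?_) (fun l w w' => ?_) <;>
        simp [indWord, SuperRep.indTmul, TensorProduct.tmul_add]
    refine B.filt_induction ρ (P := fun t => ∃ c : List ι →₀ W,
      (∀ l ∈ c.support, B.Irr l ∧ l.length = n) ∧
        t - c.sum (fun l w => B.indWord ρ l w) ∈ B.filt ρ n) ?_ ⟨0, by simp⟩ ?_ ?_ ht
    · intro l w h1 h2
      rcases Nat.lt_succ_iff_lt_or_eq.mp h2 with h2 | h2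
      · exact ⟨0, by simpa using B.indWord_mem_filt ρ h2 w⟩
      · refine ⟨Finsupp.single l w, fun l' hl' => ?_, ?_⟩
        · obtain rfl := Finset.mem_singleton.mp (Finsupp.support_single_subset hl')
          exact ⟨h1, h2⟩
        · rw [Finsupp.sum_single_index (by simp [indWord, SuperRep.indTmul]), sub_self]
          exact zero_mem _
    · rintro s t - - ⟨c, hc, hs⟩ ⟨c', hc', ht⟩
      refine ⟨c + c', fun l hl => ?_, ?_⟩
      · rcases Finset.mem_union.mp (Finsupp.support_add hl) with h | h
        · exact hc l h
        · exact hc' l h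
      · rw [hadd, add_sub_add_comm]
        exact add_mem hs ht
    · rintro a t - ⟨c, hc, ht⟩
      refine ⟨a • c, fun l hl => hc l (Finsupp.support_smul hl), ?_⟩
      have e : (a • c).sum (fun l w => B.indWord ρ l w) =
          a • c.sum (fun l w => B.indWord ρ l w) := by
        rw [Finsupp.sum_smul_index' (by simp [indWord, SuperRep.indTmul]), Finsupp.smul_sum]
        simp [indWord, SuperRep.indTmul]
      rw [e, ← smul_sub]
      exact Submodule.smul_mem _ a ht
  obtain ⟨c, hc, ht'⟩ := key
  have hc0 : c = 0 := by
    ext l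
    rw [Finsupp.zero_apply]
    by_contra hl
    have hls := hc l (Finsupp.mem_support_iff.mpr hl)
    have h1 := B.coef_of_mem_filt ρ ht' hls.2.ge
    rw [map_sub, h0 l hls.2, zero_sub, neg_eq_zero, Finsupp.sum, map_sum] at h1
    have h2 : ∀ l' ∈ c.support, B.coef ρ l (B.indWord ρ l' (c l')) = if l' = l then c l' else 0 :=
      fun l' hl' => B.coef_indWord ρ (hc l' hl').1 l _
    rw [Finset.sum_congr rfl h2, Finset.sum_ite_eq', if_pos (Finsupp.mem_support_iff.mpr hl)] at h1
    exact hl h1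
  simpa [hc0] using ht'

theorem coef_parityMap (l : List ι) (t : ρ.IndSpace) :
    B.coef ρ l (parityMap K ρ.IndSpace t) =
      koszulSign K (B.par l) 1 • parityMap K W (B.coef ρ l t) := by
  obtain ⟨n, ht⟩ := B.exists_mem_filt ρ t
  refine B.filt_induction ρ (P := fun t => B.coef ρ l (parityMap K ρ.IndSpace t) =
      koszulSign K (B.par l) 1 • parityMap K W (B.coef ρ l t)) ?_ (by simp) ?_ ?_ ht
  · intro l' w h1 h2
    rw [parityMap_indWord, map_smul, B.coef_indWord ρ h1, B.coef_indWord ρ h1]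
    split
    · next e => rw [e]
    · simp
  · intro s t _ _ h1 h2
    simp only [map_add, h1, h2, smul_add]
  · intro c t _ h
    simp only [map_smul, h, smul_comm c]

variable {k : LieSubsuperalgebra K g} (hk : k.IsIdeal) (hkh : k.toSubmodule ≤ h.toSubmodule)

/-- A term in which `x` has met a letter is shorter, so it is invisible to the top coordinates. -/
theorem coef_indAct_top (hk : k.IsIdeal) {l : List ι} {j : ZMod 2} {x : k} (hx : x ∈ deg (K := K) j)
    {t : ρ.IndSpace} (ht : t ∈ B.filt ρ (l.length + 1)) :
    B.coef ρ l (ρ.indAct x.1 t) =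
      koszulSign K j (B.par l) • (ρ.restrict hkh).act x (B.coef ρ l t) := by
  refine B.filt_induction ρ (P := fun t => B.coef ρ l (ρ.indAct x.1 t) =
      koszulSign K j (B.par l) • (ρ.restrict hkh).act x (B.coef ρ l t)) ?_ (by simp) ?_ ?_ ht
  · intro l' w h1 h2
    have e := B.coef_of_mem_filt ρ (B.filt_mono ρ (Nat.sub_le _ _)
      (B.indAct_indWord_sub_mem ρ hk hkh l' hx w)) (Nat.lt_succ_iff.mp h2)
    have e' := B.coef_of_mem_filt ρ (B.firstOrder_mem ρ hk hkh x l' w) (Nat.lt_succ_iff.mp h2)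
    rw [map_sub, map_smul, map_sub, e', sub_zero, B.coef_indWord ρ h1, sub_eq_zero] at e
    rw [e, B.coef_indWord ρ h1]
    split
    · next e => rw [e]
    · simp
  · intro s t _ _ h1 h2
    simp only [map_add, h1, h2, smul_add]
  · intro c t _ h
    simp only [map_smul, h, smul_comm c]

/-- Deleting the letter at position `i` of `l` gives `β` exactly when `l` is `β` with that letter
inserted at `i`. A repeated letter makes the same `l` occur for several positions, and each is
counted. -/
theorem coef_firstOrder [Fintype ι] (x : k) {l : List ι} (hl : B.Irr l) (β : List ι) (w : W) :
    B.coef ρ β (B.firstOrder ρ hk hkh x l w) =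
      ∑ q : ι × Fin (β.length + 1),
        koszulSign K (B.p q.1) (B.par (β.drop q.2)) • (ρ.restrict hkh).act (adIdeal hk (B.z q.1) x)
          (B.coef ρ (β.insertIdx q.2 q.1) (B.indWord ρ l w)) := by
  classical
  rw [firstOrder, map_sum]
  simp only [map_smul, B.coef_indWord ρ (Irr.eraseIdx B hl _), B.coef_indWord ρ hl]
  by_cases hlen : l.length = β.length + 1
  · rw [Fintype.sum_prod_type_right]
    refine Fintype.sum_equiv (finCongr hlen) _ _ fun i => ?_
    have hiff := fun a => List.eq_insertIdx_iff i.2 hlen a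
    simp only [finCongr_apply, Fin.val_cast, hiff]
    rw [Finset.sum_eq_single (l.get i)]
    · by_cases he : l.eraseIdx i = β
      · rw [if_pos he, if_pos ⟨he, rfl⟩, ← he, List.drop_eraseIdx_self]
      · rw [if_neg he, smul_zero, if_neg fun h => he h.1, map_zero, smul_zero]
    · intro a _ ha
      rw [if_neg fun h => ha h.2.symm, map_zero, smul_zero]
    · simp
  · rw [Finset.sum_eq_zero, Finset.sum_eq_zero]
    · intro q _
      rw [if_neg, map_zero, smul_zero]
      rintro rfl
      apply hlen
      rw [List.length_insertIdx_of_le_length]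
      have := q.2.2
      omega
    · intro i _
      rw [if_neg, smul_zero]
      rintro rfl
      apply hlen
      rw [List.length_eraseIdx, if_pos i.2]
      have := i.2
      omega

/-- One degree below the top, the brackets of `x` with the letters enter for the first time. This is
the formula that detects the stabilizer. -/
theorem coef_indAct [Fintype ι] {β : List ι} {j : ZMod 2} {x : k} (hx : x ∈ deg (K := K) j)
    {t : ρ.IndSpace} (ht : t ∈ B.filt ρ (β.length + 2)) :
    B.coef ρ β (ρ.indAct x.1 t) =
      koszulSign K j (B.par β) • (ρ.restrict hkh).act x (B.coef ρ β t) -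
      ∑ q : ι × Fin (β.length + 1), (koszulSign K j (B.par β + B.p q.1) *
        koszulSign K (B.p q.1) (B.par (β.drop q.2))) •
          (ρ.restrict hkh).act (adIdeal hk (B.z q.1) x) (B.coef ρ (β.insertIdx q.2 q.1) t) := by
  classical
  refine B.filt_induction ρ (P := fun t => B.coef ρ β (ρ.indAct x.1 t) =
      koszulSign K j (B.par β) • (ρ.restrict hkh).act x (B.coef ρ β t) -
      ∑ q : ι × Fin (β.length + 1), (koszulSign K j (B.par β + B.p q.1) *
        koszulSign K (B.p q.1) (B.par (β.drop q.2))) •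
          (ρ.restrict hkh).act (adIdeal hk (B.z q.1) x) (B.coef ρ (β.insertIdx q.2 q.1) t))
    ?_ (by simp) ?_ ?_ ht
  · intro l w h1 h2
    have e := B.coef_of_mem_filt ρ (B.indAct_indWord_sub_mem ρ hk hkh l hx w) (l := β) (by omega)
    rw [map_sub, map_smul, map_sub, B.coef_indWord ρ h1, B.coef_firstOrder ρ hk hkh x h1,
      sub_eq_zero] at e
    rw [e, B.coef_indWord ρ h1, smul_sub, Finset.smul_sum]
    congr 1
    · split
      · next e => rw [e]
      · simp
    · refine Finset.sum_congr rfl fun q _ => ?_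
      rw [B.coef_indWord ρ h1]
      split
      · next e =>
        have : B.par l = B.par β + B.p q.1 := by
          have hp := List.perm_insertIdx q.1 β (i := q.2) (by have := q.2.2; omega)
          rw [e, par, (hp.map B.p).sum_eq, List.map_cons, List.sum_cons, par, add_comm]
        rw [smul_smul, this]
      · simp
  · intro s t _ _ h1 h2
    simp only [map_add, h1, h2, smul_add, Finset.sum_add_distrib]
    abel
  · intro c t _ h
    simp only [map_smul, h, smul_sub, Finset.smul_sum, smul_comm c]

end AdaptedBasis

end

/-! ### Copies of a simple representation and a criterion for the stabilizer -/

noncomputable section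
open SuperSpace (deg)
open LieSuperalgebra (br)

namespace SuperRep

section embedding

variable {K : Type*} {g : Type*} {U : Type*} {M : Type*} [Field K] [CharZero K] [AddCommGroup g]
  [Module K g] [SuperSpace K g] [LieSuperalgebra K g] [AddCommGroup U] [Module K U]
  [SuperSpace K U] [AddCommGroup M] [Module K M] [SuperSpace K M]

/-- The restriction of a representation to a subalgebra. -/
def toSub (ρ : SuperRep K g M) (k : LieSubsuperalgebra K g) : SuperRep K k M where
  act := ρ.act ∘ₗ k.toSubmodule.subtype
  act_mem {i x} hx := ρ.act_mem (i := i) (x := x.1) hx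
  act_br {i j x y} hx hy := ρ.act_br (i := i) (j := j) (x := x.1) (y := y.1) hx hy

/-- A nonzero subrepresentation which embeds into a direct sum of copies of a simple
representation (up to parity) contains a copy of it. -/
theorem IsSimple.exists_embedding {σ : SuperRep K g U} (hσ : σ.IsSimple) (τ : SuperRep K g M)
    {R : Submodule K M} (hRP : ∀ r ∈ R, parityMap K M r ∈ R)
    (hRa : ∀ x, ∀ r ∈ R, τ.act x r ∈ R) (hR : R ≠ ⊥) {Q : Type*} (f : Q → M →ₗ[K] U)
    (δ : Q → ZMod 2)
    (hP : ∀ q, ∀ r ∈ R, f q (parityMap K M r) = koszulSign K (δ q) 1 • parityMap K U (f q r))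
    (ha : ∀ q, ∀ {j : ZMod 2} {x : g}, x ∈ deg (K := K) j → ∀ r ∈ R,
      f q (τ.act x r) = koszulSign K j (δ q) • σ.act x (f q r))
    (hinj : ∀ r ∈ R, (∀ q, f q r = 0) → r = 0) (hfin : ∀ r ∈ R, {q | f q r ≠ 0}.Finite) :
    ∃ (q : Q) (T : U →ₗ[K] M), (∀ u, T u ∈ R) ∧ (∀ u, f q (T u) = u) ∧
      IsSuperHom σ τ (δ q) T := by
  obtain ⟨r₀, hr₀, hr₀0⟩ := Submodule.exists_mem_ne_zero_of_ne_bot hR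
  -- A nonzero element with as few nonzero coordinates as possible.
  obtain ⟨r, ⟨hr, hr0⟩, hmin⟩ := WellFounded.has_min
    (InvImage.wf (fun r : M => {q | f q r ≠ 0}.ncard) Nat.lt_wfRel.wf)
    {r | r ∈ R ∧ r ≠ 0} ⟨r₀, hr₀, hr₀0⟩
  obtain ⟨q, hq⟩ : ∃ q, f q r ≠ 0 := by
    by_contra! h
    exact hr0 (hinj r hr h)
  -- A nonzero element of `O` killed by `f q` would have fewer nonzero coordinates than `r`, so `f
  -- q` is injective on `O`. Its image is a nonzero subrepresentation of `U`, hence all of `U`, and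
  -- `T` is the inverse.
  let O : Submodule K M :=
    { carrier := {s | s ∈ R ∧ ∀ q, f q r = 0 → f q s = 0}
      add_mem' := fun {s t} hs ht => ⟨add_mem hs.1 ht.1, fun q h => by
        rw [map_add, hs.2 q h, ht.2 q h, add_zero]⟩
      zero_mem' := ⟨zero_mem _, fun q _ => map_zero _⟩
      smul_mem' := fun c s hs => ⟨Submodule.smul_mem _ c hs.1, fun q h => by
        rw [map_smul, hs.2 q h, smul_zero]⟩ }
  have hOP : ∀ s ∈ O, parityMap K M s ∈ O := fun s hs => ⟨hRP s hs.1, fun q h => by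
    rw [hP q s hs.1, hs.2 q h, map_zero, smul_zero]⟩
  have hOa : ∀ (j : ZMod 2) (x : g), x ∈ deg (K := K) j → ∀ s ∈ O, τ.act x s ∈ O :=
    fun j x hx s hs => ⟨hRa x s hs.1, fun q h => by
      rw [ha q hx s hs.1, hs.2 q h, map_zero, smul_zero]⟩
  have hOinj : ∀ s ∈ O, f q s = 0 → s = 0 := by
    intro s hs h0
    by_contra hs0
    refine hmin s ⟨hs.1, hs0⟩ ?_
    refine Set.ncard_lt_ncard ⟨fun q' hq' h => hq' (hs.2 q' h), fun hsub => hsub hq h0⟩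
      (hfin r hr)
  have hOinj' : ∀ s ∈ O, ∀ t ∈ O, f q s = f q t → s = t := fun s hs t ht h =>
    sub_eq_zero.mp (hOinj _ (sub_mem hs ht) (by rw [map_sub, h, sub_self]))
  have hsurj : O.map (f q) = ⊤ := by
    refine (hσ.eq_bot_or_eq_top ?_ ?_).resolve_left ?_
    · rintro _ ⟨s, hs, rfl⟩
      refine ⟨_, Submodule.smul_mem _ (koszulSign K (δ q) 1) (hOP s hs), ?_⟩
      rw [map_smul, hP q s hs.1, smul_smul, koszulSign_mul_self, one_smul]
    · rintro j x hx _ ⟨s, hs, rfl⟩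
      refine ⟨_, Submodule.smul_mem _ (koszulSign K j (δ q)) (hOa j x hx s hs), ?_⟩
      rw [map_smul, ha q hx s hs.1, smul_smul, koszulSign_mul_self, one_smul]
    · intro h
      have : f q r ∈ O.map (f q) := ⟨r, ⟨hr, fun _ h => h⟩, rfl⟩
      rw [h] at this
      exact hq ((Submodule.mem_bot K).mp this)
  let e : O ≃ₗ[K] U := LinearEquiv.ofBijective (f q ∘ₗ O.subtype)
    ⟨fun s t h => Subtype.ext (hOinj' _ s.2 _ t.2 h), fun u => by
      have : u ∈ O.map (f q) := hsurj ▸ trivial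
      obtain ⟨s, hs, h⟩ := this
      exact ⟨⟨s, hs⟩, h⟩⟩
  have hT : ∀ u, f q (e.symm u).1 = u := fun u => e.apply_symm_apply u
  refine ⟨q, O.subtype ∘ₗ e.symm.toLinearMap, fun u => (e.symm u).2.1, hT, ?_, ?_⟩
  · intro u
    refine hOinj' _ (Subtype.prop _) _ (Submodule.smul_mem _ _ (hOP _ (Subtype.prop _))) ?_
    change f q (e.symm _).1 = f q (koszulSign K (δ q) 1 • parityMap K M (e.symm u).1)
    rw [map_smul, hP q _ (e.symm u).2.1, hT, hT, smul_smul, koszulSign_mul_self, one_smul]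
  · intro j x hx u
    refine hOinj' _ (Subtype.prop _) _ (Submodule.smul_mem _ _ (hOa j x hx _ (Subtype.prop _))) ?_
    change f q (e.symm _).1 = f q (koszulSign K j (δ q) • τ.act x (e.symm u).1)
    rw [map_smul, ha q hx _ (e.symm u).2.1, hT, hT, smul_smul, koszulSign_mul_self, one_smul]

end embedding

section copies

variable {K : Type*} {g : Type*} {U : Type*} {W : Type w} [Field K] [AddCommGroup g]
  [Module K g] [SuperSpace K g] [LieSuperalgebra K g] [AddCommGroup U] [Module K U]
  [SuperSpace K U] [AddCommGroup W] [Module K W] [SuperSpace K W]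

/-- A direct sum of copies of `U` (up to parity) has enough projections to `U`. -/
theorem IsSumOfCopies.exists_projections {ρ : SuperRep K g W} {σ : SuperRep K g U}
    (h : ρ.IsSumOfCopies σ) : ∃ (Λ : Type w) (d : Λ → ZMod 2) (pr : Λ → W →ₗ[K] U),
      (∀ l, IsSuperHom ρ σ (d l) (pr l)) ∧ (∀ w, (∀ l, pr l w = 0) → w = 0) ∧
      ∀ w, {l | pr l w ≠ 0}.Finite := by
  classical
  obtain ⟨Λ, d, e, hd, he⟩ := h
  have hind : ∀ (P : W → Prop), P 0 → (∀ v w, P v → P w → P (v + w)) →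
      (∀ l u, P (e (Finsupp.single l u))) → ∀ w, P w := by
    intro P h0 hadd hs w
    obtain ⟨v, rfl⟩ := e.surjective w
    induction v using Finsupp.induction_linear with
    | zero => rwa [map_zero]
    | add v w hv hw => rw [map_add]; exact hadd _ _ hv hw
    | single l u => exact hs l u
  have hpar : ∀ l u, parityMap K W (e (Finsupp.single l u)) =
      koszulSign K (d l) 1 • e (Finsupp.single l (parityMap K U u)) := by
    intro l u
    obtain ⟨u₀, h₀, u₁, h₁, rfl⟩ := SuperSpace.exists_add K u
    have e₀ := parityMap_apply (hd l 0 u₀ h₀)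
    have e₁ := parityMap_apply (hd l 1 u₁ h₁)
    simp only [LinearMap.comp_apply, Finsupp.lsingle_apply, LinearEquiv.coe_coe] at e₀ e₁
    rw [Finsupp.single_add, map_add, map_add, e₀, e₁, map_add, parityMap_apply h₀,
      parityMap_apply h₁, koszulSign_add_left, koszulSign_add_left]
    simp only [Finsupp.single_add, map_add, ← Finsupp.smul_single, map_smul, smul_smul, smul_add]
  refine ⟨Λ, d, fun l => Finsupp.lapply l ∘ₗ e.symm.toLinearMap, fun l => ⟨?_, ?_⟩, ?_, ?_⟩
  · refine hind _ (by simp) (fun v w hv hw => by simp only [map_add, hv, hw, smul_add]) ?_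
    intro l' u
    simp only [hpar, map_smul, LinearMap.comp_apply, LinearEquiv.coe_coe,
      LinearEquiv.symm_apply_apply, Finsupp.lapply_apply]
    by_cases hl : l' = l
    · subst hl; simp
    · simp [Finsupp.single_eq_of_ne' hl]
  · intro j x hx
    refine hind _ (by simp) (fun v w hv hw => by simp only [map_add, hv, hw, smul_add]) ?_
    intro l' u
    have e1 : ρ.act x (e (Finsupp.single l' u)) =
        koszulSign K j (d l') • e (Finsupp.single l' (σ.act x u)) := by
      rw [he l' j x hx u, smul_smul, koszulSign_mul_self, one_smul]
    simp only [e1, map_smul, LinearMap.comp_apply, LinearEquiv.coe_coe,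
      LinearEquiv.symm_apply_apply, Finsupp.lapply_apply]
    by_cases hl : l' = l
    · subst hl; simp
    · simp [Finsupp.single_eq_of_ne' hl]
  · intro w hw
    rw [← e.symm.map_eq_zero_iff]
    ext l
    exact hw l
  · intro w
    refine (e.symm w).support.finite_toSet.subset fun l hl => ?_
    exact Finsupp.mem_support_iff.mpr hl

end copies

section commutator

variable {K : Type*} {g : Type*} {U : Type*} [Field K] [CharZero K]
  [AddCommGroup g] [Module K g] [SuperSpace K g] [LieSuperalgebra K g]
  [AddCommGroup U] [Module K U] [SuperSpace K U] {k : LieSubsuperalgebra K g} {hk : k.IsIdeal}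
  {σ : SuperRep K k U}

theorem stabilizes_of_commutator {i : ZMod 2} {y : g} (hy : y ∈ deg (K := K) i)
    (s : U →ₗ[K] U) (hP : ∀ u, s (parityMap K U u) = koszulSign K i 1 • parityMap K U (s u))
    (hs : ∀ {j : ZMod 2} {x : k}, x ∈ deg (K := K) j → ∀ u, σ.act (adIdeal hk y x) u =
      s (σ.act x u) - koszulSign K i j • σ.act x (s u)) : Stabilizes k hk σ i y := by
  refine ⟨hy, s, fun j u hu => ?_, fun j x hx => LinearMap.ext fun u => hs hx u⟩
  rw [mem_deg_iff] at hu ⊢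
  have := hP u
  rw [hu, map_smul] at this
  rw [koszulSign_add_left, ← smul_smul, this, smul_smul, koszulSign_mul_self, one_smul]

end commutator

section separation

variable {K : Type*} {g : Type*} {U : Type*} [Field K] [IsAlgClosed K] [CharZero K]
  [AddCommGroup g] [Module K g] [FiniteDimensional K g] [SuperSpace K g] [LieSuperalgebra K g]
  [AddCommGroup U] [Module K U] [SuperSpace K U] {k : LieSubsuperalgebra K g} {hk : k.IsIdeal}
  {σ : SuperRep K k U}

theorem IsSuperHom.smul {g U V : Type*} {K : Type*} [Field K] [AddCommGroup g] [Module K g]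
    [SuperSpace K g] [LieSuperalgebra K g] [AddCommGroup U] [Module K U] [SuperSpace K U]
    [AddCommGroup V] [Module K V] [SuperSpace K V] {σ : SuperRep K g U} {τ : SuperRep K g V}
    {i : ZMod 2} {f : U →ₗ[K] V} (hf : IsSuperHom σ τ i f) (c : K) :
    IsSuperHom σ τ i (c • f) where
  parity u := by simp [hf.parity, smul_comm c]
  act hx u := by simp [hf.act hx, smul_comm c]

/-- The composite `ε⁻¹ θ` has degree `i + i = 0`, so Schur's lemma applies to it. In particular the
odd endomorphisms form a space of dimension at most one. -/
theorem IsSuperHom.eq_smul_of_ne_zero (hσ : σ.IsSimple) {i : ZMod 2} {ε θ : U →ₗ[K] U}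
    (hε : IsSuperHom σ σ i ε) (hε0 : ε ≠ 0) (hθ : IsSuperHom σ σ i θ) : ∃ c : K, θ = c • ε := by
  let e : U ≃ₗ[K] U := LinearEquiv.ofBijective ε (hε.bijective hσ hε0)
  have he : ∀ u, e u = ε u := fun _ => rfl
  have hinv : IsSuperHom σ σ i e.symm.toLinearMap := by
    constructor
    · intro u
      obtain ⟨v, rfl⟩ := e.surjective u
      apply e.injective
      simp only [LinearEquiv.coe_coe, LinearEquiv.symm_apply_apply, LinearEquiv.apply_symm_apply,
        map_smul]
      rw [he, he, hε.parity, smul_smul, koszulSign_mul_self, one_smul]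
    · intro j x hx u
      obtain ⟨v, rfl⟩ := e.surjective u
      apply e.injective
      simp only [LinearEquiv.coe_coe, LinearEquiv.symm_apply_apply, LinearEquiv.apply_symm_apply,
        map_smul]
      rw [he, he, hε.act hx, smul_smul, koszulSign_mul_self, one_smul]
  have h0 := hinv.comp hθ
  have hi : i + i = 0 := by rcases zmodTwo_cases i with rfl | rfl <;> decide
  rw [hi] at h0
  obtain ⟨c, hc⟩ := hσ.exists_eq_smul h0
  refine ⟨c, LinearMap.ext fun u => ?_⟩
  have h1 : e (e.symm (θ u)) = e (c • u) := congrArg e (LinearMap.congr_fun hc u)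
  rwa [LinearEquiv.apply_symm_apply, map_smul] at h1

/-- If a combination of the derivations attached to homogeneous elements `y q`, with coefficients
in the super endomorphisms of `σ`, is inner, then the terms with scalar coefficients add up to an
element of the stabilizer. -/
theorem IsSimple.exists_stabilizes (hσ : σ.IsSimple) {Q : Type*} [Fintype Q] (y : Q → g)
    (π : Q → ZMod 2) (hy : ∀ q, y q ∈ deg (K := K) (π q)) (i : ZMod 2) (θ : Q → U →ₗ[K] U)
    (hθ : ∀ q, IsSuperHom σ σ (i + π q) (θ q)) (ψ : U →ₗ[K] U)
    (hψ : ∀ u, ψ (parityMap K U u) = koszulSign K i 1 • parityMap K U (ψ u))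
    (hE : ∀ {j : ZMod 2} {x : k}, x ∈ deg (K := K) j → ∀ u,
      ∑ q, koszulSign K j (i + π q) • σ.act (adIdeal hk (y q) x) (θ q u) =
        koszulSign K i j • σ.act x (ψ u) - ψ (σ.act x u)) :
    ∃ c : Q → K, (∀ q, π q = i → θ q = c q • LinearMap.id) ∧ (∀ q, π q ≠ i → c q = 0) ∧
      Stabilizes k hk σ i (∑ q, c q • y q) := by
  have hii : ∀ i : ZMod 2, i + i = 0 := fun i => by
    rcases zmodTwo_cases i with rfl | rfl <;> decide
  have hne : ∀ j : ZMod 2, j ≠ i → i + j = 1 := fun j hj => by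
    rcases zmodTwo_cases i with rfl | rfl <;> rcases zmodTwo_cases j with rfl | rfl <;>
      simp_all
  -- Only the `y q` of parity `i` have even coefficients, which are scalars; the others have odd
  -- coefficients and do not contribute to the stabilizing element.
  have hc : ∀ q, ∃ c : K, (π q = i → θ q = c • LinearMap.id) ∧ (π q ≠ i → c = 0) := by
    intro q
    by_cases h : π q = i
    · have h1 := hθ q
      rw [h, hii] at h1
      obtain ⟨c, hc⟩ := hσ.exists_eq_smul h1
      exact ⟨c, fun _ => hc, fun h' => absurd h h'⟩
    · exact ⟨0, fun h' => absurd h' h, fun _ => rfl⟩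
  choose c hc1 hc0 using hc
  refine ⟨c, hc1, hc0, ?_⟩
  have hmem : ∑ q, c q • y q ∈ deg (K := K) i := by
    refine sum_mem fun q _ => ?_
    by_cases h : π q = i
    · rw [← h]; exact Submodule.smul_mem _ _ (hy q)
    · rw [hc0 q h, zero_smul]; exact zero_mem _
  have hsum : ∀ (x : k) (u : U), σ.act (adIdeal hk (∑ q, c q • y q) x) u =
      ∑ q, c q • σ.act (adIdeal hk (y q) x) u := by
    intro x u
    simp only [map_sum, map_smul, LinearMap.sum_apply, LinearMap.smul_apply]
  -- the part of the equation with odd coefficients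
  let o : k → U → U := fun x u => ∑ q, if π q = i then 0 else σ.act (adIdeal hk (y q) x) (θ q u)
  have hE' : ∀ {j : ZMod 2} {x : k}, x ∈ deg (K := K) j → ∀ u,
      σ.act (adIdeal hk (∑ q, c q • y q) x) u + koszulSign K j 1 • o x u =
        koszulSign K i j • σ.act x (ψ u) - ψ (σ.act x u) := by
    intro j x hx u
    rw [← hE hx u, hsum, Finset.smul_sum, ← Finset.sum_add_distrib]
    refine Finset.sum_congr rfl fun q _ => ?_
    by_cases h : π q = i
    · rw [if_pos h, hc1 q h, h, hii]; simp
    · rw [if_neg h, hc0 q h, hne _ h]; simp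
  by_cases hodd : ∀ q, π q ≠ i → θ q = 0
  · refine stabilizes_of_commutator hmem (-ψ) (fun u => by simp [hψ]) fun {j x} hx u => ?_
    have ho : o x u = 0 := Finset.sum_eq_zero fun q _ => by
      by_cases h : π q = i
      · rw [if_pos h]
      · rw [if_neg h, hodd q h]; simp
    have := hE' hx u
    rw [ho, smul_zero, add_zero] at this
    rw [this]
    simp only [LinearMap.neg_apply, map_neg, smul_neg]
    abel
  · push Not at hodd
    obtain ⟨q₁, hq₁, h0⟩ := hodd
    have hε := hθ q₁
    rw [hne _ hq₁] at hε
    set ε := θ q₁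
    let e : U ≃ₗ[K] U := LinearEquiv.ofBijective ε (hε.bijective hσ h0)
    have he : ∀ u, e u = ε u := fun _ => rfl
    have hεc : ∀ q, π q ≠ i → ∀ u, ε (θ q u) = θ q (ε u) := by
      intro q hq u
      have h1 := hθ q
      rw [hne _ hq] at h1
      obtain ⟨a, ha⟩ := hε.eq_smul_of_ne_zero hσ h0 h1
      rw [ha]; simp
    have hoε : ∀ {j : ZMod 2} {x : k}, x ∈ deg (K := K) j → ∀ u,
        ε (o x u) = koszulSign K (i + 1 + j) 1 • o x (ε u) := by
      intro j x hx u
      simp only [o]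
      rw [map_sum, Finset.smul_sum]
      refine Finset.sum_congr rfl fun q _ => ?_
      by_cases h : π q = i
      · simp [h]
      · have hπ : π q = i + 1 := by
          rw [← hne _ h, ← add_assoc, hii, zero_add]
        rw [if_neg h, if_neg h, hε.act (AdaptedBasis.adIdeal_mem hk (hy q) hx), hεc q h, hπ]
    -- The conjugate of `ψ` under `ε`; the average of `ψ` and `ψ'` will take the place of `ψ`.
    let ψ' : U →ₗ[K] U := koszulSign K i 1 • (ε ∘ₗ ψ ∘ₗ e.symm.toLinearMap)
    have hψ'e : ∀ u, ψ' (ε u) = koszulSign K i 1 • ε (ψ u) := by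
      intro u
      change koszulSign K i 1 • ε (ψ (e.symm (e u))) = _
      rw [LinearEquiv.symm_apply_apply]
    have hsurj : ∀ v, ∃ u, ε u = v := e.surjective
    refine stabilizes_of_commutator hmem (-(2⁻¹ : K) • (ψ + ψ')) (fun v => ?_)
      fun {j x} hx v => ?_
    · obtain ⟨u, rfl⟩ := hsurj v
      have h1 : parityMap K U (ε u) = koszulSign K 1 1 • ε (parityMap K U u) := by
        rw [hε.parity, smul_smul, koszulSign_mul_self, one_smul]
      have h2 : ψ' (parityMap K U (ε u)) = koszulSign K i 1 • parityMap K U (ψ' (ε u)) := by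
        rw [h1, map_smul, hψ'e, hψ, hψ'e]
        simp only [map_smul, hε.parity, smul_smul]
        congr 1
        rcases zmodTwo_cases i with rfl | rfl <;> simp
      clear_value ψ'
      rw [LinearMap.smul_apply, LinearMap.add_apply, hψ, h2, LinearMap.smul_apply,
        LinearMap.add_apply, map_smul, map_add, ← smul_add, smul_comm]
    · obtain ⟨u, rfl⟩ := hsurj v
      have h1 := hE' hx (ε u)
      have h2 := congrArg ε (hE' hx u)
      rw [map_add, map_smul, hε.act (AdaptedBasis.adIdeal_mem hk hmem hx), hoε hx, map_sub,
        map_smul, hε.act hx] at h2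
      have h3 : σ.act x (ε u) = koszulSign K j 1 • ε (σ.act x u) := by
        rw [hε.act hx, smul_smul, koszulSign_mul_self, one_smul]
      have h4 : ψ' (σ.act x (ε u)) = (koszulSign K j 1 * koszulSign K i 1) • ε (ψ (σ.act x u)) := by
        rw [h3, map_smul, hψ'e, smul_smul]
      have h5 : ε (ψ (σ.act x u)) = (koszulSign K j 1 * koszulSign K i 1) •
          ψ' (σ.act x (ε u)) := by
        rw [h4, smul_smul, mul_mul_mul_comm, koszulSign_mul_self, koszulSign_mul_self, one_mul,
          one_smul]
      have h6 : ε (ψ u) = koszulSign K i 1 • ψ' (ε u) := by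
        rw [hψ'e, smul_smul, koszulSign_mul_self, one_smul]
      rw [h5, h6, map_smul] at h2
      simp only [LinearMap.smul_apply, LinearMap.add_apply, map_smul, map_add]
      generalize σ.act (adIdeal hk (∑ q, c q • y q) x) (ε u) = D at *
      generalize o x (ε u) = O at *
      generalize σ.act x (ψ (ε u)) = A at *
      generalize ψ (σ.act x (ε u)) = A' at *
      generalize σ.act x (ψ' (ε u)) = C at *
      generalize ψ' (σ.act x (ε u)) = C' at *
      clear h3 h4 h5 h6
      -- The mean of the equation and its conjugate, with the sign of the conjugate normalised so
      -- that the two contributions of `O` cancel.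
      have e2 : D = (2⁻¹ : K) • (D + koszulSign K j 1 • O) + (2⁻¹ : K) •
          koszulSign K (i + j) 1 • (koszulSign K (i + j) 1 • D + koszulSign K j 1 •
            koszulSign K (i + 1 + j) 1 • O) := by
        rcases zmodTwo_cases i with rfl | rfl <;> rcases zmodTwo_cases j with rfl | rfl <;>
          simp [zmodTwo_one_add_one] <;> module
      rw [e2, h1, h2]
      rcases zmodTwo_cases i with rfl | rfl <;> rcases zmodTwo_cases j with rfl | rfl <;>
        simp [zmodTwo_one_add_one] <;> module

end separation

end SuperRep

end

/-! ### Lowering the degree and simplicity of the induced representation -/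

noncomputable section
open SuperSpace (deg)
open LieSuperalgebra (br)

/-- The lexicographic sum places the basis vectors of `h` after all the others. -/
theorem AdaptedBasis.exists_fin {K : Type*} {g : Type*} [Field K] [CharZero K] [AddCommGroup g]
    [Module K g] [FiniteDimensional K g] [SuperSpace K g] [LieSuperalgebra K g]
    (h : LieSubsuperalgebra K g) :
    ∃ m r : ℕ, Nonempty (AdaptedBasis h (Fin m ⊕ₗ Fin r)) := by
  obtain ⟨m, r, z, p, hz, hspan⟩ := exists_adapted_basis h.homogeneous
  refine ⟨m, r, ⟨{
    z := z.reindex toLex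
    p := fun a => p (ofLex a)
    z_mem := fun a => by rw [Module.Basis.reindex_apply]; exact hz _
    isSub := fun a => ∃ i, a = toLex (Sum.inr i)
    mem_sub := ?_
    le_span := ?_
    upper := ?_ }⟩⟩
  · rintro _ ⟨i, rfl⟩
    rw [Module.Basis.reindex_apply, ← hspan]
    exact Submodule.subset_span ⟨i, rfl⟩
  · rw [← hspan]
    refine Submodule.span_mono ?_
    rintro _ ⟨i, rfl⟩
    exact ⟨toLex (Sum.inr i), ⟨i, rfl⟩, by rw [Module.Basis.reindex_apply]; rfl⟩
  · rintro a b hab ⟨i, rfl⟩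
    induction b using Lex.rec with
    | _ b =>
    cases b with
    | inl j => exact absurd hab Sum.Lex.not_inr_le_inl
    | inr j => exact ⟨j, rfl⟩

namespace AdaptedBasis

set_option linter.unusedSectionVars false

section

variable {K : Type*} {g : Type*} [Field K] [AddCommGroup g] [Module K g]
  [SuperSpace K g] [LieSuperalgebra K g]
  {h : LieSubsuperalgebra K g} {ι : Type*} [LinearOrder ι] (B : AdaptedBasis h ι)

theorem repr_eq_zero {a : ι} (ha : ¬ B.isSub a) {y : g} (hy : y ∈ h.toSubmodule) :
    B.z.repr y a = 0 := by
  by_contra h0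
  have := (Module.Basis.mem_span_image B.z).mp (B.le_span hy)
  exact ha (this (Finsupp.mem_support_iff.mpr h0))

theorem Irr.eq_of_perm {l l' : List ι} (hl : B.Irr l) (hl' : B.Irr l') (hp : l.Perm l') :
    l = l' := by
  refine hp.eq_of_pairwise (fun a b _ _ h1 h2 => ?_) hl.1 hl'.1
  rcases h1 with h1 | h1
  · rcases h2 with h2 | h2
    · exact absurd h1 (lt_asymm h2)
    · exact h2.1.symm
  · exact h1.1

/-- For even `a` all signs are `1` and the sum counts positions, including the first, hence is
nonzero in characteristic zero. For odd `a` no letter `a` repeats, so only the first position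
contributes. -/
theorem sum_insertIdx_ne_zero [CharZero K] {a : ι} {β : List ι} (hl : B.Irr (a :: β))
    (d : ZMod 2) :
    ∑ i : Fin (β.length + 1), (if β.insertIdx i a = a :: β then
      koszulSign K (B.p a) d * koszulSign K (B.p a) (B.par (β.drop i)) else 0) ≠ 0 := by
  rcases zmodTwo_cases (B.p a) with hp | hp
  · simp only [hp, koszulSign_zero_left, mul_one]
    rw [Finset.sum_boole, Nat.cast_ne_zero, Finset.card_ne_zero]
    exact ⟨0, by simp⟩
  · rw [Finset.sum_eq_single (0 : Fin (β.length + 1))]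
    · simp only [Fin.val_zero, List.insertIdx_zero, if_true]
      exact mul_ne_zero (SuperRep.koszulSign_ne_zero _ _) (SuperRep.koszulSign_ne_zero _ _)
    · intro i _ hi
      rw [if_neg]
      intro heq
      obtain ⟨i', rfl⟩ := Fin.exists_succ_eq.mpr hi
      cases β with
      | nil => exact i'.elim0
      | cons b β =>
        rw [Fin.val_succ, List.insertIdx_succ_cons, List.cons.injEq] at heq
        rcases (List.pairwise_cons.mp hl.1).1 b (List.mem_cons_self) with h1 | h1
        · exact absurd heq.1 h1.ne'
        · rw [hp] at h1
          exact one_ne_zero h1.2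
    · simp

end

variable {K : Type*} {g : Type*} {U : Type*} {W : Type*} [Field K] [CharZero K] [AddCommGroup g]
  [Module K g] [SuperSpace K g] [LieSuperalgebra K g] [AddCommGroup U] [Module K U]
  [SuperSpace K U] [AddCommGroup W] [Module K W] [SuperSpace K W]

/-- Unlike a general element of `g`, an element of the ideal does not raise the degree: brackets
with it stay in `k` and end up acting on `W`. -/
theorem indAct_mem_filt_of_ideal {h k : LieSubsuperalgebra K g} {ι : Type*} [LinearOrder ι]
    (B : AdaptedBasis h ι) (ρ : SuperRep K h W) (hkh : k.toSubmodule ≤ h.toSubmodule)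
    (hk : k.IsIdeal) (x : k) {n : ℕ} {t : ρ.IndSpace} (ht : t ∈ B.filt ρ n) :
    ρ.indAct x.1 t ∈ B.filt ρ n := by
  have hom : ∀ {j : ZMod 2} {x : k}, x ∈ deg (K := K) j →
      B.filt ρ n ≤ (B.filt ρ n).comap (ρ.indAct x.1) := by
    intro j x hx
    refine Submodule.span_le.mpr ?_
    rintro _ ⟨l, w, hl, rfl⟩
    have h1 := B.filt_mono ρ (show l.length - 1 ≤ n by omega)
      (B.indAct_indWord_sub_mem ρ hk hkh l hx w)
    have h2 := B.filt_mono ρ hl.le (B.firstOrder_mem ρ hk hkh x l w)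
    exact (Submodule.sub_mem_iff_left _ (Submodule.smul_mem _ _
      (sub_mem (B.indWord_mem_filt ρ hl _) h2))).mp h1
  obtain ⟨x₀, h₀, x₁, h₁, rfl⟩ := SuperSpace.exists_add K x
  rw [Submodule.coe_add, map_add]
  exact add_mem (hom h₀ ht) (hom h₁ ht)

variable [IsAlgClosed K] [FiniteDimensional K g] {k : LieSubsuperalgebra K g} {hk : k.IsIdeal}
  {σ : SuperRep K k U} {ι : Type*} [LinearOrder ι] [Fintype ι]
  (B : AdaptedBasis (stabilizer k hk σ) ι) {ρ : SuperRep K (stabilizer k hk σ) W}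

/-- A subrepresentation of the induced representation which has no nonzero element of degree at
most `n` has no nonzero element of degree `n + 1`. -/
theorem inf_filt_succ_eq_bot (hσ : σ.IsSimple)
    (hW : (ρ.restrict (le_stabilizer k hk σ)).IsSumOfCopies σ) {N : Submodule K ρ.IndSpace}
    (hNP : ∀ t ∈ N, parityMap K ρ.IndSpace t ∈ N) (hNa : ∀ x, ∀ t ∈ N, ρ.indAct x t ∈ N) {n : ℕ}
    (h0 : N ⊓ B.filt ρ (n + 1) = ⊥) : N ⊓ B.filt ρ (n + 2) = ⊥ := by
  classical
  by_contra hR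
  obtain ⟨Λ, d, pr, hpr, hinj, hfin⟩ := hW.exists_projections
  -- By `h0` an element of `N` of degree at most `n + 1` is determined by its top coordinates.
  -- Followed by the projections `W → U`, these are super homomorphisms for `k`, so a copy of `U`
  -- can be found.
  obtain ⟨⟨⟨l, hl⟩, lam⟩, T, hTR, hT, hTs⟩ := hσ.exists_embedding (ρ.ind.toSub k)
    (R := N ⊓ B.filt ρ (n + 2)) (fun t ht => ⟨hNP t ht.1, B.parityMap_mem_filt ρ ht.2⟩)
    (fun x t ht => ⟨hNa _ t ht.1,
      B.indAct_mem_filt_of_ideal ρ (le_stabilizer k hk σ) hk x ht.2⟩) hR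
    (Q := {l : List ι // l.length = n + 1} × Λ) (fun q => pr q.2 ∘ₗ B.coef ρ q.1.1)
    (fun q => B.par q.1.1 + d q.2)
    (fun q t ht => by
      rw [LinearMap.comp_apply, coef_parityMap, map_smul, (hpr q.2).parity, smul_smul,
        ← koszulSign_add_left]; rfl)
    (fun q j x hx t ht => by
      have ht' : t ∈ B.filt ρ (q.1.1.length + 1) := by rw [q.1.2]; exact ht.2
      have e := B.coef_indAct_top ρ (le_stabilizer k hk σ) hk hx ht'
      rw [LinearMap.comp_apply, LinearMap.comp_apply, koszulSign_add_right, mul_smul,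
        ← (hpr q.2).act hx, ← map_smul, ← e]; rfl)
    (fun t ht h => by
      have hm := B.mem_filt_of_coef_eq_zero ρ ht.2 fun l hl => hinj _ fun lam => h (⟨l, hl⟩, lam)
      exact (Submodule.mem_bot K).mp (h0 ▸ ⟨ht.1, hm⟩))
    (fun t ht => by
      have : Finite {l : List ι // l.length = n + 1} := List.finite_length_eq ι (n + 1)
      refine (Set.finite_iUnion fun l : {l : List ι // l.length = n + 1} =>
        (hfin (B.coef ρ l.1 t)).image (Prod.mk l)).subset ?_
      rintro ⟨l, lam⟩ h
      exact Set.mem_iUnion.mpr ⟨l, lam, h, rfl⟩)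
  simp only [LinearMap.comp_apply] at hT hTs
  have := hσ.1
  obtain ⟨u₀, hu₀⟩ := exists_ne (0 : U)
  -- Coordinates at reducible words vanish identically, whereas this one recovers every `u`.
  have hirr : B.Irr l := by
    by_contra hirr
    refine hu₀ ?_
    rw [← hT u₀, coef_of_not_irr B ρ hirr, map_zero]
  cases l with
  | nil => simp at hl
  | cons a β =>
  obtain rfl : β.length = n := by simpa using hl
  have hTf : ∀ u, T u ∈ B.filt ρ (β.length + 2) := fun u => (hTR u).2
  have hlen : ∀ q : ι × Fin (β.length + 1), (β.insertIdx q.2 q.1).length = β.length + 1 :=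
    fun q => List.length_insertIdx_of_le_length (Nat.lt_succ_iff.mp q.2.2) _
  have hperm : ∀ q : ι × Fin (β.length + 1), (β.insertIdx q.2 q.1).Perm (q.1 :: β) :=
    fun q => List.perm_insertIdx q.1 β (Nat.lt_succ_iff.mp q.2.2)
  -- The contributions of `β` and of the copy `lam` to the degree occur twice and cancel, which
  -- leaves the parities of the two letters.
  have htop : ∀ q : ι × Fin (β.length + 1), SuperRep.IsSuperHom σ σ (B.p a + B.p q.1)
      (pr lam ∘ₗ B.coef ρ (β.insertIdx q.2 q.1) ∘ₗ T) := by
    intro q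
    have hpar : B.par (β.insertIdx q.2 q.1) = B.p q.1 + B.par β := by
      rw [← par_cons]
      exact ((hperm q).map B.p).sum_eq
    have hdeg : ∀ j, koszulSign K j (B.p a + B.p q.1) = koszulSign K j (B.par (a :: β) + d lam) *
        (koszulSign K j (B.par (β.insertIdx q.2 q.1)) * koszulSign K j (d lam)) := by
      intro j
      rw [hpar, par_cons]
      simp only [koszulSign_add_right]
      linear_combination (-koszulSign K j (B.p a) * koszulSign K j (B.p q.1)) *
        (koszulSign_mul_self (K := K) j (d lam)) * (koszulSign K j (B.par β) ^ 2) -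
        koszulSign K j (B.p a) * koszulSign K j (B.p q.1) *
          koszulSign_mul_self (K := K) j (B.par β)
    constructor
    · intro u
      rw [koszulSign_comm, hdeg]
      simp only [LinearMap.comp_apply]
      rw [hTs.parity, map_smul, map_smul, coef_parityMap, map_smul, (hpr lam).parity, smul_smul,
        smul_smul]
      simp only [koszulSign_comm (K := K) (1 : ZMod 2), mul_assoc]
    · intro j x hx u
      rw [hdeg]
      simp only [LinearMap.comp_apply]
      have e := B.coef_indAct_top ρ (le_stabilizer k hk σ) hk hx (t := T u)
        (l := β.insertIdx q.2 q.1) (by rw [hlen q]; exact hTf u)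
      rw [hTs.act hx, map_smul, map_smul]
      change _ • pr lam (B.coef ρ _ (ρ.indAct x.1 (T u))) = _
      rw [e, map_smul, (hpr lam).act hx, smul_smul, smul_smul, mul_assoc]
  -- The equation required is the coordinate at `β` of the homomorphism property of `T`, projected
  -- to the copy `lam`. The signs in the coefficients are those left over once the degrees of `T`
  -- and of the projection are accounted for.
  obtain ⟨c, hc1, hc0, hst⟩ := hσ.exists_stabilizes (hk := hk) (fun q => B.z q.1)
    (fun q => B.p q.1) (fun q => B.z_mem _) (B.p a)
    (fun q : ι × Fin (β.length + 1) => (koszulSign K (B.p q.1) (d lam) *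
      koszulSign K (B.p q.1) (B.par (β.drop q.2))) •
        (pr lam ∘ₗ B.coef ρ (β.insertIdx q.2 q.1) ∘ₗ T))
    (fun q => (htop q).smul _) (pr lam ∘ₗ B.coef ρ β ∘ₗ T)
    (fun u => by
      simp only [LinearMap.comp_apply]
      rw [hTs.parity, map_smul, map_smul, coef_parityMap, map_smul, (hpr lam).parity, smul_smul,
        smul_smul, par_cons]
      congr 1
      simp only [koszulSign_add_left]
      linear_combination koszulSign K (B.p a) 1 * koszulSign K (d lam) 1 ^ 2 *
        koszulSign_mul_self (K := K) (B.par β) 1 + koszulSign K (B.p a) 1 *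
          koszulSign_mul_self (K := K) (d lam) 1)
    (fun {j x} hx u => by
      simp only [LinearMap.comp_apply, LinearMap.smul_apply]
      have e := B.coef_indAct ρ hk (le_stabilizer k hk σ) hx (hTf u)
      rw [hTs.act hx, map_smul, map_smul]
      change _ = _ - _ • pr lam (B.coef ρ _ (ρ.indAct x.1 (T u)))
      rw [e, map_sub, map_smul, (hpr lam).act hx, map_sum, smul_sub, smul_smul, smul_smul]
      have e1 : koszulSign K j (B.par (a :: β) + d lam) *
          (koszulSign K j (B.par β) * koszulSign K j (d lam)) = koszulSign K (B.p a) j := by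
        rw [par_cons, koszulSign_comm (B.p a) j]
        simp only [koszulSign_add_right]
        linear_combination koszulSign K j (B.p a) * koszulSign K j (d lam) ^ 2 *
          koszulSign_mul_self (K := K) j (B.par β) + koszulSign K j (B.p a) *
            koszulSign_mul_self (K := K) j (d lam)
      rw [mul_assoc, e1, sub_sub_cancel, Finset.smul_sum]
      refine Finset.sum_congr rfl fun q _ => ?_
      rw [map_smul, map_smul, (hpr lam).act (adIdeal_mem hk (B.z_mem q.1) hx), smul_smul,
        smul_smul, smul_smul]
      congr 1
      rw [par_cons]
      simp only [koszulSign_add_right, koszulSign_add_left]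
      linear_combination (-koszulSign K j (B.p a) * koszulSign K j (B.p q.1) *
        koszulSign K (B.p q.1) (d lam) * koszulSign K (B.p q.1) (B.par (β.drop q.2))) *
        (koszulSign K j (d lam) ^ 2 * koszulSign_mul_self (K := K) j (B.par β) +
          koszulSign_mul_self (K := K) j (d lam)))
  -- The element `∑ c q • z q` lies in `h`, while the letter `a` of the irreducible word does not
  -- belong to the final segment spanning `h`.
  have hY := B.repr_eq_zero (hirr.2 a List.mem_cons_self) (Submodule.subset_span ⟨_, hst⟩)
  refine B.sum_insertIdx_ne_zero hirr (d lam) (Eq.trans ?_ hY)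
  rw [map_sum, Finsupp.finsetSum_apply, Fintype.sum_prod_type, Finset.sum_eq_single a]
  · refine Finset.sum_congr rfl fun i _ => ?_
    have hci := LinearMap.congr_fun (hc1 (a, i) rfl) u₀
    simp only [LinearMap.comp_apply, LinearMap.smul_apply, LinearMap.id_apply] at hci
    have : c (a, i) • u₀ = (if β.insertIdx i a = a :: β then koszulSign K (B.p a) (d lam) *
        koszulSign K (B.p a) (B.par (β.drop i)) else 0) • u₀ := by
      rw [← hci]
      split_ifs with heq
      · rw [heq, hT]
      -- A rearrangement of `a :: β` other than itself is not sorted, hence reducible, and its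
      -- coordinate is zero.
      · rw [coef_of_not_irr, map_zero, smul_zero, zero_smul]
        exact fun h' => heq (h'.eq_of_perm B hirr (hperm (a, i)))
    rw [map_smul, Finsupp.smul_apply, B.z.repr_self, Finsupp.single_eq_same, smul_eq_mul, mul_one]
    exact (smul_left_injective K hu₀ this).symm
  · intro b _ hb
    refine Finset.sum_eq_zero fun i _ => ?_
    rw [map_smul, Finsupp.smul_apply, B.z.repr_self, Finsupp.single_eq_of_ne' hb, smul_zero]
  · simp

end AdaptedBasis

theorem mainTheorem9 {K : Type*} [Field K] [IsAlgClosed K] [CharZero K]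
    {g : Type*} [AddCommGroup g] [Module K g] [FiniteDimensional K g]
    [SuperSpace K g] [LieSuperalgebra K g]
    (k : LieSubsuperalgebra K g) (hk : k.IsIdeal)
    {U : Type*} [AddCommGroup U] [Module K U] [SuperSpace K U]
    (σ : SuperRep K k U) (hσ : σ.IsSimple)
    {W : Type*} [AddCommGroup W] [Module K W] [SuperSpace K W]
    (ρ : SuperRep K (stabilizer k hk σ) W) (hρ : ρ.IsSimple)
    (hW : (ρ.restrict (le_stabilizer k hk σ)).IsSumOfCopies σ) :
    ρ.ind.IsSimple := by
  classical
  obtain ⟨m, r, ⟨B⟩⟩ := AdaptedBasis.exists_fin (stabilizer k hk σ)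
  have hnil : B.Irr [] := ⟨List.Pairwise.nil, by simp⟩
  have hinj : ∀ w : W, B.indWord ρ [] w = 0 → w = 0 := fun w hw => by
    have := B.coef_indWord ρ hnil [] w
    rw [hw, map_zero, if_pos rfl] at this
    exact this.symm
  let f : W →ₗ[K] ρ.IndSpace := ρ.balancing.mkQ ∘ₗ TensorProduct.mk K _ _ 1
  have hf : ∀ w, f w = B.indWord ρ [] w := fun _ => rfl
  have hfilt : B.filt ρ 1 ≤ LinearMap.range f := by
    refine Submodule.span_le.mpr ?_
    rintro _ ⟨l, w, hl, rfl⟩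
    obtain rfl : l = [] := List.length_eq_zero_iff.mp (by omega)
    exact ⟨w, rfl⟩
  refine ⟨?_, fun N hN hNa => ?_⟩
  · have := hρ.1
    obtain ⟨w, hw⟩ := exists_ne (0 : W)
    exact ⟨_, 0, fun h => hw (hinj w h)⟩
  replace hN := isHomogeneousSub_iff.mp hN
  -- `filt ρ 1` is the image of `1 ⊗ W`, since only the empty word has length less than `1`.
  by_cases h1 : N ⊓ B.filt ρ 1 = ⊥
  · left
    have hall : ∀ n, N ⊓ B.filt ρ (n + 1) = ⊥ := by
      intro n
      induction n with
      | zero => exact h1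
      | succ n ih => exact B.inf_filt_succ_eq_bot hσ hW hN hNa ih
    rw [eq_bot_iff]
    intro t ht
    obtain ⟨n, hn⟩ := B.exists_mem_filt ρ t
    rw [← hall n]
    exact ⟨ht, B.filt_mono ρ n.le_succ hn⟩
  · right
    obtain ⟨t, ht, ht0⟩ := Submodule.exists_mem_ne_zero_of_ne_bot h1
    -- The vectors `w` with `1 ⊗ w ∈ N` form a nonzero graded `h`-subrepresentation of the simple
    -- representation `W`.
    have htop : N.comap f = ⊤ := by
      refine (hρ.eq_bot_or_eq_top (fun w hw => ?_) fun j x hx w hw => ?_).resolve_left fun h => ?_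
      · have := hN _ hw
        rw [hf, B.parityMap_indWord, B.par_nil, koszulSign_zero_left, one_smul] at this
        exact this
      · have := hNa x.1 _ hw
        change ρ.indAct x.1 (B.indWord ρ [] w) ∈ N at this
        rw [B.indAct_nil] at this
        exact this
      · obtain ⟨w, rfl⟩ := hfilt ht.2
        have hw : w ∈ N.comap f := ht.1
        rw [h, Submodule.mem_bot] at hw
        rw [hw, map_zero] at ht0
        exact ht0 rfl
    have hword : ∀ l w, B.indWord ρ l w ∈ N := by
      intro l w
      induction l with
      | nil =>
        have hw : w ∈ N.comap f := htop ▸ Submodule.mem_top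
        exact hw
      | cons a l ih =>
        rw [← B.indAct_indWord]
        exact hNa _ _ ih
    rw [eq_top_iff]
    intro t _
    obtain ⟨n, hn⟩ := B.exists_mem_filt ρ t
    refine Submodule.span_le.mpr ?_ hn
    rintro _ ⟨l, w, -, rfl⟩
    exact hword l w

end
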